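/- Let $q$ be a prime power, $F=\mathbb F_q(\!(t^{-1})\!)$ with uniformizer $\pi=t^{-1}$ and valuation ring $\mathcal O=\mathbb F_q[\![t^{-1}]\!]$, let $\Gamma=PGL_4(\mathbb F_q[t])$, and let $W$ be the image of $GL_4(\mathcal O)$ in $PGL_4(F)$. The vertices of the building $\mathcal B_4$ are the homothety classes of $\mathcal O$-lattices in $F^4$, that is, the cosets $gW\in PGL_4(F)/W$ (with $gW$ the class of $g\mathcal O^4$). Two vertices are adjacent if they are represented by lattices $L,L'$ with $\pi L\subsetneq L'\subsetneq L$, and the color is $\tau(gW)=\mathrm{ord}_\pi\det g\in\mathbb Z/4\mathbb Z$. Give the vertices and edges of $\Gamma\backslash\mathcal B_4$ the weights $w(v)=1/|\Gamma_v|$, $w(e)=1/|\Gamma_e|$, where $\Gamma_v,\Gamma_e$ are the stabilizers of lifts (for an edge, the intersection of the stabilizers of its two end points). Let $L^2_w(\Gamma\backslash\mathcal B_4)$ be the space of functions on the vertices with $\|f\|_{2,w}^2=\sum_v|f(v)|^2w(v)<\infty$, and for $i=1,2,3$ put $$A_{w,i}f(u)=\sum_{(u,v)\ \text{edge},\ \tau(v)=\tau(u)+i}\frac{w(u,v)}{w(u)}f(v).$$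 The automorphic simultaneous spectrum is the set of $(\lambda_1,\lambda_2,\lambda_3)\in\mathbb C^3$ for which there is a sequence $f_n\in L^2_w(\Gamma\backslash\mathcal B_4)$ with $\|f_n\|_{2,w}=1$ and $\|A_{w,i}f_n-\lambda_if_n\|_{2,w}\to0$ for $i=1,2,3$. **Theorem 1.2.** Let $(\lambda_1,\lambda_2,\lambda_3)$ be in the automorphic simultaneous spectrum and let $\mathbf z=(z_1,z_2,z_3,z_4)\in\mathbb C^4$ satisfy $z_1z_2z_3z_4=1$ and $\lambda_k=q^{k(4-k)/2}\sigma_k(\mathbf z)$ for $k=1,2,3$, where $\sigma_k$ is the $k$-th elementary symmetric polynomial. Then, up to a permutation of its entries, $\mathbf z$ is of one of the following forms: 1. $(q^{3/2}i^k,\ q^{1/2}i^k,\ q^{-1/2}i^k,\ q^{-3/2}i^k)$ with $k\in\{0,1,2,3\}$; 2. $(qe^{i\theta},\ e^{i\theta},\ e^{-3i\theta},\ q^{-1}e^{i\theta})$ with $\theta\in\mathbb R$; 3. $(\sqrt q\,e^{i\theta},\ \varepsilon\sqrt q\,e^{-i\theta},\ q^{-1/2}e^{i\theta},\ \varepsilon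 q^{-1/2}e^{-i\theta})$ with $\theta\in\mathbb R$ and $\varepsilon\in\{1,-1\}$; 4. $(\sqrt q\,e^{i\theta_1},\ e^{i\theta_2},\ e^{-i(\theta_2+2\theta_1)},\ q^{-1/2}e^{i\theta_1})$ with $\theta_1,\theta_2\in\mathbb R$; 5. $(e^{i\theta_1},\ e^{i\theta_2},\ e^{i\theta_3},\ e^{-i(\theta_1+\theta_2+\theta_3)})$ with $\theta_1,\theta_2,\theta_3\in\mathbb R$. The five forms correspond to the partitions $4$, $3+1$, $2+2$, $2+1+1$, $1+1+1+1$ of $4$: in each case the multiset $\{|z_1|,|z_2|,|z_3|,|z_4|\}$ is the union, over the parts $n$ of the corresponding partition, of $\{q^{(n-1)/2},q^{(n-3)/2},\dots,q^{(1-n)/2}\}$, and distinct partitions of $4$ give distinct multisets. -/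

import Mathlib

open Filter Topology
open scoped ENNReal LaurentSeries PowerSeries Pointwise MatrixGroups

noncomputable section

namespace Building

/-! ### The local field, the groups and the building

For a finite field `k` with `q` elements, `F = k((t⁻¹))` is realised as `k⸨X⸩` with uniformizer
`X = t⁻¹`, and its valuation ring is `O = k⟦X⟧`. -/

/-- The element `t = X⁻¹` of `F = k((t⁻¹))`. -/
def tElem (k : Type*) [Field k] : k⸨X⸩ := HahnSeries.single (-1 : ℤ) (1 : k)

/-- `W`, the image of `GL(4, O)` in `PGL(4, F)`. -/
def W (k : Type*) [Field k] : Subgroup PGL(4, k⸨X⸩) :=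
  ((Matrix.ProjGenLinGroup.mk (n := Fin 4) (R := k⸨X⸩)).comp
    (Matrix.GeneralLinearGroup.map (n := Fin 4) (algebraMap k⟦X⟧ k⸨X⸩))).range

/-- `Γ = PGL(4, k[t])`, the image of `GL(4, k[t])` in `PGL(4, F)`. -/
def Gam (k : Type*) [Field k] : Subgroup PGL(4, k⸨X⸩) :=
  ((Matrix.ProjGenLinGroup.mk (n := Fin 4) (R := k⸨X⸩)).comp
    (Matrix.GeneralLinearGroup.map (n := Fin 4)
      (Polynomial.aeval (R := k) (tElem k)).toRingHom)).range

/-- The vertices of the building: cosets `gW`, i.e. homothety classes of `O`-lattices in `F⁴`,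
the coset of `g` being the class of the lattice `g O⁴`. `PGL(4, F)` acts by left translation. -/
abbrev Vertex (k : Type*) [Field k] : Type _ := PGL(4, k⸨X⸩) ⧸ W k

/-- The vertex `[L_g]` attached to `g ∈ GL(4, F)`. -/
def vertexOf {k : Type*} [Field k] (g : GL (Fin 4) k⸨X⸩) : Vertex k :=
  QuotientGroup.mk (Matrix.ProjGenLinGroup.mk g)

/-- The `O`-lattice `L_g = g O⁴`, spanned over `O` by the columns of `g`. -/
def latticeOf {k : Type*} [Field k] (g : GL (Fin 4) k⸨X⸩) : Submodule k⟦X⟧ (Fin 4 → k⸨X⸩) :=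
  Submodule.span k⟦X⟧ (Set.range fun j : Fin 4 => fun i : Fin 4 => g.val i j)

/-- Two vertices `x`, `y` are joined by an edge when they are represented by lattices
`L`, `L'` with `π L ⊊ L' ⊊ L`. -/
def Adj {k : Type*} [Field k] (x y : Vertex k) : Prop :=
  ∃ g h : GL (Fin 4) k⸨X⸩, vertexOf g = x ∧ vertexOf h = y ∧
    (PowerSeries.X : k⟦X⟧) • latticeOf g < latticeOf h ∧ latticeOf h < latticeOf g

/-! ### The color of a vertex -/

/-- The order of vanishing (valuation normalised by `ord π = 1`), modulo `4`,
as a homomorphism on `Fˣ`. -/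
def ordHom (k : Type*) [Field k] : (k⸨X⸩)ˣ →* Multiplicative (ZMod 4) :=
  MonoidHom.mk' (fun x => Multiplicative.ofAdd ((HahnSeries.order (x : k⸨X⸩) : ℤ) : ZMod 4))
    (by
      intro x y
      rw [Units.val_mul, HahnSeries.order_mul x.ne_zero y.ne_zero, Int.cast_add, ofAdd_add])

/-- `g ↦ ord (det g) mod 4` on `GL(4, F)`. -/
def ordDetGL (k : Type*) [Field k] : GL (Fin 4) k⸨X⸩ →* Multiplicative (ZMod 4) :=
  (ordHom k).comp Matrix.GeneralLinearGroup.det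

theorem ordDetGL_center (k : Type*) [Field k] (g : GL (Fin 4) k⸨X⸩)
    (hg : g ∈ Subgroup.center (GL (Fin 4) k⸨X⸩)) : ordDetGL k g = 1 := by
  rw [Matrix.GeneralLinearGroup.center_eq_range_scalar] at hg
  obtain ⟨u, rfl⟩ := hg
  have h : Matrix.GeneralLinearGroup.det (Matrix.GeneralLinearGroup.scalar (Fin 4) u) = u ^ 4 := by
    ext
    simp [Matrix.GeneralLinearGroup.det]
  have h4 : ∀ a : Multiplicative (ZMod 4), a ^ 4 = 1 := by decide
  rw [ordDetGL, MonoidHom.comp_apply, h, map_pow, h4]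

/-- `g ↦ ord (det g) mod 4` on `PGL(4, F)`. -/
def ordDet (k : Type*) [Field k] : PGL(4, k⸨X⸩) →* Multiplicative (ZMod 4) :=
  QuotientGroup.lift (Subgroup.center (GL (Fin 4) k⸨X⸩)) (ordDetGL k) (ordDetGL_center k)

theorem order_unit (k : Type*) [Field k] (u : (k⟦X⟧)ˣ) :
    HahnSeries.order (algebraMap k⟦X⟧ k⸨X⸩ u) = 0 := by
  have key : ∀ v : (k⟦X⟧)ˣ, 0 ≤ HahnSeries.order (algebraMap k⟦X⟧ k⸨X⸩ v) := by
    intro v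
    by_contra! hlt
    have hv : algebraMap k⟦X⟧ k⸨X⸩ v ≠ 0 := by
      rw [Ne, FaithfulSMul.algebraMap_eq_zero_iff]
      exact v.ne_zero
    have h0 := HahnSeries.coeff_order_eq_zero.not.mpr hv
    apply h0
    change HahnSeries.coeff ((v : k⟦X⟧) : k⸨X⸩) _ = 0
    rw [PowerSeries.coeff_coe, if_pos hlt]
  have hu : algebraMap k⟦X⟧ k⸨X⸩ u ≠ 0 := by
    rw [Ne, FaithfulSMul.algebraMap_eq_zero_iff]
    exact u.ne_zero
  have hu' : algebraMap k⟦X⟧ k⸨X⸩ (u⁻¹ : (k⟦X⟧)ˣ) ≠ 0 := by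
    rw [Ne, FaithfulSMul.algebraMap_eq_zero_iff]
    exact (u⁻¹).ne_zero
  have hmul := HahnSeries.order_mul hu hu'
  rw [← map_mul, Units.mul_inv, map_one, HahnSeries.order_one] at hmul
  have h1 := key u
  have h2 := key u⁻¹
  omega

theorem ordDet_W (k : Type*) [Field k] (g : PGL(4, k⸨X⸩)) (hg : g ∈ W k) : ordDet k g = 1 := by
  obtain ⟨a, rfl⟩ := hg
  have h1 : ordDet k (Matrix.ProjGenLinGroup.mk
      (Matrix.GeneralLinearGroup.map (n := Fin 4) (algebraMap k⟦X⟧ k⸨X⸩) a))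
      = ordDetGL k (Matrix.GeneralLinearGroup.map (n := Fin 4) (algebraMap k⟦X⟧ k⸨X⸩) a) := rfl
  have h2 : ((Matrix.GeneralLinearGroup.det
      (Matrix.GeneralLinearGroup.map (n := Fin 4) (algebraMap k⟦X⟧ k⸨X⸩) a) : (k⸨X⸩)ˣ) : k⸨X⸩)
      = algebraMap k⟦X⟧ k⸨X⸩ (Matrix.GeneralLinearGroup.det a : (k⟦X⟧)ˣ) :=
    ((algebraMap k⟦X⟧ k⸨X⸩).map_det a.val).symm
  rw [MonoidHom.comp_apply, h1, ordDetGL, MonoidHom.comp_apply]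
  change Multiplicative.ofAdd ((HahnSeries.order _ : ℤ) : ZMod 4) = 1
  rw [h2, order_unit]
  simp

/-- The color `τ([L_g]) = ord (det g) mod 4` of a vertex. -/
def color {k : Type*} [Field k] (x : Vertex k) : ZMod 4 :=
  Multiplicative.toAdd (Quotient.liftOn' x (fun g => ordDet k g) (by
    intro a b hab
    have h := ordDet_W k _ (QuotientGroup.leftRel_apply.mp hab)
    rw [map_mul, map_inv, inv_mul_eq_one] at h
    exact h))

/-! ### The weighted quotient `Γ \ 𝓑₄` -/

/-- The weight of an orbit of a group `G` on a set `α`: the inverse of the cardinality of the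
stabilizer of any of its points. -/
def orbitWeight {G α : Type*} [Group G] [MulAction G α]
    (u : MulAction.orbitRel.Quotient G α) : ℝ :=
  Quotient.liftOn' u (fun x => ((Nat.card (MulAction.stabilizer G x) : ℝ))⁻¹) (by
    intro a b hab
    exact congrArg (fun n : ℕ => (n : ℝ)⁻¹)
      (Nat.card_congr (MulAction.stabilizerEquivStabilizerOfOrbitRel hab).toEquiv))

/-- The vertices of `Γ \ 𝓑₄`. -/
abbrev QVertex (k : Type*) [Field k] : Type _ := MulAction.orbitRel.Quotient (Gam k) (Vertex k)

/-- The `Γ`-orbits of ordered pairs of vertices, for the diagonal action. The stabilizer of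
`(x, y)` is `Γ_x ∩ Γ_y`, so that `orbitWeight` of the orbit of an edge is its weight. -/
abbrev QPair (k : Type*) [Field k] : Type _ :=
  MulAction.orbitRel.Quotient (Gam k) (Vertex k × Vertex k)

/-- The `Γ`-orbit of a vertex. -/
def toQ {k : Type*} [Field k] (x : Vertex k) : QVertex k := Quotient.mk'' x

/-- The `Γ`-orbit of an ordered pair of vertices. -/
def toQPair {k : Type*} [Field k] (x y : Vertex k) : QPair k := Quotient.mk'' (x, y)

/-- The end point in `Γ \ 𝓑₄` of an orbit of ordered pairs: the class of `(x, y)` is sent to the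
class of `y`. -/
def target {k : Type*} [Field k] (e : QPair k) : QVertex k :=
  Quotient.liftOn' e (fun p => toQ p.2) (by
    rintro ⟨a, b⟩ ⟨c, d⟩ ⟨g, hg⟩
    exact Quotient.sound' ⟨g, congrArg Prod.snd hg⟩)

/-- The edges of `Γ \ 𝓑₄` that join `u` to a vertex whose color is that of `u` plus `i`. -/
def edgesFrom {k : Type*} [Field k] (i : ZMod 4) (u : QVertex k) : Set (QPair k) :=
  {e | ∃ x y : Vertex k, Adj x y ∧ color y = color x + i ∧ toQ x = u ∧ toQPair x y = e}

/-- The weighted adjacency operator `A_{w,i} f (u) = ∑ (w(u,v) / w(u)) f(v)`, the sum over the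
(finitely many) edges `(u,v)` of `Γ \ 𝓑₄` with `τ(v) = τ(u) + i`. -/
def adjOp {k : Type*} [Field k] (i : ZMod 4) (f : QVertex k → ℂ) (u : QVertex k) : ℂ :=
  ∑ᶠ e ∈ edgesFrom i u, ((orbitWeight e / orbitWeight u : ℝ) : ℂ) * f (target e)

/-- The norm `‖f‖_{2,w} = (∑_u |f(u)|² w(u))^{1/2}`, with value `∞` when `f` is not in `L²_w`. -/
def wNorm {k : Type*} [Field k] (f : QVertex k → ℂ) : ℝ≥0∞ :=
  (∑' u : QVertex k, ‖f u‖ₑ ^ 2 * ENNReal.ofReal (orbitWeight u)) ^ (1 / 2 : ℝ)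

/-- The automorphic simultaneous spectrum of `A_{w,1}, A_{w,2}, A_{w,3}` on `L²_w(Γ \ 𝓑₄)`: the
triples that admit a sequence of unit vectors which are asymptotically simultaneous
eigenvectors. The entry `lam i` belongs to the operator `A_{w,i+1}`. -/
def automorphicSpectrum (k : Type*) [Field k] : Set (Fin 3 → ℂ) :=
  {lam | ∃ f : ℕ → QVertex k → ℂ, (∀ n, wNorm (f n) = 1) ∧
    ∀ i : Fin 3, Tendsto
      (fun n => wNorm (fun u => adjOp (((i : ℕ) + 1 : ℕ) : ZMod 4) (f n) u - lam i * f n u))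
      atTop (𝓝 0)}

/-! ### Elementary symmetric functions and partitions -/

/-- The `n`-th elementary symmetric function of `z₁, …, z₄`. -/
def sigma (n : ℕ) (z : Fin 4 → ℂ) : ℂ :=
  ∑ s ∈ Finset.powersetCard n (Finset.univ : Finset (Fin 4)), ∏ j ∈ s, z j

/-- The multiset of absolute values of the entries of a tuple. -/
def moduli (z : Fin 4 → ℂ) : Multiset ℝ := Finset.univ.val.map fun i => ‖z i‖

/-- The multiset attached to a partition: the union, over its parts `n`, of
`q^{(n-1)/2}, q^{(n-3)/2}, …, q^{(1-n)/2}`. -/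
def partitionModuli (q : ℝ) (parts : Multiset ℕ) : Multiset ℝ :=
  parts.bind fun n => (Multiset.range n).map fun j => q ^ (((n : ℝ) - 1) / 2 - (j : ℝ))

end Building

end

/-! The orbits of Γ on vertices are represented by diagonal matrices, hence by dominant coweights of
PGL(4). A function on the quotient is therefore the same thing as a function on the whole coweight
lattice invariant under the finite Weyl group. The affine Hecke algebra acts on all functions on
this lattice, and the invariant ones are the common fixed vectors of the operators `heckeT`. The
algebra contains four commuting Bernstein elements. On invariant functions, at dominant coweights,
their elementary symmetric functions are scalar multiples of the adjacency operators
(`polyAct_symPoly_comp_coordQ`). The products of the first one, two or three of them act on every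
function, at dominant coweights, as multiples of translations by fundamental coweights
(`polyAct_fundPoly`).

Given an approximate joint eigenvector, consider the polynomials in the Bernstein elements that
annihilate it asymptotically. They form a proper ideal with a finite-dimensional quotient, so the
quotient has joint eigenvectors; their eigenvalue tuples `t` are rearrangements of `z`. Two facts
constrain these tuples (`exists_weights`). The normalized translations are contractions of the
weighted norm on the cone, so every initial product of `t` has absolute value at most 1. If such a
product is strictly less than 1 and `t (i+1) ≠ q t i`, then exchanging the two entries gives another
weight. Otherwise the eigenvector would yield functions vanishing on the i-th wall, for which
translation loses no norm up to a small error; an eigenvalue of absolute value less than 1 would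
then force these functions to tend to zero.

An entry of absolute value greater than 1 can thus not stand first, and it can be moved forward
unless the entry before it is exactly q times smaller. Hence each such entry is q times another
entry. The adjointness of the first and third operators, and the self-adjointness of the second,
show that the tuple is stable under inversion in the unit circle (`IsHermitianTuple`). A finite case
analysis (`exists_isPartitionForm`) leaves the five forms. The only case needing more is a family
with `|z 0| |z 1| = q` and unequal factors, removed by moving a blocked pair of entries as a unit
(`exists_eq_mul_of_pair`). -/

noncomputable section

namespace Building

/-! ### The coweight lattice of `PGL(4)` in simple root coordinates -/

/-- `ℤ⁴` modulo the diagonal; `ν` has coordinates `(ν₁ - ν₂, ν₂ - ν₃, ν₃ - ν₄)`. -/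
abbrev Coweight : Type := ℤ × ℤ × ℤ

/-- The simple root coordinates. -/
def rootCoord : Fin 3 → Coweight → ℤ
  | 0, ν => ν.1
  | 1, ν => ν.2.1
  | 2, ν => ν.2.2

/-- The simple reflections. -/
def refl : Fin 3 → Coweight → Coweight
  | 0, ν => (-ν.1, ν.1 + ν.2.1, ν.2.2)
  | 1, ν => (ν.1 + ν.2.1, -ν.2.1, ν.2.1 + ν.2.2)
  | 2, ν => (ν.1, ν.2.1 + ν.2.2, -ν.2.2)

/-- The map induced by `(ν₁, ν₂, ν₃, ν₄) ↦ (ν₄ + 1, ν₁, ν₂, ν₃)`. -/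
def rot (ν : Coweight) : Coweight := (1 - ν.1 - ν.2.1 - ν.2.2, ν.1, ν.2.1)

/-- Translation by the fundamental coweights. -/
def addFund : Fin 3 → Coweight → Coweight
  | 0, ν => (ν.1 + 1, ν.2.1, ν.2.2)
  | 1, ν => (ν.1, ν.2.1 + 1, ν.2.2)
  | 2, ν => (ν.1, ν.2.1, ν.2.2 + 1)

/-- The dominant coweights. -/
def cone : Set Coweight := {ν | ∀ i, 0 ≤ rootCoord i ν}

theorem mem_cone {a b c : ℤ} : ((a, b, c) : Coweight) ∈ cone ↔ 0 ≤ a ∧ 0 ≤ b ∧ 0 ≤ c := by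
  simp [cone, Fin.forall_fin_succ, rootCoord]

theorem refl_refl (i : Fin 3) (ν : Coweight) : refl i (refl i ν) = ν := by
  obtain ⟨a, b, c⟩ := ν
  fin_cases i <;> simp [refl]

theorem refl_involutive (i : Fin 3) : Function.Involutive (refl i) := refl_refl i

theorem rootCoord_refl (i : Fin 3) (ν : Coweight) : rootCoord i (refl i ν) = -rootCoord i ν := by
  fin_cases i <;> rfl

theorem refl_eq_self {i : Fin 3} {ν : Coweight} (h : rootCoord i ν = 0) : refl i ν = ν := by
  obtain ⟨a, b, c⟩ := ν
  fin_cases i <;> simp_all [refl, rootCoord]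

theorem rot_rot_rot_rot (ν : Coweight) : rot (rot (rot (rot ν))) = ν := by
  obtain ⟨a, b, c⟩ := ν
  simp only [rot, Prod.mk.injEq]
  refine ⟨?_, ?_, ?_⟩ <;> ring

/-- Functions that are invariant under the finite Weyl group. -/
def IsSymm (F : Coweight → ℂ) : Prop := ∀ i ν, F (refl i ν) = F ν

/-! ### The operators of the affine Hecke algebra -/

/-- The linear endomorphisms of the space of functions on the coweight lattice. -/
abbrev FunEnd : Type := Module.End ℂ (Coweight → ℂ)

/-- The Hecke operator of a simple reflection. -/
def heckeT (q : ℂ) (i : Fin 3) : FunEnd where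
  toFun F ν := if 0 ≤ rootCoord i ν then F (refl i ν) else q * F (refl i ν) - (q - 1) * F ν
  map_add' F G := by
    funext ν
    dsimp only [Pi.add_apply]
    split_ifs <;> ring
  map_smul' c F := by
    funext ν
    dsimp only [Pi.smul_apply, smul_eq_mul, RingHom.id_apply]
    split_ifs <;> ring

/-- The operator of the generator of length zero. -/
def heckeRot : FunEnd where
  toFun F ν := F (rot ν)
  map_add' _ _ := rfl
  map_smul' _ _ := rfl

/-- The inverse of `heckeT`. -/
def heckeTinv (q : ℂ) (i : Fin 3) : FunEnd := q⁻¹ • (heckeT q i + (q - 1) • 1)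

theorem heckeT_apply (q : ℂ) (i : Fin 3) (F : Coweight → ℂ) (ν : Coweight) :
    heckeT q i F ν =
      if 0 ≤ rootCoord i ν then F (refl i ν) else q * F (refl i ν) - (q - 1) * F ν := rfl

theorem heckeT_apply_of_nonneg (q : ℂ) {i : Fin 3} (F : Coweight → ℂ) {ν : Coweight}
    (h : 0 ≤ rootCoord i ν) : heckeT q i F ν = F (refl i ν) := if_pos h

theorem heckeRot_apply (F : Coweight → ℂ) (ν : Coweight) : heckeRot F ν = F (rot ν) := rfl

/-- The operator preserves the functions on each pair `{ν, refl i ν}`, so this is a two by two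
computation. The eigenvalues are 1 and -q; in this normalization invariance means eigenvalue 1. -/
theorem heckeT_mul_self (q : ℂ) (i : Fin 3) :
    heckeT q i * heckeT q i = (1 - q) • heckeT q i + q • 1 := by
  ext1 F
  funext ν
  simp only [Module.End.mul_apply, LinearMap.add_apply, LinearMap.smul_apply, Pi.add_apply,
    Pi.smul_apply, Module.End.one_apply, smul_eq_mul, heckeT_apply, refl_refl, rootCoord_refl]
  rcases lt_trichotomy (rootCoord i ν) 0 with h | h | h
  · have h1 : ¬ 0 ≤ rootCoord i ν := by omega
    have h2 : 0 ≤ -rootCoord i ν := by omega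
    simp only [if_neg h1, if_pos h2]
    ring
  · simp only [h, refl_eq_self h, le_refl, neg_zero, if_true]
    ring
  · have h1 : 0 ≤ rootCoord i ν := by omega
    have h2 : ¬ 0 ≤ -rootCoord i ν := by omega
    simp only [if_pos h1, if_neg h2]
    ring

theorem heckeT_mul_heckeTinv {q : ℂ} (hq : q ≠ 0) (i : Fin 3) :
    heckeT q i * heckeTinv q i = 1 := by
  rw [heckeTinv, mul_smul_comm, mul_add, heckeT_mul_self, mul_smul_comm, mul_one,
    inv_smul_eq_iff₀ hq]
  module

theorem heckeTinv_mul_heckeT {q : ℂ} (hq : q ≠ 0) (i : Fin 3) :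
    heckeTinv q i * heckeT q i = 1 := by
  rw [heckeTinv, smul_mul_assoc, add_mul, heckeT_mul_self, smul_mul_assoc, one_mul,
    inv_smul_eq_iff₀ hq]
  module

theorem heckeT_braid01 (q : ℂ) :
    heckeT q 0 * heckeT q 1 * heckeT q 0 = heckeT q 1 * heckeT q 0 * heckeT q 1 := by
  ext1 F
  funext ν
  obtain ⟨a, b, c⟩ := ν
  simp only [Module.End.mul_apply, heckeT_apply, refl, rootCoord]
  have e1 : a + b + -b = a := by ring
  have e2 : -a + (a + b) = b := by ring
  simp only [e1, e2, neg_add_cancel_left, neg_neg, neg_add_rev]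
  -- Both sides branch only on the signs of the positive roots of the rank-two subsystem, evaluated
  -- at the coweight; within each sign pattern this is linear algebra.
  by_cases ha : 0 ≤ a <;> by_cases hb : 0 ≤ b <;> by_cases hab : 0 ≤ a + b <;>
    by_cases hc : 0 ≤ c <;> grind

theorem heckeT_braid12 (q : ℂ) :
    heckeT q 1 * heckeT q 2 * heckeT q 1 = heckeT q 2 * heckeT q 1 * heckeT q 2 := by
  ext1 F
  funext ν
  obtain ⟨a, b, c⟩ := ν
  simp only [Module.End.mul_apply, heckeT_apply, refl, rootCoord]
  by_cases ha : 0 ≤ b <;> by_cases hb : 0 ≤ c <;> by_cases hab : 0 ≤ b + c <;> grind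

theorem heckeT_comm02 (q : ℂ) : Commute (heckeT q 0) (heckeT q 2) := by
  ext1 F
  funext ν
  obtain ⟨a, b, c⟩ := ν
  simp only [Module.End.mul_apply, heckeT_apply, refl, rootCoord]
  by_cases ha : 0 ≤ a <;> by_cases hb : 0 ≤ c <;> grind

/-- The rotation moves root coordinates one place along the affine diagram, so conjugation by
`heckeRot` takes node 1 to node 0. -/
theorem heckeT_mul_heckeRot01 (q : ℂ) : heckeT q 0 * heckeRot = heckeRot * heckeT q 1 := by
  ext1 F
  funext ν
  obtain ⟨a, b, c⟩ := ν
  simp only [Module.End.mul_apply, heckeT_apply, heckeRot_apply, refl, rootCoord, rot]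
  have e : 1 - -a - (a + b) - c = 1 - a - b - c + a := by ring
  rw [e]
  split_ifs <;> rfl

theorem heckeT_mul_heckeRot12 (q : ℂ) : heckeT q 1 * heckeRot = heckeRot * heckeT q 2 := by
  ext1 F
  funext ν
  obtain ⟨a, b, c⟩ := ν
  simp only [Module.End.mul_apply, heckeT_apply, heckeRot_apply, refl, rootCoord, rot]
  have e : 1 - (a + b) - -b - (b + c) = 1 - a - b - c := by ring
  rw [e]
  split_ifs <;> rfl

/-- A single conjugation takes node 0 to the affine node, for which no operator is defined; a second
one takes it to node 2. The squared form avoids the affine generator. -/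
theorem heckeT_mul_heckeRot_sq (q : ℂ) :
    heckeT q 2 * (heckeRot * heckeRot) = heckeRot * heckeRot * heckeT q 0 := by
  ext1 F
  funext ν
  obtain ⟨a, b, c⟩ := ν
  simp only [Module.End.mul_apply, heckeT_apply, heckeRot_apply, refl, rootCoord, rot]
  grind

theorem heckeRot_pow_four : heckeRot * heckeRot * (heckeRot * heckeRot) = 1 := by
  ext1 F
  funext ν
  exact congrArg F (rot_rot_rot_rot ν)

/-- The branch with nonnegative coordinate is the bare reflection and already forces invariance; on
invariant functions the other branch is `q F - (q - 1) F`. -/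
theorem heckeT_eq_self_iff {q : ℂ} {i : Fin 3} {F : Coweight → ℂ} :
    heckeT q i F = F ↔ ∀ ν, F (refl i ν) = F ν := by
  constructor
  · intro h ν
    rcases le_total 0 (rootCoord i ν) with h0 | h0
    · rw [← heckeT_apply_of_nonneg q F h0, h]
    · have h1 : 0 ≤ rootCoord i (refl i ν) := by rw [rootCoord_refl]; omega
      have h2 := heckeT_apply_of_nonneg q F h1
      rw [h, refl_refl] at h2
      exact h2
  · intro h
    funext ν
    rw [heckeT_apply, h]
    split_ifs <;> ring

theorem heckeTinv_eq_self {q : ℂ} (hq : q ≠ 0) {i : Fin 3} {F : Coweight → ℂ}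
    (h : heckeT q i F = F) : heckeTinv q i F = F := by
  conv_lhs => rw [← h]
  rw [← Module.End.mul_apply, heckeTinv_mul_heckeT hq, Module.End.one_apply]

end Building
end

noncomputable section

namespace Building

/-! ### The Bernstein elements -/

attribute [local irreducible] heckeT heckeRot

/-- The commuting (Bernstein) elements of the affine Hecke algebra. -/
def heckeY (q : ℂ) : Fin 4 → FunEnd
  | 0 => heckeT q 0 * heckeT q 1 * heckeT q 2 * heckeRot
  | 1 => q • (heckeT q 1 * heckeT q 2 * heckeRot * heckeTinv q 0)
  | 2 => q ^ 2 • (heckeT q 2 * heckeRot * heckeTinv q 0 * heckeTinv q 1)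
  | 3 => q ^ 3 • (heckeRot * heckeTinv q 0 * heckeTinv q 1 * heckeTinv q 2)

theorem commute_heckeTinv {q : ℂ} {i : Fin 3} {A : FunEnd} (h : Commute A (heckeT q i)) :
    Commute A (heckeTinv q i) := by
  rw [heckeTinv]
  exact (h.add_right ((Commute.one_right A).smul_right _)).smul_right _

theorem heckeY_succ {q : ℂ} (hq : q ≠ 0) (i : Fin 3) :
    heckeY q i.succ = q • (heckeTinv q i * heckeY q i.castSucc * heckeTinv q i) := by
  have hT : ∀ (j : Fin 3) (A : FunEnd), heckeTinv q j * (heckeT q j * A) = A := fun j A => by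
    rw [← mul_assoc, heckeTinv_mul_heckeT hq, one_mul]
  fin_cases i
  · change q • (heckeT q 1 * heckeT q 2 * heckeRot * heckeTinv q 0) = q • (heckeTinv q 0 *
      (heckeT q 0 * heckeT q 1 * heckeT q 2 * heckeRot) * heckeTinv q 0)
    simp only [mul_assoc, hT]
  · change q ^ 2 • (heckeT q 2 * heckeRot * heckeTinv q 0 * heckeTinv q 1) = q • (heckeTinv q 1 *
      (q • (heckeT q 1 * heckeT q 2 * heckeRot * heckeTinv q 0)) * heckeTinv q 1)
    simp only [mul_smul_comm, smul_mul_assoc, smul_smul, mul_assoc, hT, pow_two]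
  · change q ^ 3 • (heckeRot * heckeTinv q 0 * heckeTinv q 1 * heckeTinv q 2) = q • (heckeTinv q 2 *
      (q ^ 2 • (heckeT q 2 * heckeRot * heckeTinv q 0 * heckeTinv q 1)) * heckeTinv q 2)
    simp only [mul_smul_comm, smul_mul_assoc, smul_smul, mul_assoc, hT, ← pow_succ']

theorem heckeT_mul_heckeY_succ {q : ℂ} (hq : q ≠ 0) (i : Fin 3) :
    heckeT q i * heckeY q i.succ = q • (heckeY q i.castSucc * heckeTinv q i) := by
  rw [heckeY_succ hq, mul_smul_comm, ← mul_assoc, ← mul_assoc, heckeT_mul_heckeTinv hq, one_mul]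

theorem heckeY_succ_mul_heckeT {q : ℂ} (hq : q ≠ 0) (i : Fin 3) :
    heckeY q i.succ * heckeT q i = q • (heckeTinv q i * heckeY q i.castSucc) := by
  rw [heckeY_succ hq, smul_mul_assoc, mul_assoc, heckeTinv_mul_heckeT hq, mul_one]

/-- Moved left through the rotation, `T₁` becomes `T₀`, which passes `T₂`; the braid relation for 0
and 1 then releases a `T₁` at the front. -/
theorem heckeY_zero_commute_T1 (q : ℂ) : Commute (heckeY q 0) (heckeT q 1) := by
  change _ * _ * _ * _ * _ = _ * (_ * _ * _ * _)
  calc heckeT q 0 * heckeT q 1 * heckeT q 2 * heckeRot * heckeT q 1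
      = heckeT q 0 * heckeT q 1 * heckeT q 2 * (heckeRot * heckeT q 1) := by
        simp only [mul_assoc]
    _ = heckeT q 0 * heckeT q 1 * (heckeT q 2 * heckeT q 0) * heckeRot := by
        rw [← heckeT_mul_heckeRot01]
        simp only [mul_assoc]
    _ = (heckeT q 0 * heckeT q 1 * heckeT q 0) * heckeT q 2 * heckeRot := by
        rw [← (heckeT_comm02 q).eq]
        simp only [mul_assoc]
    _ = _ := by
        rw [heckeT_braid01]
        simp only [mul_assoc]

theorem heckeY_zero_commute_T2 (q : ℂ) : Commute (heckeY q 0) (heckeT q 2) := by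
  change _ * _ * _ * _ * _ = _ * (_ * _ * _ * _)
  calc heckeT q 0 * heckeT q 1 * heckeT q 2 * heckeRot * heckeT q 2
      = heckeT q 0 * heckeT q 1 * heckeT q 2 * (heckeRot * heckeT q 2) := by
        simp only [mul_assoc]
    _ = heckeT q 0 * (heckeT q 1 * heckeT q 2 * heckeT q 1) * heckeRot := by
        rw [← heckeT_mul_heckeRot12]
        simp only [mul_assoc]
    _ = (heckeT q 0 * heckeT q 2) * heckeT q 1 * heckeT q 2 * heckeRot := by
        rw [heckeT_braid12]
        simp only [mul_assoc]
    _ = _ := by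
        rw [(heckeT_comm02 q).eq]
        simp only [mul_assoc]

theorem heckeT_heckeTinv_braid {q : ℂ} (hq : q ≠ 0) {i j : Fin 3}
    (h : heckeT q i * heckeT q j * heckeT q i = heckeT q j * heckeT q i * heckeT q j) :
    heckeT q i * heckeTinv q j * heckeTinv q i = heckeTinv q j * heckeTinv q i * heckeT q j := by
  have h1 : heckeT q i * heckeT q j * (heckeT q i * heckeTinv q j * heckeTinv q i) =
      heckeT q i * heckeT q j * (heckeTinv q j * heckeTinv q i * heckeT q j) := by
    calc _ = (heckeT q i * heckeT q j * heckeT q i) * heckeTinv q j * heckeTinv q i := by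
          simp only [mul_assoc]
      _ = heckeT q j * (heckeT q i * (heckeT q j * heckeTinv q j) * heckeTinv q i) := by
          rw [h]
          simp only [mul_assoc]
      _ = heckeT q i * (heckeT q j * heckeTinv q j) * heckeTinv q i * heckeT q j := by
          rw [heckeT_mul_heckeTinv hq, mul_one, heckeT_mul_heckeTinv hq, mul_one, one_mul]
      _ = _ := by simp only [mul_assoc]
  have h2 := congrArg (fun A => heckeTinv q j * (heckeTinv q i * A)) h1
  have hl : ∀ A : FunEnd, heckeTinv q j * (heckeTinv q i * (heckeT q i * heckeT q j * A)) = A := by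
    intro A
    rw [mul_assoc, ← mul_assoc (heckeTinv q i), heckeTinv_mul_heckeT hq, one_mul, ← mul_assoc,
      heckeTinv_mul_heckeT hq, one_mul]
  simpa only [hl] using h2

/-- Passing through the outer pair of inverses turns `Tᵢ` into `Tⱼ`, which commutes with `A` and
turns back into `Tᵢ` on the other side. With `A` the zeroth or first Bernstein element this gives
commutation of `Y₂` with `T₀` and of `Y₃` with `T₁`. -/
theorem commute_conj {q : ℂ} (hq : q ≠ 0) {i j : Fin 3}
    (h : heckeT q i * heckeT q j * heckeT q i = heckeT q j * heckeT q i * heckeT q j)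
    {A : FunEnd} (hA : Commute A (heckeT q j)) :
    Commute (heckeTinv q j * (heckeTinv q i * A * heckeTinv q i) * heckeTinv q j)
      (heckeT q i) := by
  have h1 := heckeT_heckeTinv_braid hq h
  have h2 := heckeT_heckeTinv_braid hq h.symm
  change _ * _ = _ * _
  calc _ = heckeTinv q j * heckeTinv q i * A * (heckeTinv q i * heckeTinv q j * heckeT q i) := by
        simp only [mul_assoc]
    _ = heckeTinv q j * heckeTinv q i * (A * heckeT q j) * heckeTinv q i * heckeTinv q j := by
        rw [← h2]
        simp only [mul_assoc]
    _ = (heckeTinv q j * heckeTinv q i * heckeT q j) * A * heckeTinv q i * heckeTinv q j := by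
        rw [hA.eq]
        simp only [mul_assoc]
    _ = _ := by
        rw [← h1]
        simp only [mul_assoc]

theorem commute_heckeY_heckeT {q : ℂ} (hq : q ≠ 0) {i : Fin 3} {j : Fin 4}
    (h1 : j ≠ i.castSucc) (h2 : j ≠ i.succ) : Commute (heckeY q j) (heckeT q i) := by
  have c01 := heckeY_zero_commute_T1 q
  have c02 := heckeY_zero_commute_T2 q
  have t02 := heckeT_comm02 q
  have e1 : heckeY q 1 = q • (heckeTinv q 0 * heckeY q 0 * heckeTinv q 0) := heckeY_succ hq 0
  have e2 : heckeY q 2 = q • (heckeTinv q 1 * heckeY q 1 * heckeTinv q 1) := heckeY_succ hq 1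
  have e3 : heckeY q 3 = q • (heckeTinv q 2 * heckeY q 2 * heckeTinv q 2) := heckeY_succ hq 2
  have c12 : Commute (heckeY q 1) (heckeT q 2) := by
    have h := (commute_heckeTinv t02.symm).symm
    rw [e1]
    exact ((h.mul_left c02).mul_left h).smul_left q
  have c20 : Commute (heckeY q 2) (heckeT q 0) := by
    rw [e2, e1, mul_smul_comm, smul_mul_assoc]
    exact ((commute_conj hq (heckeT_braid01 q) c01).smul_left q).smul_left q
  have c30 : Commute (heckeY q 3) (heckeT q 0) := by
    have h := (commute_heckeTinv t02).symm
    rw [e3]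
    exact ((h.mul_left c20).mul_left h).smul_left q
  have c31 : Commute (heckeY q 3) (heckeT q 1) := by
    rw [e3, e2, mul_smul_comm, smul_mul_assoc]
    exact ((commute_conj hq (heckeT_braid12 q) c12).smul_left q).smul_left q
  fin_cases i <;> fin_cases j <;>
    first
    | exact absurd rfl h1
    | exact absurd rfl h2
    | exact c01
    | exact c02
    | exact c12
    | exact c20
    | exact c30
    | exact c31

/-- The element `Y₀ T₀⁻¹ Y₀` is a word in the generators without inverses, and the braid relations
show that it commutes with `T₀`. Multiplying by `T₀⁻¹` on both sides gives the claim, since `Y₁` is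
`q T₀⁻¹ Y₀ T₀⁻¹`. -/
theorem heckeY_zero_one_comm {q : ℂ} (hq : q ≠ 0) : Commute (heckeY q 0) (heckeY q 1) := by
  have key : heckeY q 0 * heckeTinv q 0 * heckeY q 0 =
      heckeT q 0 * heckeT q 1 * heckeT q 2 * heckeT q 0 * heckeT q 1 * (heckeRot * heckeRot) := by
    calc _ = heckeT q 0 * heckeT q 1 * heckeT q 2 * heckeRot * (heckeTinv q 0 * heckeT q 0) *
          heckeT q 1 * heckeT q 2 * heckeRot := by simp only [heckeY, mul_assoc]
      _ = heckeT q 0 * heckeT q 1 * heckeT q 2 * (heckeRot * heckeT q 1) * heckeT q 2 *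
          heckeRot := by rw [heckeTinv_mul_heckeT hq, mul_one]; simp only [mul_assoc]
      _ = heckeT q 0 * heckeT q 1 * heckeT q 2 * heckeT q 0 * (heckeRot * heckeT q 2) *
          heckeRot := by rw [← heckeT_mul_heckeRot01]; simp only [mul_assoc]
      _ = _ := by rw [← heckeT_mul_heckeRot12]; simp only [mul_assoc]
  have key2 : heckeT q 0 * (heckeY q 0 * heckeTinv q 0 * heckeY q 0) =
      heckeY q 0 * heckeTinv q 0 * heckeY q 0 * heckeT q 0 := by
    have hw : heckeT q 0 * heckeT q 1 * heckeT q 2 * heckeT q 0 * heckeT q 1 * heckeT q 2 =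
        heckeT q 0 * (heckeT q 0 * heckeT q 1 * heckeT q 2 * heckeT q 0 * heckeT q 1) := by
      calc _ = heckeT q 0 * heckeT q 1 * (heckeT q 2 * heckeT q 0) * heckeT q 1 * heckeT q 2 := by
            simp only [mul_assoc]
        _ = heckeT q 0 * heckeT q 1 * heckeT q 0 * (heckeT q 2 * heckeT q 1 * heckeT q 2) := by
            rw [← (heckeT_comm02 q).eq]; simp only [mul_assoc]
        _ = heckeT q 0 * (heckeT q 1 * heckeT q 0 * heckeT q 1) * heckeT q 2 * heckeT q 1 := by
            rw [← heckeT_braid12]; simp only [mul_assoc]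
        _ = heckeT q 0 * heckeT q 0 * heckeT q 1 * (heckeT q 0 * heckeT q 2) * heckeT q 1 := by
            rw [← heckeT_braid01]; simp only [mul_assoc]
        _ = _ := by rw [(heckeT_comm02 q).eq]; simp only [mul_assoc]
    rw [key, mul_assoc _ (heckeRot * heckeRot), ← heckeT_mul_heckeRot_sq, ← mul_assoc _ (heckeT q 2),
      hw]
    simp only [mul_assoc]
  have e1 : heckeY q 1 = q • (heckeTinv q 0 * heckeY q 0 * heckeTinv q 0) := heckeY_succ hq 0
  have h3 : Commute (heckeY q 0) (heckeTinv q 0 * heckeY q 0 * heckeTinv q 0) := by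
    change _ * _ = _ * _
    have h4 := congrArg (fun A => heckeTinv q 0 * A * heckeTinv q 0) key2
    simp only [← mul_assoc, heckeTinv_mul_heckeT hq, one_mul] at h4
    simp only [mul_assoc, heckeT_mul_heckeTinv hq, mul_one] at h4
    simp only [mul_assoc]
    exact h4
  rw [e1]
  exact h3.smul_right q

/-- Only `Y₀` and `Y₁` need the braid computation. An operator that commutes with `Tᵢ` and `Yᵢ`
commutes with `Yᵢ₊₁`, by the recursion `heckeY_succ`, and all other pairs follow. -/
theorem heckeY_comm {q : ℂ} (hq : q ≠ 0) (i j : Fin 4) : Commute (heckeY q i) (heckeY q j) := by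
  have c := fun {i : Fin 3} {j : Fin 4} => @commute_heckeY_heckeT q hq i j
  have conj : ∀ (i : Fin 3) {A : FunEnd}, Commute A (heckeT q i) →
      Commute A (heckeY q i.castSucc) → Commute A (heckeY q i.succ) := by
    intro i A h1 h2
    rw [heckeY_succ hq]
    have h := commute_heckeTinv h1
    exact ((h.mul_right h2).mul_right h).smul_right q
  have c01 := heckeY_zero_one_comm hq
  have c02 : Commute (heckeY q 0) (heckeY q 2) := conj 1 (c (by decide) (by decide)) c01
  have c03 : Commute (heckeY q 0) (heckeY q 3) := conj 2 (c (by decide) (by decide)) c02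
  have c12 : Commute (heckeY q 2) (heckeY q 1) := conj 0 (c (by decide) (by decide)) c02.symm
  have c13 : Commute (heckeY q 3) (heckeY q 1) := conj 0 (c (by decide) (by decide)) c03.symm
  have c23 : Commute (heckeY q 3) (heckeY q 2) := conj 1 (c (by decide) (by decide)) c13
  have main : ∀ i j : Fin 4, i < j → Commute (heckeY q i) (heckeY q j) := by
    intro i j hij
    fin_cases i <;> fin_cases j <;>
      first
      | exact absurd hij (by decide)
      | exact c01
      | exact c02
      | exact c03
      | exact c12.symm
      | exact c13.symm
      | exact c23.symm
  rcases lt_trichotomy i j with h | h | h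
  · exact main i j h
  · rw [h]
  · exact (main j i h).symm

/-! ### Bernstein elements on invariant functions and at dominant coweights -/

/-- The trailing `T₀⁻¹` of `Y₁` cancels against a `T₀` that emerges from the two rotations. The
remaining word has no inverses, so at a dominant coweight it can be evaluated by substitution alone.
-/
theorem heckeY_zero_mul_one {q : ℂ} (hq : q ≠ 0) :
    heckeY q 0 * heckeY q 1 =
      q • (heckeT q 1 * heckeT q 0 * heckeT q 2 * heckeT q 1 * (heckeRot * heckeRot)) := by
  calc heckeY q 0 * heckeY q 1
      = q • (heckeT q 0 * heckeT q 1 * heckeT q 2 * (heckeRot * heckeT q 1) * heckeT q 2 *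
          heckeRot * heckeTinv q 0) := by
        simp only [heckeY, mul_smul_comm, mul_assoc]
    _ = q • (heckeT q 0 * heckeT q 1 * heckeT q 2 * heckeT q 0 * (heckeRot * heckeT q 2) *
          heckeRot * heckeTinv q 0) := by
        rw [← heckeT_mul_heckeRot01]; simp only [mul_assoc]
    _ = q • (heckeT q 0 * heckeT q 1 * (heckeT q 2 * heckeT q 0) * heckeT q 1 *
          (heckeRot * heckeRot) * heckeTinv q 0) := by
        rw [← heckeT_mul_heckeRot12]; simp only [mul_assoc]
    _ = q • (heckeT q 0 * heckeT q 1 * heckeT q 0 * heckeT q 2 * heckeT q 1 *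
          (heckeRot * heckeRot) * heckeTinv q 0) := by
        rw [← (heckeT_comm02 q).eq]; simp only [mul_assoc]
    _ = q • (heckeT q 1 * heckeT q 0 * (heckeT q 1 * heckeT q 2 * heckeT q 1) *
          (heckeRot * heckeRot) * heckeTinv q 0) := by
        rw [heckeT_braid01]; simp only [mul_assoc]
    _ = q • (heckeT q 1 * heckeT q 0 * heckeT q 2 * heckeT q 1 *
          (heckeT q 2 * (heckeRot * heckeRot)) * heckeTinv q 0) := by
        rw [heckeT_braid12]; simp only [mul_assoc]
    _ = q • (heckeT q 1 * heckeT q 0 * heckeT q 2 * heckeT q 1 * (heckeRot * heckeRot) *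
          (heckeT q 0 * heckeTinv q 0)) := by
        rw [heckeT_mul_heckeRot_sq]; simp only [mul_assoc]
    _ = _ := by rw [heckeT_mul_heckeTinv hq, mul_one]


theorem heckeY_zero_mul_one_mul_two {q : ℂ} (hq : q ≠ 0) :
    heckeY q 0 * heckeY q 1 * heckeY q 2 =
      q ^ 3 • (heckeT q 2 * heckeT q 1 * heckeT q 0 * (heckeRot * heckeRot * heckeRot)) := by
  have hr0 : ∀ A : FunEnd, heckeRot * (heckeT q 1 * A) = heckeT q 0 * (heckeRot * A) := fun A => by
    rw [← mul_assoc, ← mul_assoc, heckeT_mul_heckeRot01]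
  have hr1 : ∀ A : FunEnd, heckeRot * (heckeT q 2 * A) = heckeT q 1 * (heckeRot * A) := fun A => by
    rw [← mul_assoc, ← mul_assoc, heckeT_mul_heckeRot12]
  have hr2 : ∀ A : FunEnd, heckeRot * (heckeRot * (heckeT q 0 * A)) =
      heckeT q 2 * (heckeRot * (heckeRot * A)) := fun A => by
    simpa only [mul_assoc] using congrArg (· * A) (heckeT_mul_heckeRot_sq q).symm
  have hb : ∀ A : FunEnd, heckeT q 1 * (heckeT q 0 * (heckeT q 2 * (heckeT q 1 * (heckeT q 0 * A)))) =
      heckeT q 2 * (heckeT q 1 * (heckeT q 0 * (heckeT q 2 * (heckeT q 1 * A)))) := fun A => by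
    calc _ = heckeT q 1 * (heckeT q 0 * heckeT q 2) * (heckeT q 1 * (heckeT q 0 * A)) := by
          simp only [mul_assoc]
      _ = heckeT q 1 * heckeT q 2 * (heckeT q 0 * heckeT q 1 * heckeT q 0) * A := by
          rw [(heckeT_comm02 q).eq]; simp only [mul_assoc]
      _ = heckeT q 1 * heckeT q 2 * heckeT q 1 * (heckeT q 0 * heckeT q 1) * A := by
          rw [heckeT_braid01]; simp only [mul_assoc]
      _ = heckeT q 2 * heckeT q 1 * (heckeT q 2 * heckeT q 0) * heckeT q 1 * A := by
          rw [heckeT_braid12]; simp only [mul_assoc]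
      _ = _ := by rw [← (heckeT_comm02 q).eq]; simp only [mul_assoc]
  have hc : ∀ (i : Fin 3) (A : FunEnd), heckeT q i * (heckeTinv q i * A) = A := fun i A => by
    rw [← mul_assoc, heckeT_mul_heckeTinv hq, one_mul]
  have h1 : heckeT q 2 * (heckeT q 1 * (heckeRot * (heckeRot * (heckeRot *
      (heckeTinv q 0 * heckeTinv q 1))))) = heckeRot * (heckeRot * heckeRot) := by
    rw [← hr1, ← hr2, hc, ← hr2, ← hr0, heckeT_mul_heckeTinv hq, mul_one]
  rw [heckeY_zero_mul_one hq]
  change q • _ * q ^ 2 • (heckeT q 2 * heckeRot * heckeTinv q 0 * heckeTinv q 1) = _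
  rw [smul_mul_smul_comm, ← pow_succ']
  congr 1
  simp only [mul_assoc]
  rw [hr1, hr0, hb, h1]

/-- In `Yᵢ₊₁ = q Tᵢ⁻¹ Yᵢ Tᵢ⁻¹` the right inverse is absorbed by `F` and the left one moves past `B`.
All monomials on invariant functions follow from the dominant one: raising an index strips one
leading `T` from the word and multiplies by `q`. -/
theorem mul_heckeY_succ_apply {q : ℂ} (hq : q ≠ 0) (i : Fin 3) {F : Coweight → ℂ}
    (hF : heckeT q i F = F) {B : FunEnd} (hB : Commute B (heckeT q i)) :
    (B * heckeY q i.succ) F = q • heckeTinv q i ((B * heckeY q i.castSucc) F) := by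
  have h := commute_heckeTinv hB
  rw [heckeY_succ hq, mul_smul_comm, ← mul_assoc, ← mul_assoc, h.eq, LinearMap.smul_apply,
    mul_assoc, mul_assoc, Module.End.mul_apply, ← mul_assoc, Module.End.mul_apply _ (heckeTinv q i),
    heckeTinv_eq_self hq hF]

theorem heckeTinv_heckeT_apply {q : ℂ} (hq : q ≠ 0) (i : Fin 3) (F : Coweight → ℂ) :
    heckeTinv q i (heckeT q i F) = F := by
  rw [← Module.End.mul_apply, heckeTinv_mul_heckeT hq, Module.End.one_apply]

/-- The monomials of degree one on invariant functions. -/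
theorem heckeY_apply_symm {q : ℂ} (hq : q ≠ 0) {F : Coweight → ℂ} (hF : ∀ i, heckeT q i F = F) :
    heckeY q 0 F = heckeT q 0 (heckeT q 1 (heckeT q 2 (heckeRot F))) ∧
    heckeY q 1 F = q • heckeT q 1 (heckeT q 2 (heckeRot F)) ∧
    heckeY q 2 F = q ^ 2 • heckeT q 2 (heckeRot F) ∧
    heckeY q 3 F = q ^ 3 • heckeRot F := by
  have hi := fun i => heckeTinv_eq_self hq (hF i)
  refine ⟨rfl, ?_, ?_, ?_⟩ <;>
    simp only [heckeY, LinearMap.smul_apply, Module.End.mul_apply, hi]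

/-- The monomials of degree two on invariant functions. -/
theorem heckeY_mul_apply_symm {q : ℂ} (hq : q ≠ 0) {F : Coweight → ℂ}
    (hF : ∀ i, heckeT q i F = F) {G : Coweight → ℂ} (hG : G = heckeRot (heckeRot F)) :
    heckeY q 0 (heckeY q 1 F) = q • heckeT q 1 (heckeT q 0 (heckeT q 2 (heckeT q 1 G))) ∧
    heckeY q 0 (heckeY q 2 F) = q ^ 2 • heckeT q 0 (heckeT q 2 (heckeT q 1 G)) ∧
    heckeY q 1 (heckeY q 2 F) = q ^ 3 • heckeT q 2 (heckeT q 1 G) ∧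
    heckeY q 0 (heckeY q 3 F) = q ^ 3 • heckeT q 0 (heckeT q 1 G) ∧
    heckeY q 1 (heckeY q 3 F) = q ^ 4 • heckeT q 1 G ∧
    heckeY q 2 (heckeY q 3 F) = q ^ 5 • G := by
  have c := fun {i : Fin 3} {j : Fin 4} => @commute_heckeY_heckeT q hq i j
  have y := heckeY_comm hq
  have step := fun (i : Fin 3) (j : Fin 4) h1 h2 =>
    mul_heckeY_succ_apply hq i (hF i) (@c i j h1 h2)
  simp only [Module.End.mul_apply] at step
  have comm : ∀ i j : Fin 4, heckeY q i (heckeY q j F) = heckeY q j (heckeY q i F) := fun i j =>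
    LinearMap.congr_fun (y i j).eq F
  have t02 : ∀ H, heckeT q 0 (heckeT q 2 H) = heckeT q 2 (heckeT q 0 H) := fun H =>
    LinearMap.congr_fun (heckeT_comm02 q).eq H
  have inv := heckeTinv_heckeT_apply hq
  have e01 : heckeY q 0 (heckeY q 1 F) = q • heckeT q 1 (heckeT q 0 (heckeT q 2 (heckeT q 1 G))) := by
    subst hG
    exact LinearMap.congr_fun (heckeY_zero_mul_one hq) F
  have e02 : heckeY q 0 (heckeY q 2 F) = q ^ 2 • heckeT q 0 (heckeT q 2 (heckeT q 1 G)) := by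
    refine (step 1 0 (by decide) (by decide)).trans ?_
    change q • heckeTinv q 1 (heckeY q 0 (heckeY q 1 F)) = _
    rw [e01, map_smul, inv, smul_smul, ← pow_two]
  have e12 : heckeY q 1 (heckeY q 2 F) = q ^ 3 • heckeT q 2 (heckeT q 1 G) := by
    rw [comm]
    refine (step 0 2 (by decide) (by decide)).trans ?_
    change q • heckeTinv q 0 (heckeY q 2 (heckeY q 0 F)) = _
    rw [comm, e02, map_smul, inv, smul_smul, ← pow_succ']
  have e03 : heckeY q 0 (heckeY q 3 F) = q ^ 3 • heckeT q 0 (heckeT q 1 G) := by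
    refine (step 2 0 (by decide) (by decide)).trans ?_
    change q • heckeTinv q 2 (heckeY q 0 (heckeY q 2 F)) = _
    rw [e02, map_smul, t02, inv, smul_smul, ← pow_succ']
  have e13 : heckeY q 1 (heckeY q 3 F) = q ^ 4 • heckeT q 1 G := by
    refine (step 2 1 (by decide) (by decide)).trans ?_
    change q • heckeTinv q 2 (heckeY q 1 (heckeY q 2 F)) = _
    rw [e12, map_smul, inv, smul_smul, ← pow_succ']
  have e23 : heckeY q 2 (heckeY q 3 F) = q ^ 5 • G := by
    rw [comm]
    refine (step 1 3 (by decide) (by decide)).trans ?_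
    change q • heckeTinv q 1 (heckeY q 3 (heckeY q 1 F)) = _
    rw [comm, e13, map_smul, inv, smul_smul, ← pow_succ']
  exact ⟨e01, e02, e12, e03, e13, e23⟩

/-- The monomials of degree three on invariant functions. -/
theorem heckeY_mul_mul_apply_symm {q : ℂ} (hq : q ≠ 0) {F : Coweight → ℂ}
    (hF : ∀ i, heckeT q i F = F) {G : Coweight → ℂ} (hG : G = heckeRot (heckeRot (heckeRot F))) :
    heckeY q 0 (heckeY q 1 (heckeY q 2 F)) = q ^ 3 • heckeT q 2 (heckeT q 1 (heckeT q 0 G)) ∧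
    heckeY q 0 (heckeY q 1 (heckeY q 3 F)) = q ^ 4 • heckeT q 1 (heckeT q 0 G) ∧
    heckeY q 0 (heckeY q 2 (heckeY q 3 F)) = q ^ 5 • heckeT q 0 G ∧
    heckeY q 1 (heckeY q 2 (heckeY q 3 F)) = q ^ 6 • G := by
  have c := fun {i : Fin 3} {j : Fin 4} => @commute_heckeY_heckeT q hq i j
  have y := heckeY_comm hq
  have comm : ∀ (i j : Fin 4) H, heckeY q i (heckeY q j H) = heckeY q j (heckeY q i H) :=
    fun i j H => LinearMap.congr_fun (y i j).eq H
  have inv := heckeTinv_heckeT_apply hq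
  have step : ∀ (i : Fin 3) (j l : Fin 4), j ≠ i.castSucc → j ≠ i.succ → l ≠ i.castSucc →
      l ≠ i.succ → heckeY q j (heckeY q l (heckeY q i.succ F)) =
        q • heckeTinv q i (heckeY q j (heckeY q l (heckeY q i.castSucc F))) := fun i j l h1 h2 h3 h4 =>
    mul_heckeY_succ_apply hq i (hF i) ((@c i j h1 h2).mul_left (@c i l h3 h4))
  have e012 : heckeY q 0 (heckeY q 1 (heckeY q 2 F)) =
      q ^ 3 • heckeT q 2 (heckeT q 1 (heckeT q 0 G)) := by
    subst hG
    exact LinearMap.congr_fun (heckeY_zero_mul_one_mul_two hq) F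
  have e013 : heckeY q 0 (heckeY q 1 (heckeY q 3 F)) = q ^ 4 • heckeT q 1 (heckeT q 0 G) := by
    refine (step 2 0 1 (by decide) (by decide) (by decide) (by decide)).trans ?_
    change q • heckeTinv q 2 (heckeY q 0 (heckeY q 1 (heckeY q 2 F))) = _
    rw [e012, map_smul, inv, smul_smul, ← pow_succ']
  have e023 : heckeY q 0 (heckeY q 2 (heckeY q 3 F)) = q ^ 5 • heckeT q 0 G := by
    rw [comm 2 3]
    refine (step 1 0 3 (by decide) (by decide) (by decide) (by decide)).trans ?_
    change q • heckeTinv q 1 (heckeY q 0 (heckeY q 3 (heckeY q 1 F))) = _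
    rw [comm 3 1, e013, map_smul, inv, smul_smul, ← pow_succ']
  have e123 : heckeY q 1 (heckeY q 2 (heckeY q 3 F)) = q ^ 6 • G := by
    rw [comm 1 2, comm 1 3]
    refine (step 0 2 3 (by decide) (by decide) (by decide) (by decide)).trans ?_
    change q • heckeTinv q 0 (heckeY q 2 (heckeY q 3 (heckeY q 0 F))) = _
    rw [comm 3 0, comm 2 0, e023, map_smul, inv, smul_smul, ← pow_succ']
  exact ⟨e012, e013, e023, e123⟩

theorem heckeY_prod_apply_symm {q : ℂ} (hq : q ≠ 0) {F : Coweight → ℂ}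
    (hF : ∀ i, heckeT q i F = F) :
    heckeY q 0 (heckeY q 1 (heckeY q 2 (heckeY q 3 F))) = q ^ 6 • F := by
  have h := (heckeY_mul_mul_apply_symm hq hF rfl).2.2.2
  have h2 : ∀ H : Coweight → ℂ, heckeRot (heckeRot (heckeRot (heckeRot H))) = H := fun H =>
    LinearMap.congr_fun heckeRot_pow_four H
  rw [h, map_smul]
  change q ^ 6 • heckeT q 0 (heckeT q 1 (heckeT q 2 (heckeRot _))) = _
  rw [h2, hF, hF, hF]

/-! ### Values at dominant coweights -/

section Dominant

variable (q : ℂ) (F : Coweight → ℂ) {a b c : ℤ}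

theorem heckeT_zero_apply (h : 0 ≤ a) : heckeT q 0 F (a, b, c) = F (-a, a + b, c) :=
  heckeT_apply_of_nonneg q F (i := 0) h

theorem heckeT_one_apply (h : 0 ≤ b) : heckeT q 1 F (a, b, c) = F (a + b, -b, b + c) :=
  heckeT_apply_of_nonneg q F (i := 1) h

theorem heckeT_two_apply (h : 0 ≤ c) : heckeT q 2 F (a, b, c) = F (a, b + c, -c) :=
  heckeT_apply_of_nonneg q F (i := 2) h

theorem heckeRot_apply_mk : heckeRot F (a, b, c) = F (1 - a - b - c, a, b) :=
  heckeRot_apply F _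

end Dominant

/-- Starting from a dominant coweight, each `heckeT` met on the way sees a nonnegative coordinate
and is a bare substitution. Invariance of the function is not assumed; this matters because the
eigenfunctions used later are not invariant. -/
theorem heckeY_zero_apply {q : ℂ} (F : Coweight → ℂ) {ν : Coweight} (h : ν ∈ cone) :
    heckeY q 0 F ν = F (addFund 0 ν) := by
  obtain ⟨a, b, c⟩ := ν
  obtain ⟨ha, hb, hc⟩ := mem_cone.mp h
  change heckeT q 0 (heckeT q 1 (heckeT q 2 (heckeRot F))) (a, b, c) = _
  rw [heckeT_zero_apply q _ ha, heckeT_one_apply q _ (by omega), heckeT_two_apply q _ (by omega),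
    heckeRot_apply_mk]
  congr 1
  simp only [addFund, Prod.mk.injEq]
  omega

theorem heckeY_zero_one_apply {q : ℂ} (hq : q ≠ 0) (F : Coweight → ℂ) {ν : Coweight}
    (h : ν ∈ cone) : heckeY q 0 (heckeY q 1 F) ν = q * F (addFund 1 ν) := by
  obtain ⟨a, b, c⟩ := ν
  obtain ⟨ha, hb, hc⟩ := mem_cone.mp h
  rw [← Module.End.mul_apply, heckeY_zero_mul_one hq]
  change q * heckeT q 1 (heckeT q 0 (heckeT q 2 (heckeT q 1 (heckeRot (heckeRot F))))) (a, b, c) = _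
  rw [heckeT_one_apply q _ hb, heckeT_zero_apply q _ (by omega), heckeT_two_apply q _ (by omega),
    heckeT_one_apply q _ (by omega), heckeRot_apply_mk, heckeRot_apply_mk]
  congr 2
  simp only [addFund, Prod.mk.injEq]
  omega

theorem heckeY_zero_one_two_apply {q : ℂ} (hq : q ≠ 0) (F : Coweight → ℂ) {ν : Coweight}
    (h : ν ∈ cone) : heckeY q 0 (heckeY q 1 (heckeY q 2 F)) ν = q ^ 3 * F (addFund 2 ν) := by
  obtain ⟨a, b, c⟩ := ν
  obtain ⟨ha, hb, hc⟩ := mem_cone.mp h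
  have e := LinearMap.congr_fun (heckeY_zero_mul_one_mul_two hq) F
  simp only [Module.End.mul_apply] at e
  rw [e]
  change q ^ 3 * heckeT q 2 (heckeT q 1 (heckeT q 0 (heckeRot (heckeRot (heckeRot F))))) (a, b, c) = _
  rw [heckeT_two_apply q _ hc, heckeT_one_apply q _ (by omega), heckeT_zero_apply q _ (by omega),
    heckeRot_apply_mk, heckeRot_apply_mk, heckeRot_apply_mk]
  congr 2
  simp only [addFund, Prod.mk.injEq]
  omega

theorem heckeT_fixed_of_symm {F : Coweight → ℂ} (hF : IsSymm F) (q : ℂ) (i : Fin 3) :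
    heckeT q i F = F := heckeT_eq_self_iff.mpr (hF i)

/-- The first elementary symmetric function of the Bernstein elements at dominant coweights. -/
theorem heckeY_esymm_one {q : ℂ} (hq : q ≠ 0) {F : Coweight → ℂ} (hF : IsSymm F) {a b c : ℤ}
    (h : (a, b, c) ∈ cone) :
    (heckeY q 0 F + heckeY q 1 F + heckeY q 2 F + heckeY q 3 F) (a, b, c) =
      F (a + 1, b, c) + q * F (a - 1, b + 1, c) + q ^ 2 * F (a, b - 1, c + 1) +
        q ^ 3 * F (a, b, c - 1) := by
  obtain ⟨ha, hb, hc⟩ := mem_cone.mp h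
  obtain ⟨e0, e1, e2, e3⟩ := heckeY_apply_symm hq (heckeT_fixed_of_symm hF q)
  have s0 : ∀ a b c, F (-a, a + b, c) = F (a, b, c) := fun a b c => hF 0 (a, b, c)
  have s1 : ∀ a b c, F (a + b, -b, b + c) = F (a, b, c) := fun a b c => hF 1 (a, b, c)
  have s2 : ∀ a b c, F (a, b + c, -c) = F (a, b, c) := fun a b c => hF 2 (a, b, c)
  -- The rotation is addition of the last standard basis vector followed by a permutation, and the
  -- permutation is invisible to an invariant function.
  have hr : ∀ a b c, heckeRot F (a, b, c) = F (a, b, c - 1) := by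
    intro a b c
    rw [heckeRot_apply_mk, ← s0, ← s1, ← s2]
    congr 1
    simp only [Prod.mk.injEq]
    omega
  rw [e0, e1, e2, e3]
  simp only [Pi.add_apply, Pi.smul_apply, smul_eq_mul]
  rw [heckeT_zero_apply q _ ha, heckeT_one_apply q _ (by omega), heckeT_two_apply q _ (by omega),
    heckeT_one_apply q _ hb, heckeT_two_apply q _ (by omega), heckeT_two_apply q _ hc]
  simp only [hr]
  congr 1; congr 1; congr 1
  · rw [← s2, ← s1, ← s0]
    congr 1
    simp only [Prod.mk.injEq]
    omega
  all_goals congr 1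
  · rw [← s2, ← s1]
    congr 1
    simp only [Prod.mk.injEq]
    omega
  · rw [← s2 _ _ (-c - 1)]
    congr 1
    simp only [Prod.mk.injEq, true_and]
    omega

/-- The second elementary symmetric function of the Bernstein elements at dominant coweights. -/
theorem heckeY_esymm_two {q : ℂ} (hq : q ≠ 0) {F : Coweight → ℂ} (hF : IsSymm F) {a b c : ℤ}
    (h : (a, b, c) ∈ cone) :
    (heckeY q 0 (heckeY q 1 F) + heckeY q 0 (heckeY q 2 F) + heckeY q 0 (heckeY q 3 F) +
      heckeY q 1 (heckeY q 2 F) + heckeY q 1 (heckeY q 3 F) + heckeY q 2 (heckeY q 3 F)) (a, b, c) =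
      q * (F (a, b + 1, c) + q * F (a + 1, b - 1, c + 1) + q ^ 2 * F (a + 1, b, c - 1) +
        q ^ 2 * F (a - 1, b, c + 1) + q ^ 3 * F (a - 1, b + 1, c - 1) + q ^ 4 * F (a, b - 1, c)) := by
  obtain ⟨ha, hb, hc⟩ := mem_cone.mp h
  obtain ⟨e01, e02, e12, e03, e13, e23⟩ :=
    heckeY_mul_apply_symm hq (heckeT_fixed_of_symm hF q) rfl
  have s0 : ∀ a b c, F (-a, a + b, c) = F (a, b, c) := fun a b c => hF 0 (a, b, c)
  have s1 : ∀ a b c, F (a + b, -b, b + c) = F (a, b, c) := fun a b c => hF 1 (a, b, c)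
  have s2 : ∀ a b c, F (a, b + c, -c) = F (a, b, c) := fun a b c => hF 2 (a, b, c)
  -- Two rotations add the last two basis vectors, up to a permutation.
  have hr : ∀ a b c, heckeRot (heckeRot F) (a, b, c) = F (a, b - 1, c) := by
    intro a b c
    rw [heckeRot_apply_mk, heckeRot_apply_mk, ← s1, ← s0, ← s2, ← s1]
    congr 1
    simp only [Prod.mk.injEq]
    omega
  rw [e01, e02, e12, e03, e13, e23]
  simp only [Pi.add_apply, Pi.smul_apply, smul_eq_mul]
  rw [heckeT_one_apply q (heckeT q 0 _) hb, heckeT_zero_apply q _ (by omega),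
    heckeT_two_apply q _ (by omega), heckeT_one_apply q _ (by omega),
    heckeT_zero_apply q (heckeT q 2 _) ha, heckeT_two_apply q _ (by omega),
    heckeT_one_apply q _ (by omega),
    heckeT_zero_apply q _ ha, heckeT_one_apply q _ (by omega),
    heckeT_two_apply q _ hc, heckeT_one_apply q _ (by omega), heckeT_one_apply q _ hb]
  simp only [hr]
  have key : ∀ x1 x2 x3 x4 x5 x6 y1 y2 y3 y4 y5 y6 : ℂ, x1 = y1 → x2 = y2 → x3 = y3 → x4 = y4 →
      x5 = y5 → x6 = y6 → q * x1 + q ^ 2 * x2 + q ^ 3 * x3 + q ^ 3 * x4 + q ^ 4 * x5 + q ^ 5 * x6 =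
      q * (y1 + q * y2 + q ^ 2 * y3 + q ^ 2 * y4 + q ^ 3 * y5 + q ^ 4 * y6) := by
    intros
    subst_vars
    ring
  apply key
  · rw [← s1, ← s0, ← s2, ← s1]
    congr 1
    simp only [Prod.mk.injEq]
    omega
  · rw [← s1, ← s0, ← s2]
    congr 1
    simp only [Prod.mk.injEq]
    omega
  · rw [← s1, ← s0]
    congr 1
    simp only [Prod.mk.injEq]
    omega
  · rw [← s1, ← s2]
    congr 1
    simp only [Prod.mk.injEq]
    omega
  · rw [← s1]
    congr 1
    simp only [Prod.mk.injEq]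
    omega
  · rfl

/-- The third elementary symmetric function of the Bernstein elements at dominant coweights. -/
theorem heckeY_esymm_three {q : ℂ} (hq : q ≠ 0) {F : Coweight → ℂ} (hF : IsSymm F) {a b c : ℤ}
    (h : (a, b, c) ∈ cone) :
    (heckeY q 0 (heckeY q 1 (heckeY q 2 F)) + heckeY q 0 (heckeY q 1 (heckeY q 3 F)) +
      heckeY q 0 (heckeY q 2 (heckeY q 3 F)) + heckeY q 1 (heckeY q 2 (heckeY q 3 F))) (a, b, c) =
      q ^ 3 * (F (a, b, c + 1) + q * F (a, b + 1, c - 1) + q ^ 2 * F (a + 1, b - 1, c) +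
        q ^ 3 * F (a - 1, b, c)) := by
  obtain ⟨ha, hb, hc⟩ := mem_cone.mp h
  obtain ⟨e012, e013, e023, e123⟩ :=
    heckeY_mul_mul_apply_symm hq (heckeT_fixed_of_symm hF q) rfl
  have s0 : ∀ a b c, F (-a, a + b, c) = F (a, b, c) := fun a b c => hF 0 (a, b, c)
  have s1 : ∀ a b c, F (a + b, -b, b + c) = F (a, b, c) := fun a b c => hF 1 (a, b, c)
  have s2 : ∀ a b c, F (a, b + c, -c) = F (a, b, c) := fun a b c => hF 2 (a, b, c)
  have hr : ∀ a b c, heckeRot (heckeRot (heckeRot F)) (a, b, c) = F (a - 1, b, c) := by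
    intro a b c
    rw [heckeRot_apply_mk, heckeRot_apply_mk, heckeRot_apply_mk, ← s2, ← s1, ← s0]
    congr 1
    simp only [Prod.mk.injEq]
    omega
  rw [e012, e013, e023, e123]
  simp only [Pi.add_apply, Pi.smul_apply, smul_eq_mul]
  rw [heckeT_two_apply q _ hc, heckeT_one_apply q _ (by omega), heckeT_zero_apply q _ (by omega),
    heckeT_one_apply q _ hb, heckeT_zero_apply q _ (by omega), heckeT_zero_apply q _ ha]
  simp only [hr]
  have key : ∀ x1 x2 x3 x4 y1 y2 y3 y4 : ℂ, x1 = y1 → x2 = y2 → x3 = y3 → x4 = y4 →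
      q ^ 3 * x1 + q ^ 4 * x2 + q ^ 5 * x3 + q ^ 6 * x4 =
      q ^ 3 * (y1 + q * y2 + q ^ 2 * y3 + q ^ 3 * y4) := by
    intros
    subst_vars
    ring
  apply key
  · rw [← s0, ← s1, ← s2]
    congr 1
    simp only [Prod.mk.injEq]
    omega
  · rw [← s0, ← s1]
    congr 1
    simp only [Prod.mk.injEq]
    omega
  · rw [← s0 (-a - 1)]
    congr 1
    simp only [Prod.mk.injEq, and_true]
    omega
  · rfl

end Building
end

noncomputable section

namespace Building

attribute [local irreducible] heckeT heckeRot

/-! ### The action of polynomials through the Bernstein elements -/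

/-- Polynomials in four variables. -/
abbrev Poly4 : Type := MvPolynomial (Fin 4) ℂ

open scoped IsMulCommutative in
/-- The substitution of the multiples `κ Y_j` of the Bernstein elements in polynomials. -/
def bernstein {q : ℂ} (hq : q ≠ 0) (κ : ℂ) : Poly4 →ₐ[ℂ] FunEnd :=
  let S : Set FunEnd := Set.range fun j => κ • heckeY q j
  -- The substitution is made in the algebra generated by the Bernstein elements, which is
  -- commutative, and then embedded in all endomorphisms.
  haveI : IsMulCommutative (Algebra.adjoin ℂ S) := Algebra.isMulCommutative_adjoin ℂ (by
    rintro _ ⟨i, rfl⟩ _ ⟨j, rfl⟩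
    exact (((heckeY_comm hq i j).smul_left κ).smul_right κ).eq)
  (Algebra.adjoin ℂ S).val.comp
    (MvPolynomial.aeval fun j => ⟨κ • heckeY q j, Algebra.subset_adjoin ⟨j, rfl⟩⟩)

open scoped IsMulCommutative in
theorem bernstein_X {q : ℂ} (hq : q ≠ 0) (κ : ℂ) (j : Fin 4) :
    bernstein hq κ (MvPolynomial.X j) = κ • heckeY q j := by
  simp [bernstein]

theorem bernstein_C {q : ℂ} (hq : q ≠ 0) (κ c : ℂ) :
    bernstein hq κ (MvPolynomial.C c) = c • 1 := by
  rw [← MvPolynomial.algebraMap_eq, AlgHom.commutes, Algebra.algebraMap_eq_smul_one]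

/-- The action of a simple reflection on polynomials. -/
def polySwap (i : Fin 3) : Poly4 →ₐ[ℂ] Poly4 :=
  MvPolynomial.rename (Equiv.swap i.castSucc i.succ)

theorem polySwap_polySwap (i : Fin 3) (p : Poly4) : polySwap i (polySwap i p) = p := by
  rw [polySwap, MvPolynomial.rename_rename]
  have h : (Equiv.swap i.castSucc i.succ : Fin 4 → Fin 4) ∘ (Equiv.swap i.castSucc i.succ) = id := by
    funext x
    simp
  rw [h, MvPolynomial.rename_id_apply]

theorem eval_polySwap (i : Fin 3) (t : Fin 4 → ℂ) (p : Poly4) :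
    MvPolynomial.eval t (polySwap i p) =
      MvPolynomial.eval (t ∘ Equiv.swap i.castSucc i.succ) p := by
  rw [polySwap, MvPolynomial.eval_rename]

/-- The Bernstein relation. -/
theorem heckeT_mul_bernstein {q : ℂ} (hq : q ≠ 0) (κ : ℂ) (i : Fin 3) (p : Poly4) :
    ∃ r : Poly4, (MvPolynomial.X (σ := Fin 4) i.castSucc - MvPolynomial.X (σ := Fin 4) i.succ) * r =
        MvPolynomial.C (q - 1) * MvPolynomial.X (σ := Fin 4) i.castSucc * (polySwap i p - p) ∧
      heckeT q i * bernstein hq κ p =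
        bernstein hq κ (polySwap i p) * heckeT q i + bernstein hq κ r := by
  -- The two degree-one relations for the exchanged variables; the other variables commute with
  -- `Tᵢ`.
  have hu : heckeT q i * heckeY q i.castSucc =
      heckeY q i.succ * heckeT q i - (q - 1) • heckeY q i.castSucc := by
    rw [heckeY_succ_mul_heckeT hq, heckeTinv, smul_mul_assoc, smul_smul, mul_inv_cancel₀ hq,
      one_smul, add_mul, smul_mul_assoc, one_mul, add_sub_cancel_right]
  have hv : heckeT q i * heckeY q i.succ =
      heckeY q i.castSucc * heckeT q i + (q - 1) • heckeY q i.castSucc := by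
    rw [heckeT_mul_heckeY_succ hq, heckeTinv, mul_smul_comm, smul_smul, mul_inv_cancel₀ hq,
      one_smul, mul_add, mul_smul_comm, mul_one]
  induction p using MvPolynomial.induction_on with
  | C c =>
    refine ⟨0, ?_, ?_⟩
    · simp [polySwap]
    · rw [polySwap, MvPolynomial.rename_C, bernstein_C, map_zero, add_zero, mul_smul_comm,
        smul_mul_assoc, mul_one, one_mul]
  | add p₁ p₂ h₁ h₂ =>
    obtain ⟨r₁, e₁, f₁⟩ := h₁
    obtain ⟨r₂, e₂, f₂⟩ := h₂
    refine ⟨r₁ + r₂, ?_, ?_⟩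
    · rw [mul_add, e₁, e₂, map_add]
      ring
    · rw [map_add, mul_add, f₁, f₂, map_add, map_add, map_add, add_mul]
      abel
  | mul_X p j h =>
    obtain ⟨r, e, f⟩ := h
    have hj : ∃ r' : Poly4, (MvPolynomial.X (σ := Fin 4) i.castSucc - MvPolynomial.X (σ := Fin 4) i.succ) * r' =
        MvPolynomial.C (q - 1) * MvPolynomial.X (σ := Fin 4) i.castSucc *
          (polySwap i (MvPolynomial.X j) - MvPolynomial.X j) ∧
        heckeT q i * bernstein hq κ (MvPolynomial.X j) =
          bernstein hq κ (polySwap i (MvPolynomial.X j)) * heckeT q i + bernstein hq κ r' := by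
      by_cases h1 : j = i.castSucc
      · refine ⟨-(MvPolynomial.C (q - 1) * MvPolynomial.X (σ := Fin 4) i.castSucc), ?_, ?_⟩
        · simp only [h1, polySwap, MvPolynomial.rename_X, Equiv.swap_apply_left]
          ring
        · simp only [h1, polySwap, MvPolynomial.rename_X, Equiv.swap_apply_left, bernstein_X,
            map_neg, map_mul, bernstein_C, mul_smul_comm, smul_mul_assoc, hu, one_mul]
          module
      by_cases h2 : j = i.succ
      · refine ⟨MvPolynomial.C (q - 1) * MvPolynomial.X (σ := Fin 4) i.castSucc, ?_, ?_⟩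
        · simp only [h2, polySwap, MvPolynomial.rename_X, Equiv.swap_apply_right]
          ring
        · simp only [h2, polySwap, MvPolynomial.rename_X, Equiv.swap_apply_right, bernstein_X,
            map_mul, bernstein_C, mul_smul_comm, smul_mul_assoc, hv, one_mul]
          module
      · refine ⟨0, ?_, ?_⟩
        · simp [polySwap, Equiv.swap_apply_of_ne_of_ne h1 h2]
        · simp only [polySwap, MvPolynomial.rename_X, Equiv.swap_apply_of_ne_of_ne h1 h2,
            bernstein_X, map_zero, add_zero, mul_smul_comm, smul_mul_assoc]
          rw [(commute_heckeY_heckeT hq h1 h2).eq]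
    obtain ⟨r', e', f'⟩ := hj
    -- The correction term obeys a twisted Leibniz rule, as is typical of divided differences.
    refine ⟨polySwap i p * r' + r * MvPolynomial.X j, ?_, ?_⟩
    · calc _ = polySwap i p * ((MvPolynomial.X (σ := Fin 4) i.castSucc - MvPolynomial.X (σ := Fin 4) i.succ) * r') +
          ((MvPolynomial.X (σ := Fin 4) i.castSucc - MvPolynomial.X (σ := Fin 4) i.succ) * r) * MvPolynomial.X j := by ring
        _ = _ := by
          rw [e, e', map_mul]
          ring
    · rw [map_mul, ← mul_assoc, f, add_mul, mul_assoc, f', map_add, map_mul, map_mul, map_mul,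
        map_mul, mul_add]
      simp only [mul_assoc, add_assoc]

/-- For an invariant polynomial the correction term `r` is killed by `Xᵢ - Xᵢ₊₁`, hence zero in a
domain. -/
theorem commute_bernstein_of_polySwap_eq {q : ℂ} (hq : q ≠ 0) (κ : ℂ) {i : Fin 3} {p : Poly4}
    (h : polySwap i p = p) : Commute (heckeT q i) (bernstein hq κ p) := by
  obtain ⟨r, e, f⟩ := heckeT_mul_bernstein hq κ i p
  rw [h, sub_self, mul_zero, mul_eq_zero, sub_eq_zero] at e
  have hr : r = 0 := by
    rcases e with e | e
    · have := MvPolynomial.X_injective (R := ℂ) e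
      exact absurd this (by simp [Fin.ext_iff])
    · exact e
  rw [hr, map_zero, add_zero, h] at f
  exact f

/-- Applied to an invariant function, a polynomial that is invariant under a simple reflection and
multiplied by `X_{i+1} - q X_i` gives a function that vanishes on the wall. -/
theorem bernstein_apply_eq_zero_of_wall {q : ℂ} (hq : q ≠ 0) (κ : ℂ) {i : Fin 3} {p : Poly4}
    (h : polySwap i p = p) {F : Coweight → ℂ} (hF : heckeT q i F = F) {ν : Coweight}
    (hν : rootCoord i ν = 0) :
    bernstein hq κ ((MvPolynomial.X (σ := Fin 4) i.succ - MvPolynomial.C q * MvPolynomial.X (σ := Fin 4) i.castSucc) * p) F ν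
      = 0 := by
  set G := bernstein hq κ p F with hG
  have hGT : heckeT q i G = G := by
    rw [hG, ← Module.End.mul_apply, (commute_bernstein_of_polySwap_eq hq κ h).eq,
      Module.End.mul_apply, hF]
  -- On the wall `heckeT` does not change the value of a function, so there this identity reads
  -- `Yᵢ₊₁ G = q Yᵢ G`.
  have e : heckeT q i (heckeY q i.succ G) = q • heckeY q i.castSucc G := by
    rw [← Module.End.mul_apply, heckeT_mul_heckeY_succ hq, LinearMap.smul_apply,
      Module.End.mul_apply, heckeTinv_eq_self hq hGT]
  have e' := congrFun e ν
  rw [heckeT_apply_of_nonneg q _ hν.ge, refl_eq_self hν] at e'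
  simp only [map_mul, map_sub, bernstein_X, bernstein_C, Module.End.mul_apply, LinearMap.sub_apply,
    LinearMap.smul_apply, Pi.sub_apply, Pi.smul_apply, smul_eq_mul, smul_mul_assoc, one_mul,
    ← hG]
  rw [e', Pi.smul_apply, smul_eq_mul]
  ring

end Building
end

noncomputable section

namespace Building

/-! ### Weights of zero-dimensional ideals -/

/-- The weights of an ideal `J`: the points `t` for which `ℂ[X] / J` has an eigenvector with
eigenvalues `t`. -/
def weights (J : Ideal Poly4) : Set (Fin 4 → ℂ) :=
  {t | ∃ x ∉ J, ∀ j, (MvPolynomial.X j - MvPolynomial.C (t j)) * x ∈ J}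

/-- A joint eigenvector of the variables is an eigenvector of every polynomial, with eigenvalue its
value at `t`. -/
theorem mul_sub_eval_mul_mem {J : Ideal Poly4} {t : Fin 4 → ℂ} {x : Poly4}
    (hx : ∀ j, (MvPolynomial.X j - MvPolynomial.C (t j)) * x ∈ J) (p : Poly4) :
    p * x - MvPolynomial.C (MvPolynomial.eval t p) * x ∈ J := by
  induction p using MvPolynomial.induction_on with
  | C c => simp
  | add p₁ p₂ h₁ h₂ =>
    convert J.add_mem h₁ h₂ using 1
    simp only [map_add]
    ring
  | mul_X p j h =>
    convert J.add_mem (J.mul_mem_left p (hx j)) (J.mul_mem_left (MvPolynomial.C (t j)) h) using 1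
    simp only [map_mul, MvPolynomial.eval_X]
    ring

/-- Multiplication by an element of `J` is zero on the quotient and multiplies the eigenvector by
`p(t)`. -/
theorem eval_eq_zero_of_mem_weights {J : Ideal Poly4} {t : Fin 4 → ℂ} (ht : t ∈ weights J)
    {p : Poly4} (hp : p ∈ J) : MvPolynomial.eval t p = 0 := by
  obtain ⟨x, hxJ, hx⟩ := ht
  by_contra h
  apply hxJ
  have h1 := J.sub_mem (J.mul_mem_right x hp) (mul_sub_eval_mul_mem hx p)
  rw [sub_sub_cancel] at h1
  have h2 := J.mul_mem_left (MvPolynomial.C (MvPolynomial.eval t p)⁻¹) h1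
  rwa [← mul_assoc, ← MvPolynomial.C_mul, inv_mul_cancel₀ h, MvPolynomial.C_1, one_mul] at h2

/-- If `J` contains `∏_k (X_j - z_k)` for all `j`, then each zero of `J` is a weight. -/
theorem mem_weights_of_zero {J : Ideal Poly4} {z : Fin 4 → ℂ}
    (hz : ∀ j, ∏ k, (MvPolynomial.X j - MvPolynomial.C (z k)) ∈ J) {t : Fin 4 → ℂ}
    (ht : ∀ p ∈ J, MvPolynomial.eval t p = 0) : t ∈ weights J := by
  set P : Ideal Poly4 := MvPolynomial.vanishingIdeal ℂ {t} with hP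
  have hmem : ∀ p, p ∈ P ↔ MvPolynomial.eval t p = 0 := fun p => by
    rw [hP, MvPolynomial.mem_vanishingIdeal_singleton_iff, MvPolynomial.aeval_eq_eval]
  have hPmax : P.IsMaximal := MvPolynomial.isMaximal_iff_eq_vanishingIdeal_singleton.mpr ⟨t, rfl⟩
  -- Minimality holds because every prime over `J` contains some `X_j - c_j` for each `j`, so one
  -- inside `P` already equals `P`. Minimal primes are associated primes, and an element with
  -- annihilator `P` is the required eigenvector.
  have hmin : P ∈ (Module.annihilator Poly4 (Poly4 ⧸ J)).minimalPrimes := by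
    rw [Ideal.annihilator_quotient]
    refine ⟨⟨hPmax.isPrime, fun p hp => (hmem p).mpr (ht p hp)⟩, ?_⟩
    rintro Q ⟨hQ, hJQ⟩ hQP
    have h1 : ∀ j, ∃ c : ℂ, MvPolynomial.X j - MvPolynomial.C c ∈ Q := fun j => by
      obtain ⟨k, -, hk⟩ := (hQ.prod_mem_iff).mp (hJQ (hz j))
      exact ⟨_, hk⟩
    choose c hc using h1
    have h2 : ∀ j, c j = t j := fun j => by
      have := (hmem _).mp (hQP (hc j))
      simp only [map_sub, MvPolynomial.eval_X, MvPolynomial.eval_C] at this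
      exact (sub_eq_zero.mp this).symm
    intro p hp
    have h3 := mul_sub_eval_mul_mem (J := Q) (t := t) (x := 1) (fun j => by
      rw [mul_one, ← h2]
      exact hc j) p
    rwa [mul_one, mul_one, (hmem p).mp hp, map_zero, sub_zero] at h3
  have hass := Module.associatedPrimes.minimalPrimes_annihilator_subset_associatedPrimes Poly4 (Poly4 ⧸ J) hmin
  obtain ⟨-, x, hx⟩ := isAssociatedPrime_iff.mp hass
  obtain ⟨y, rfl⟩ := Ideal.Quotient.mk_surjective x
  have hy : ∀ p, p ∈ P ↔ p * y ∈ J := fun p => by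
    rw [hx, Submodule.mem_colon_singleton, Submodule.mem_bot, ← Ideal.Quotient.eq_zero_iff_mem,
      map_mul]
    rfl
  refine ⟨y, fun h => ?_, fun j => ?_⟩
  · have := (hy 1).mpr (by rwa [one_mul])
    exact hPmax.ne_top ((Ideal.eq_top_iff_one P).mpr this)
  · rw [← hy, hmem]
    simp

theorem weights_nonempty {J : Ideal Poly4} (hJ : J ≠ ⊤) {z : Fin 4 → ℂ}
    (hz : ∀ j, ∏ k, (MvPolynomial.X j - MvPolynomial.C (z k)) ∈ J) : (weights J).Nonempty := by
  obtain ⟨P, hP, hJP⟩ := Ideal.exists_le_maximal J hJ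
  obtain ⟨t, rfl⟩ := MvPolynomial.isMaximal_iff_eq_vanishingIdeal_singleton.mp hP
  refine ⟨t, mem_weights_of_zero hz fun p hp => ?_⟩
  have := (MvPolynomial.mem_vanishingIdeal_singleton_iff t p).mp (hJP hp)
  rwa [MvPolynomial.aeval_eq_eval] at this

/-- If `t` is a weight and its reflection is not, then the eigenvector can be chosen invariant. -/
theorem exists_polySwap_invariant {J : Ideal Poly4} {z : Fin 4 → ℂ}
    (hz : ∀ j, ∏ k, (MvPolynomial.X j - MvPolynomial.C (z k)) ∈ J) {t : Fin 4 → ℂ} {x : Poly4}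
    (hx : ∀ j, (MvPolynomial.X j - MvPolynomial.C (t j)) * x ∈ J) {i : Fin 3}
    (hs : t ∘ Equiv.swap i.castSucc i.succ ∉ weights J) :
    ∃ b : Poly4, polySwap i b = b ∧ b - x ∈ J := by
  obtain ⟨e, heJ, he⟩ : ∃ e ∈ J, MvPolynomial.eval (t ∘ Equiv.swap i.castSucc i.succ) e ≠ 0 := by
    by_contra! h
    exact hs (mem_weights_of_zero hz h)
  set s := MvPolynomial.eval (t ∘ Equiv.swap i.castSucc i.succ) e with hse
  -- The polynomial `g` is 1 at `t` and its reflection lies in `J`. So `g x` is congruent to `x`,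
  -- and adding the reflection of `g x` makes it invariant without changing its class.
  set g : Poly4 := MvPolynomial.C s⁻¹ * polySwap i e with hg
  have hgs : polySwap i g ∈ J := by
    rw [hg, map_mul, polySwap_polySwap]
    exact J.mul_mem_left _ heJ
  have hgt : MvPolynomial.eval t g = 1 := by
    rw [hg, map_mul, MvPolynomial.eval_C, eval_polySwap, ← hse, inv_mul_cancel₀ he]
  refine ⟨g * x + polySwap i (g * x), ?_, ?_⟩
  · rw [map_add, polySwap_polySwap, add_comm]
  · have h1 := mul_sub_eval_mul_mem hx g
    rw [hgt, MvPolynomial.C_1, one_mul] at h1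
    rw [add_sub_right_comm]
    refine J.add_mem h1 ?_
    rw [map_mul]
    exact J.mul_mem_right _ hgs

end Building
end

/-! ### Analysis: weighted norms, bounded operators and the weights of approximate eigenvectors -/

noncomputable section

namespace Building

/-! ### Weighted `ℓ²` norms -/

section WeightedNorm

variable {α : Type*}

/-- The weighted `ℓ²` norm with weights `m`. -/
def weightedNorm (m : α → ℝ≥0∞) (G : α → ℂ) : ℝ≥0∞ :=
  (∑' x, ‖G x‖ₑ ^ 2 * m x) ^ (1 / 2 : ℝ)

/-- The identification with an `L²` norm of a weighted sum of point masses serves only to obtain the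
triangle inequality. -/
theorem weightedNorm_eq_eLpNorm [MeasurableSpace α] [DiscreteMeasurableSpace α] (m : α → ℝ≥0∞)
    (G : α → ℂ) : weightedNorm m G = MeasureTheory.eLpNorm G 2
      (MeasureTheory.Measure.sum fun x => m x • MeasureTheory.Measure.dirac x) := by
  rw [MeasureTheory.eLpNorm_eq_lintegral_rpow_enorm_toReal (by norm_num) (by norm_num),
    MeasureTheory.lintegral_sum_measure, weightedNorm]
  congr 1
  refine tsum_congr fun x => ?_
  simp [MeasureTheory.lintegral_smul_measure, mul_comm]

theorem weightedNorm_add_le (m : α → ℝ≥0∞) (F G : α → ℂ) :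
    weightedNorm m (F + G) ≤ weightedNorm m F + weightedNorm m G := by
  let _ : MeasurableSpace α := ⊤
  have : DiscreteMeasurableSpace α := ⟨fun _ => trivial⟩
  rw [weightedNorm_eq_eLpNorm, weightedNorm_eq_eLpNorm, weightedNorm_eq_eLpNorm]
  exact MeasureTheory.eLpNorm_add_le
    (Measurable.of_discrete).aestronglyMeasurable (Measurable.of_discrete).aestronglyMeasurable
    (by norm_num)

theorem weightedNorm_smul (m : α → ℝ≥0∞) (c : ℂ) (G : α → ℂ) :
    weightedNorm m (c • G) = ‖c‖ₑ * weightedNorm m G := by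
  have h : ∀ x, ‖(c • G) x‖ₑ ^ 2 * m x = ‖c‖ₑ ^ 2 * (‖G x‖ₑ ^ 2 * m x) := fun x => by
    rw [Pi.smul_apply, smul_eq_mul, enorm_mul, mul_pow, mul_assoc]
  simp only [weightedNorm, h, ENNReal.tsum_mul_left]
  rw [ENNReal.mul_rpow_of_nonneg _ _ (by norm_num), ← ENNReal.rpow_natCast, ← ENNReal.rpow_mul]
  norm_num

theorem weightedNorm_neg (m : α → ℝ≥0∞) (G : α → ℂ) : weightedNorm m (-G) = weightedNorm m G := by
  simp [weightedNorm]

theorem weightedNorm_sub_le (m : α → ℝ≥0∞) (F G : α → ℂ) :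
    weightedNorm m (F - G) ≤ weightedNorm m F + weightedNorm m G := by
  rw [sub_eq_add_neg, ← weightedNorm_neg m G]
  exact weightedNorm_add_le m F (-G)

theorem weightedNorm_zero (m : α → ℝ≥0∞) : weightedNorm m 0 = 0 := by
  simp [weightedNorm]

theorem weightedNorm_sq (m : α → ℝ≥0∞) (G : α → ℂ) :
    weightedNorm m G ^ 2 = ∑' x, ‖G x‖ₑ ^ 2 * m x := by
  rw [weightedNorm, ← ENNReal.rpow_natCast, ← ENNReal.rpow_mul]
  norm_num

theorem sq_le_sq_iff_le {a b : ℝ≥0∞} : a ^ 2 ≤ b ^ 2 ↔ a ≤ b :=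
  (ENNReal.pow_right_strictMono two_ne_zero).le_iff_le

theorem weightedNorm_mono {m m' : α → ℝ≥0∞} {F G : α → ℂ}
    (h : ∀ x, ‖F x‖ₑ ^ 2 * m x ≤ ‖G x‖ₑ ^ 2 * m' x) : weightedNorm m F ≤ weightedNorm m' G :=
  ENNReal.rpow_le_rpow (ENNReal.tsum_le_tsum h) (by norm_num)

/-- Composition with an injective map is bounded if the weights do not increase too much. -/
theorem weightedNorm_comp_le {β : Type*} {m : α → ℝ≥0∞} {m' : β → ℝ≥0∞} {e : α → β}
    (he : Function.Injective e) {C : ℝ≥0∞} (h : ∀ x, m x ≤ C ^ 2 * m' (e x)) (G : β → ℂ) :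
    weightedNorm m (G ∘ e) ≤ C * weightedNorm m' G := by
  rw [← sq_le_sq_iff_le, mul_pow, weightedNorm_sq, weightedNorm_sq, ← ENNReal.tsum_mul_left]
  calc ∑' x, ‖(G ∘ e) x‖ₑ ^ 2 * m x ≤ ∑' x, C ^ 2 * (‖G (e x)‖ₑ ^ 2 * m' (e x)) := by
        refine ENNReal.tsum_le_tsum fun x => ?_
        rw [mul_left_comm]
        exact mul_le_mul_right (h x) _
    _ ≤ _ := ENNReal.tsum_comp_le_tsum_of_injective he fun y => C ^ 2 * (‖G y‖ₑ ^ 2 * m' y)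

/-- The bounded operators for a weighted norm. -/
def IsBdd (m : α → ℝ≥0∞) (L : Module.End ℂ (α → ℂ)) : Prop :=
  ∃ C : ℝ≥0∞, C ≠ ∞ ∧ ∀ G, weightedNorm m (L G) ≤ C * weightedNorm m G

theorem IsBdd.add {m : α → ℝ≥0∞} {L M : Module.End ℂ (α → ℂ)} (hL : IsBdd m L) (hM : IsBdd m M) :
    IsBdd m (L + M) := by
  obtain ⟨C, hC, h⟩ := hL
  obtain ⟨D, hD, h'⟩ := hM
  refine ⟨C + D, by simp [hC, hD], fun G => ?_⟩
  rw [add_mul]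
  exact (weightedNorm_add_le _ _ _).trans (add_le_add (h G) (h' G))

theorem IsBdd.mul {m : α → ℝ≥0∞} {L M : Module.End ℂ (α → ℂ)} (hL : IsBdd m L) (hM : IsBdd m M) :
    IsBdd m (L * M) := by
  obtain ⟨C, hC, h⟩ := hL
  obtain ⟨D, hD, h'⟩ := hM
  refine ⟨C * D, ENNReal.mul_ne_top hC hD, fun G => ?_⟩
  rw [mul_assoc]
  exact (h (M G)).trans (mul_le_mul_right (h' G) _)

theorem isBdd_smul_one (m : α → ℝ≥0∞) (c : ℂ) : IsBdd m (c • 1) :=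
  ⟨‖c‖ₑ, enorm_ne_top, fun G => (weightedNorm_smul m c G).le⟩

theorem IsBdd.smul {m : α → ℝ≥0∞} {L : Module.End ℂ (α → ℂ)} (hL : IsBdd m L) (c : ℂ) :
    IsBdd m (c • L) := by
  have := (isBdd_smul_one m c).mul hL
  rwa [smul_mul_assoc, one_mul] at this

theorem IsBdd.tendsto_zero {m : α → ℝ≥0∞} {L : Module.End ℂ (α → ℂ)} (hL : IsBdd m L)
    {ι : Type*} {l : Filter ι} {G : ι → α → ℂ} (h : Tendsto (fun n => weightedNorm m (G n)) l (𝓝 0)) :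
    Tendsto (fun n => weightedNorm m (L (G n))) l (𝓝 0) := by
  obtain ⟨C, hC, hb⟩ := hL
  have h2 := ENNReal.Tendsto.const_mul h (Or.inr hC)
  rw [mul_zero] at h2
  exact tendsto_of_tendsto_of_tendsto_of_le_of_le tendsto_const_nhds h2 (fun _ => zero_le) fun n => hb _

end WeightedNorm

/-! ### Boundedness of the Hecke operators -/

/-- The operator is a bounded multiple of the reflection, which preserves the norm, plus a bounded
multiple of the identity. -/
theorem isBdd_heckeT (q : ℂ) (i : Fin 3) {m : Coweight → ℝ≥0∞}
    (hm : ∀ ν, m (refl i ν) = m ν) : IsBdd m (heckeT q i) := by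
  refine ⟨(1 + ‖q‖ₑ) + (‖q‖ₑ + 1), by simp, fun G => ?_⟩
  set A : Coweight → ℂ := (if 0 ≤ rootCoord i · then (1 : ℂ) else q) * (G ∘ refl i) with hA
  set B : Coweight → ℂ := (if 0 ≤ rootCoord i · then (0 : ℂ) else 1 - q) * G with hB
  have e : heckeT q i G = A + B := by
    funext ν
    simp only [heckeT_apply, hA, hB, Pi.add_apply, Pi.mul_apply, Function.comp]
    split_ifs <;> ring
  have hmul : ∀ (φ H : Coweight → ℂ) (C : ℝ≥0∞), (∀ ν, ‖φ ν‖ₑ ≤ C) →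
      weightedNorm m (φ * H) ≤ C * weightedNorm m H := by
    intro φ H C hφ
    rw [← sq_le_sq_iff_le, mul_pow, weightedNorm_sq, weightedNorm_sq, ← ENNReal.tsum_mul_left]
    refine ENNReal.tsum_le_tsum fun ν => ?_
    rw [Pi.mul_apply, enorm_mul, mul_pow, mul_assoc]
    gcongr
    exact hφ ν
  have hrefl : weightedNorm m (G ∘ refl i) ≤ weightedNorm m G := by
    have := weightedNorm_comp_le (m := m) (m' := m) (refl_involutive i).injective (C := 1)
      (fun ν => by rw [hm, one_pow, one_mul]) G
    rwa [one_mul] at this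
  rw [e, add_mul]
  refine (weightedNorm_add_le _ _ _).trans (add_le_add ?_ ?_)
  · refine (hmul _ _ (1 + ‖q‖ₑ) fun ν => ?_).trans (mul_le_mul_right hrefl _)
    split_ifs
    · simp
    · simp
  · refine hmul _ _ (‖q‖ₑ + 1) fun ν => ?_
    split_ifs
    · simp
    · rw [add_comm]
      refine (enorm_sub_le).trans ?_
      simp

theorem rot_injective : Function.Injective rot := by
  intro μ ν h
  rw [← rot_rot_rot_rot μ, h, rot_rot_rot_rot]

theorem isBdd_heckeRot {m : Coweight → ℝ≥0∞} {C : ℝ≥0∞} (hC : C ≠ ∞)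
    (hm : ∀ ν, m ν ≤ C ^ 2 * m (rot ν)) : IsBdd m heckeRot :=
  ⟨C, hC, fun G => weightedNorm_comp_le rot_injective hm G⟩

theorem isBdd_bernstein {q : ℂ} (hq : q ≠ 0) (κ : ℂ) {m : Coweight → ℝ≥0∞} {C : ℝ≥0∞} (hC : C ≠ ∞)
    (hm : ∀ i ν, m (refl i ν) = m ν) (hrot : ∀ ν, m ν ≤ C ^ 2 * m (rot ν)) (p : Poly4) :
    IsBdd m (bernstein hq κ p) := by
  have hT : ∀ i, IsBdd m (heckeT q i) := fun i => isBdd_heckeT q i (hm i)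
  have hTi : ∀ i, IsBdd m (heckeTinv q i) := fun i =>
    ((hT i).add (isBdd_smul_one m (q - 1))).smul q⁻¹
  have hR := isBdd_heckeRot hC hrot
  have hY : ∀ j, IsBdd m (heckeY q j) := by
    intro j
    fin_cases j
    · exact (((hT 0).mul (hT 1)).mul (hT 2)).mul hR
    · exact ((((hT 1).mul (hT 2)).mul hR).mul (hTi 0)).smul q
    · exact ((((hT 2).mul hR).mul (hTi 0)).mul (hTi 1)).smul (q ^ 2)
    · exact (((hR.mul (hTi 0)).mul (hTi 1)).mul (hTi 2)).smul (q ^ 3)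
  induction p using MvPolynomial.induction_on with
  | C c =>
    rw [bernstein_C]
    exact isBdd_smul_one m c
  | add p₁ p₂ h₁ h₂ =>
    rw [map_add]
    exact h₁.add h₂
  | mul_X p j h =>
    rw [map_mul, bernstein_X]
    exact h.mul ((hY j).smul κ)

/-! ### Invariant functions are controlled by their values at dominant coweights -/

/-- The restriction of a weight to the dominant coweights. -/
def coneWeight (m : Coweight → ℝ≥0∞) : Coweight → ℝ≥0∞ := cone.indicator m

theorem coneWeight_le (m : Coweight → ℝ≥0∞) (ν : Coweight) : coneWeight m ν ≤ m ν :=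
  Set.indicator_le_self _ _ _

theorem coneWeight_of_mem (m : Coweight → ℝ≥0∞) {ν : Coweight} (h : ν ∈ cone) :
    coneWeight m ν = m ν := Set.indicator_of_mem h m

theorem coneWeight_of_notMem (m : Coweight → ℝ≥0∞) {ν : Coweight} (h : ν ∉ cone) :
    coneWeight m ν = 0 := Set.indicator_of_notMem h m

theorem weightedNorm_coneWeight_le (m : Coweight → ℝ≥0∞) (G : Coweight → ℂ) :
    weightedNorm (coneWeight m) G ≤ weightedNorm m G :=
  weightedNorm_mono fun ν => mul_le_mul_right (coneWeight_le m ν) _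

/-- Each point of `S` is charged to itself or to its reflection in `S'`, so a point of `S'` is
charged at most twice. -/
theorem tsum_indicator_le_two_mul {i : Fin 3} {φ : Coweight → ℝ≥0∞} (hφ : ∀ ν, φ (refl i ν) = φ ν)
    {S S' : Set Coweight} (h : ∀ ν ∈ S, ν ∈ S' ∨ refl i ν ∈ S') :
    ∑' ν, S.indicator φ ν ≤ 2 * ∑' ν, S'.indicator φ ν := by
  have e : ∑' ν, S'.indicator φ (refl i ν) = ∑' ν, S'.indicator φ ν :=
    Equiv.tsum_eq ((refl_involutive i).toPerm (refl i)) fun ν => S'.indicator φ ν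
  calc ∑' ν, S.indicator φ ν ≤ ∑' ν, (S'.indicator φ ν + S'.indicator φ (refl i ν)) := by
        refine ENNReal.tsum_le_tsum fun ν => ?_
        by_cases hν : ν ∈ S
        · rw [Set.indicator_of_mem hν]
          rcases h ν hν with h' | h'
          · rw [Set.indicator_of_mem h']
            exact le_self_add
          · rw [Set.indicator_of_mem h', hφ]
            exact le_add_self
        · rw [Set.indicator_of_notMem hν]
          exact zero_le
    _ = _ := by rw [ENNReal.tsum_add, e, two_mul]

/-- Sorting by adjacent transpositions reaches the dominant cone. -/
theorem tsum_le_tsum_cone {φ : Coweight → ℝ≥0∞} (hφ : ∀ i ν, φ (refl i ν) = φ ν) :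
    ∑' ν, φ ν ≤ 64 * ∑' ν, cone.indicator φ ν := by
  -- Bubble sort with six comparisons: after three the last entry is least, after five the last two
  -- are in place. Each comparison costs a factor 2, whence 64.
  have h1 : ∑' ν, φ ν ≤ 2 * ∑' ν, {ν : Coweight | 0 ≤ ν.1}.indicator φ ν := by
    have := tsum_indicator_le_two_mul (hφ 0) (S := Set.univ) (S' := {ν : Coweight | 0 ≤ ν.1})
      fun ν _ => by
        simp only [Set.mem_ofPred_eq, refl]
        omega
    rwa [Set.indicator_univ] at this
  have h2 := tsum_indicator_le_two_mul (hφ 1) (S := {ν : Coweight | 0 ≤ ν.1})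
    (S' := {ν : Coweight | 0 ≤ ν.1 + ν.2.1 ∧ 0 ≤ ν.2.1}) fun ν h => by
      simp only [Set.mem_ofPred_eq, refl] at h ⊢
      omega
  have h3 := tsum_indicator_le_two_mul (hφ 2)
    (S := {ν : Coweight | 0 ≤ ν.1 + ν.2.1 ∧ 0 ≤ ν.2.1})
    (S' := {ν : Coweight | 0 ≤ ν.1 + ν.2.1 + ν.2.2 ∧ 0 ≤ ν.2.1 + ν.2.2 ∧ 0 ≤ ν.2.2}) fun ν h => by
      simp only [Set.mem_ofPred_eq, refl] at h ⊢
      omega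
  have h4 := tsum_indicator_le_two_mul (hφ 0)
    (S := {ν : Coweight | 0 ≤ ν.1 + ν.2.1 + ν.2.2 ∧ 0 ≤ ν.2.1 + ν.2.2 ∧ 0 ≤ ν.2.2})
    (S' := {ν : Coweight | 0 ≤ ν.1 ∧ 0 ≤ ν.2.1 + ν.2.2 ∧ 0 ≤ ν.2.2}) fun ν h => by
      simp only [Set.mem_ofPred_eq, refl] at h ⊢
      omega
  have h5 := tsum_indicator_le_two_mul (hφ 1)
    (S := {ν : Coweight | 0 ≤ ν.1 ∧ 0 ≤ ν.2.1 + ν.2.2 ∧ 0 ≤ ν.2.2})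
    (S' := {ν : Coweight | 0 ≤ ν.1 + ν.2.1 ∧ 0 ≤ ν.2.1 ∧ 0 ≤ ν.2.2}) fun ν h => by
      simp only [Set.mem_ofPred_eq, refl] at h ⊢
      omega
  have h6 := tsum_indicator_le_two_mul (hφ 0)
    (S := {ν : Coweight | 0 ≤ ν.1 + ν.2.1 ∧ 0 ≤ ν.2.1 ∧ 0 ≤ ν.2.2}) (S' := cone) fun ν h => by
      obtain ⟨a, b, c⟩ := ν
      simp only [Set.mem_ofPred_eq, refl, mem_cone] at h ⊢
      omega
  calc _ ≤ 2 * (2 * (2 * (2 * (2 * (2 * ∑' ν, cone.indicator φ ν))))) := by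
        refine h1.trans ?_
        gcongr
        refine h2.trans ?_
        gcongr
        refine h3.trans ?_
        gcongr
        refine h4.trans ?_
        gcongr
        refine h5.trans ?_
        gcongr
    _ = _ := by ring

/-- The constant is the square root of 64. The Hecke operators are bounded for the norm over the
whole lattice, while the quotient only sees the cone; this inequality joins the two for invariant
functions. -/
theorem weightedNorm_le_of_symm {m : Coweight → ℝ≥0∞} (hm : ∀ i ν, m (refl i ν) = m ν)
    {F : Coweight → ℂ} (hF : IsSymm F) :
    weightedNorm m F ≤ 8 * weightedNorm (coneWeight m) F := by
  rw [← sq_le_sq_iff_le, mul_pow, weightedNorm_sq, weightedNorm_sq]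
  have h := tsum_le_tsum_cone (φ := fun ν => ‖F ν‖ₑ ^ 2 * m ν) fun i ν => by rw [hF, hm]
  have e : ∀ ν, cone.indicator (fun ν => ‖F ν‖ₑ ^ 2 * m ν) ν = ‖F ν‖ₑ ^ 2 * coneWeight m ν :=
    fun ν => by rw [coneWeight, Set.indicator_mul_right]
  simp only [e] at h
  norm_num
  exact h

end Building
end

noncomputable section

namespace Building

attribute [local irreducible] heckeT heckeRot heckeY

/-! ### Elementary symmetric polynomials and fundamental monomials -/

/-- The elementary symmetric polynomials of degrees `1, 2, 3, 4`. -/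
def symPoly : Fin 4 → Poly4
  | 0 => .X 0 + .X 1 + .X 2 + .X 3
  | 1 => .X 0 * .X 1 + .X 0 * .X 2 + .X 0 * .X 3 + .X 1 * .X 2 + .X 1 * .X 3 + .X 2 * .X 3
  | 2 => .X 0 * .X 1 * .X 2 + .X 0 * .X 1 * .X 3 + .X 0 * .X 2 * .X 3 + .X 1 * .X 2 * .X 3
  | 3 => .X 0 * .X 1 * .X 2 * .X 3

/-- The monomials that correspond to the fundamental coweights. -/
def fundPoly : Fin 3 → Poly4
  | 0 => .X 0
  | 1 => .X 0 * .X 1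
  | 2 => .X 0 * .X 1 * .X 2

/-- The exponents `i (4 - i)`. -/
def fundExp : Fin 3 → ℕ
  | 0 => 3
  | 1 => 4
  | 2 => 3

theorem polySwap_symPoly (i : Fin 3) (k : Fin 4) : polySwap i (symPoly k) = symPoly k := by
  have h0 : ∀ j, (Equiv.swap (0 : Fin 4) 1) j = ![1, 0, 2, 3] j := by decide
  have h1 : ∀ j, (Equiv.swap (1 : Fin 4) 2) j = ![0, 2, 1, 3] j := by decide
  have h2 : ∀ j, (Equiv.swap (2 : Fin 4) 3) j = ![0, 1, 3, 2] j := by decide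
  fin_cases i
  · change MvPolynomial.rename (Equiv.swap (0 : Fin 4) 1) _ = _
    fin_cases k <;> simp [symPoly, h0] <;> ring
  · change MvPolynomial.rename (Equiv.swap (1 : Fin 4) 2) _ = _
    fin_cases k <;> simp [symPoly, h1] <;> ring
  · change MvPolynomial.rename (Equiv.swap (2 : Fin 4) 3) _ = _
    fin_cases k <;> simp [symPoly, h2] <;> ring

/-- Modulo the elementary symmetric polynomials, each variable is a root of the polynomial with
roots `z`. -/
theorem prod_X_sub_C_mem {J : Ideal Poly4} {z : Fin 4 → ℂ}
    (h : ∀ k, symPoly k - .C (MvPolynomial.eval z (symPoly k)) ∈ J) (j : Fin 4) :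
    ∏ k, (MvPolynomial.X j - MvPolynomial.C (z k)) ∈ J := by
  -- The left side minus the identity `∏ k, (X_j - X_k) = 0`, both expanded in elementary symmetric
  -- functions.
  have e : ∏ k, (MvPolynomial.X j - MvPolynomial.C (z k)) =
      .X j ^ 3 * (symPoly 0 - .C (MvPolynomial.eval z (symPoly 0)))
      - .X j ^ 2 * (symPoly 1 - .C (MvPolynomial.eval z (symPoly 1)))
      + .X j * (symPoly 2 - .C (MvPolynomial.eval z (symPoly 2)))
      - (symPoly 3 - .C (MvPolynomial.eval z (symPoly 3))) := by
    simp only [symPoly, Fin.prod_univ_four, map_add, map_mul, MvPolynomial.eval_X]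
    fin_cases j <;> simp <;> ring
  rw [e]
  exact J.sub_mem (J.add_mem (J.sub_mem (J.mul_mem_left _ (h 0)) (J.mul_mem_left _ (h 1)))
    (J.mul_mem_left _ (h 2))) (h 3)

/-! ### The normalized Bernstein action -/

/-- The normalizing factor `q ^ (-3/2)`. -/
def normFactor (q : ℝ) : ℂ := (((√q) ^ 3)⁻¹ : ℝ)

/-- The action of polynomials through the normalized Bernstein elements. -/
def polyAct {q : ℝ} (hq : 1 < q) : Poly4 →ₐ[ℂ] FunEnd :=
  bernstein (q := (q : ℂ)) (by exact_mod_cast (zero_lt_one.trans hq).ne') (normFactor q)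

/-- A monomial of degree `n` carries `q^(-3n/2)` from the normalization and `q^(n(n-1)/2)` from the
Bernstein elements, which together give `q^(-n(4-n)/2)`. -/
theorem polyAct_fundPoly {q : ℝ} (hq : 1 < q) (i : Fin 3) (G : Coweight → ℂ) {ν : Coweight}
    (hν : ν ∈ cone) :
    polyAct hq (fundPoly i) G ν = (((√q) ^ fundExp i)⁻¹ : ℝ) * G (addFund i ν) := by
  have hq0 : (q : ℂ) ≠ 0 := by exact_mod_cast (zero_lt_one.trans hq).ne'
  have hs : √q ≠ 0 := (Real.sqrt_pos.mpr (zero_lt_one.trans hq)).ne'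
  have hsq : q = √q ^ 2 := (Real.sq_sqrt (zero_lt_one.trans hq).le).symm
  fin_cases i
  · change bernstein _ _ (.X 0) G ν = _
    rw [bernstein_X, LinearMap.smul_apply, Pi.smul_apply, smul_eq_mul, heckeY_zero_apply G hν]
    rfl
  · change bernstein _ _ (.X 0 * .X 1) G ν = _
    simp only [map_mul, bernstein_X, Module.End.mul_apply, LinearMap.smul_apply, map_smul,
      Pi.smul_apply, smul_eq_mul]
    rw [heckeY_zero_one_apply hq0 G hν, ← mul_assoc, ← mul_assoc]
    congr 1
    rw [normFactor, ← Complex.ofReal_mul, ← Complex.ofReal_mul]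
    congr 1
    change _ = ((√q) ^ 4)⁻¹
    nth_rewrite 3 [hsq]
    field_simp
  · change bernstein _ _ (.X 0 * .X 1 * .X 2) G ν = _
    simp only [map_mul, bernstein_X, Module.End.mul_apply, LinearMap.smul_apply, map_smul,
      Pi.smul_apply, smul_eq_mul]
    rw [heckeY_zero_one_two_apply hq0 G hν, ← mul_assoc, ← mul_assoc, ← mul_assoc]
    congr 1
    rw [normFactor, ← Complex.ofReal_mul, ← Complex.ofReal_mul, ← Complex.ofReal_pow,
      ← Complex.ofReal_mul]
    congr 1
    change _ = ((√q) ^ 3)⁻¹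
    nth_rewrite 4 [hsq]
    field_simp

theorem heckeT_polyAct_of_polySwap_eq {q : ℝ} (hq : 1 < q) {i : Fin 3} {p : Poly4}
    (hp : polySwap i p = p) {F : Coweight → ℂ} (hF : ∀ ν, F (refl i ν) = F ν) (ν : Coweight) :
    polyAct hq p F (refl i ν) = polyAct hq p F ν := by
  refine (heckeT_eq_self_iff (q := (q : ℂ))).mp ?_ ν
  rw [← Module.End.mul_apply]
  exact (LinearMap.congr_fun (commute_bernstein_of_polySwap_eq _ _ hp).eq F).trans
    (congrArg _ (heckeT_eq_self_iff.mpr hF))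

theorem isSymm_polyAct_symPoly {q : ℝ} (hq : 1 < q) (k : Fin 4) {F : Coweight → ℂ}
    (hF : IsSymm F) : IsSymm (polyAct hq (symPoly k) F) := fun i ν =>
  heckeT_polyAct_of_polySwap_eq hq (polySwap_symPoly i k) (hF i) ν

/-- Four normalizing factors give `q^(-6)`, which cancels the `q^6` of `heckeY_prod_apply_symm`. -/
theorem polyAct_symPoly_three {q : ℝ} (hq : 1 < q) {F : Coweight → ℂ} (hF : IsSymm F) :
    polyAct hq (symPoly 3) F = F := by
  have hq0 : (q : ℂ) ≠ 0 := by exact_mod_cast (zero_lt_one.trans hq).ne'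
  have hs : √q ≠ 0 := (Real.sqrt_pos.mpr (zero_lt_one.trans hq)).ne'
  have hsq : q = √q ^ 2 := (Real.sq_sqrt (zero_lt_one.trans hq).le).symm
  change bernstein _ _ (.X 0 * .X 1 * .X 2 * .X 3) F = F
  simp only [map_mul, bernstein_X, Module.End.mul_apply, LinearMap.smul_apply, map_smul]
  rw [heckeY_prod_apply_symm hq0 (heckeT_fixed_of_symm hF _)]
  simp only [smul_smul]
  have : normFactor q * normFactor q * normFactor q * normFactor q * (q : ℂ) ^ 6 = 1 := by
    rw [normFactor]
    norm_cast
    nth_rewrite 5 [hsq]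
    field_simp
  rw [← mul_assoc, ← mul_assoc, ← mul_assoc, this, one_smul]

/-- The assumptions on the weights of the coweights that the spectral estimates use. -/
structure HeckeWeight (q : ℝ) (m : Coweight → ℝ≥0∞) : Prop where
  refl : ∀ i ν, m (refl i ν) = m ν
  rot : ∃ C : ℝ≥0∞, C ≠ ∞ ∧ ∀ ν, m ν ≤ C ^ 2 * m (rot ν)
  shift_le : ∀ i, ∀ ν ∈ cone, m ν ≤ ENNReal.ofReal q ^ fundExp i * m (addFund i ν)
  shift_eq : ∀ i, ∀ ν ∈ cone, rootCoord i ν ≠ 0 →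
    ENNReal.ofReal q ^ fundExp i * m (addFund i ν) = m ν
  shift_ge : ∃ C : ℝ≥0∞, C ≠ ∞ ∧
    ∀ i, ∀ ν ∈ cone, ENNReal.ofReal q ^ fundExp i * m (addFund i ν) ≤ C ^ 2 * m ν

theorem addFund_injective (i : Fin 3) : Function.Injective (addFund i) := by
  rintro ⟨a, b, c⟩ ⟨a', b', c'⟩ h
  fin_cases i <;> simp_all [addFund]

theorem addFund_mem_cone (i : Fin 3) {ν : Coweight} (h : ν ∈ cone) : addFund i ν ∈ cone := by
  obtain ⟨a, b, c⟩ := ν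
  have := mem_cone.mp h
  fin_cases i <;> simp only [addFund] <;> rw [mem_cone] <;> omega

theorem exists_addFund {i : Fin 3} {ν : Coweight} (h : ν ∈ cone) (h0 : rootCoord i ν ≠ 0) :
    ∃ μ ∈ cone, addFund i μ = ν := by
  obtain ⟨a, b, c⟩ := ν
  obtain ⟨ha, hb, hc⟩ := mem_cone.mp h
  fin_cases i
  · exact ⟨(a - 1, b, c), mem_cone.mpr (by simp [rootCoord] at h0; omega), by simp [addFund]⟩
  · exact ⟨(a, b - 1, c), mem_cone.mpr (by simp [rootCoord] at h0; omega), by simp [addFund]⟩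
  · exact ⟨(a, b, c - 1), mem_cone.mpr (by simp [rootCoord] at h0; omega), by simp [addFund]⟩

section Shift

variable {q : ℝ} (hq : 1 < q) {m : Coweight → ℝ≥0∞} (hm : HeckeWeight q m)

theorem enorm_sq_polyAct_fundPoly (i : Fin 3) (G : Coweight → ℂ) {ν : Coweight} (hν : ν ∈ cone) :
    ENNReal.ofReal q ^ fundExp i * ‖polyAct hq (fundPoly i) G ν‖ₑ ^ 2 =
      ‖G (addFund i ν)‖ₑ ^ 2 := by
  have hs : 0 < √q := Real.sqrt_pos.mpr (zero_lt_one.trans hq)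
  have h1 : ‖((((√q) ^ fundExp i)⁻¹ : ℝ) : ℂ)‖ₑ = ENNReal.ofReal (((√q) ^ fundExp i)⁻¹) := by
    rw [← ofReal_norm, Complex.norm_real, Real.norm_of_nonneg (by positivity)]
  rw [polyAct_fundPoly hq i G hν, enorm_mul, mul_pow, ← mul_assoc, h1, ← ENNReal.ofReal_pow
    (zero_lt_one.trans hq).le, ← ENNReal.ofReal_pow (by positivity), ← ENNReal.ofReal_mul
    (pow_nonneg (zero_lt_one.trans hq).le _)]
  have h2 : q ^ fundExp i * ((√q ^ fundExp i)⁻¹) ^ 2 = 1 := by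
    have : q ^ fundExp i = (√q ^ fundExp i) ^ 2 := by
      rw [← pow_mul, mul_comm, pow_mul, Real.sq_sqrt (zero_lt_one.trans hq).le]
    rw [this]
    field_simp
  rw [h2, ENNReal.ofReal_one, one_mul]

include hm in
/-- The fundamental monomials are contractions on the dominant cone. -/
theorem weightedNorm_polyAct_fundPoly_le (i : Fin 3) (G : Coweight → ℂ) :
    weightedNorm (coneWeight m) (polyAct hq (fundPoly i) G) ≤ weightedNorm (coneWeight m) G := by
  rw [← sq_le_sq_iff_le, weightedNorm_sq, weightedNorm_sq]
  -- The term at `ν` is compared with the term of `G` at `ν` plus the fundamental coweight: the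
  -- scalar factor of the translation is compensated by the change of weight.
  refine le_trans (ENNReal.tsum_le_tsum fun ν => ?_) (ENNReal.tsum_comp_le_tsum_of_injective
    (addFund_injective i) fun ν => ‖G ν‖ₑ ^ 2 * coneWeight m ν)
  by_cases hν : ν ∈ cone
  · rw [coneWeight_of_mem m hν, coneWeight_of_mem m (addFund_mem_cone i hν),
      ← enorm_sq_polyAct_fundPoly hq i G hν]
    refine (mul_le_mul_right (hm.shift_le i ν hν) _).trans_eq ?_
    ring
  · rw [coneWeight_of_notMem m hν, mul_zero]
    exact zero_le

include hm in
/-- A function that vanishes on a wall is controlled by its translate. -/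
theorem exists_weightedNorm_le_of_wall : ∃ C : ℝ≥0∞, C ≠ ∞ ∧ ∀ (i : Fin 3) (G : Coweight → ℂ) (s : ℂ),
    (∀ ν ∈ cone, rootCoord i ν = 0 → G ν = 0) →
    weightedNorm (coneWeight m) G ≤ weightedNorm (coneWeight m) (polyAct hq (fundPoly i) G) +
      C * weightedNorm (coneWeight m) (polyAct hq (fundPoly i) G - s • G) := by
  obtain ⟨C, hC, hge⟩ := hm.shift_ge
  refine ⟨C, hC, fun i G s hG => ?_⟩
  set H := polyAct hq (fundPoly i) G with hH
  have key : weightedNorm (coneWeight m) G ^ 2 ≤ weightedNorm (coneWeight m) H ^ 2 +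
      C ^ 2 * weightedNorm (coneWeight m) (H - s • G) ^ 2 := by
    simp only [weightedNorm_sq]
    rw [← ENNReal.tsum_mul_left, ← ENNReal.tsum_add]
    -- Off the wall every dominant coweight is a translate of a dominant one, so the sum for `G`
    -- loses nothing when restricted to translates of the cone.
    have h1 : ∑' ν, ‖G ν‖ₑ ^ 2 * coneWeight m ν ≤
        ∑' ν, cone.indicator (fun ν => ‖G (addFund i ν)‖ₑ ^ 2 * m (addFund i ν)) ν := by
      have hsup : Function.support (fun ν => ‖G ν‖ₑ ^ 2 * coneWeight m ν) ⊆
          Set.range (addFund i) := by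
        intro ν hν
        have hc : ν ∈ cone := by
          by_contra hc
          exact hν (by simp [coneWeight_of_notMem m hc])
        obtain ⟨μ, -, h⟩ := exists_addFund hc fun h0 => hν (by simp [hG ν hc h0])
        exact ⟨μ, h⟩
      rw [← (addFund_injective i).tsum_eq hsup]
      refine ENNReal.tsum_le_tsum fun ν => ?_
      by_cases hν : ν ∈ cone
      · rw [Set.indicator_of_mem hν, coneWeight_of_mem m (addFund_mem_cone i hν)]
      · by_cases hν' : addFund i ν ∈ cone
        · have h0 : rootCoord i (addFund i ν) = 0 := by
            by_contra h0
            obtain ⟨μ, hμ, h⟩ := exists_addFund hν' h0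
            rw [addFund_injective i h] at hμ
            exact hν hμ
          simp [hG _ hν' h0]
        · simp [coneWeight_of_notMem m hν']
    refine h1.trans (ENNReal.tsum_le_tsum fun ν => ?_)
    by_cases hν : ν ∈ cone
    · rw [Set.indicator_of_mem hν, coneWeight_of_mem m hν, ← enorm_sq_polyAct_fundPoly hq i G hν,
        ← hH]
      -- On the wall the weights satisfy only an inequality with a constant, but there `G` vanishes
      -- and the term belongs to `H - s • G`. Off the wall the comparison of weights is exact and
      -- costs no constant.
      by_cases h0 : rootCoord i ν = 0
      · rw [Pi.sub_apply, Pi.smul_apply, hG ν hν h0, smul_zero, sub_zero]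
        refine le_trans ?_ le_add_self
        calc _ = ‖H ν‖ₑ ^ 2 * (ENNReal.ofReal q ^ fundExp i * m (addFund i ν)) := by ring
          _ ≤ ‖H ν‖ₑ ^ 2 * (C ^ 2 * m ν) := mul_le_mul_right (hge i ν hν) _
          _ = _ := by ring
      · refine le_trans ?_ le_self_add
        rw [← hm.shift_eq i ν hν h0]
        exact le_of_eq (by ring)
    · rw [Set.indicator_of_notMem hν]
      exact zero_le
  rw [← sq_le_sq_iff_le]
  refine key.trans ?_
  rw [← mul_pow, add_sq]
  exact add_le_add_left le_self_add _

end Shift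

end Building
end

noncomputable section

namespace Building

attribute [local irreducible] heckeT heckeRot heckeY bernstein

/-! ### The weights of an approximate eigenvector -/

section ApproximateEigenvector

variable {q : ℝ} (hq : 1 < q) {m : Coweight → ℝ≥0∞}

/-- The polynomials all of whose multiples annihilate a sequence of functions asymptotically. -/
def nullIdeal (m : Coweight → ℝ≥0∞) (F : ℕ → Coweight → ℂ) : Ideal Poly4 where
  -- Bernstein operators are bounded for the full norm but need not be so for the norm on the cone.
  -- Requiring all multiples to tend to zero builds in the ideal property.
  carrier := {x | ∀ y, Tendsto (fun n => weightedNorm (coneWeight m) (polyAct hq (y * x) (F n)))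
    atTop (𝓝 0)}
  add_mem' := by
    intro a b ha hb y
    have h := (ha y).add (hb y)
    rw [add_zero] at h
    refine tendsto_of_tendsto_of_tendsto_of_le_of_le tendsto_const_nhds h (fun _ => zero_le)
      fun n => ?_
    dsimp only
    rw [mul_add, map_add, LinearMap.add_apply]
    exact weightedNorm_add_le _ _ _
  zero_mem' y := by simp [weightedNorm_zero]
  smul_mem' c x hx y := by
    rw [smul_eq_mul, ← mul_assoc]
    exact hx (y * c)

theorem tendsto_of_mem_nullIdeal {F : ℕ → Coweight → ℂ} {x : Poly4} (h : x ∈ nullIdeal hq m F) :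
    Tendsto (fun n => weightedNorm (coneWeight m) (polyAct hq x (F n))) atTop (𝓝 0) := by
  have := h 1
  rwa [one_mul] at this

/-- An eigenvector modulo the null ideal that is asymptotically null lies in the null ideal. -/
theorem mem_nullIdeal_of_tendsto {F : ℕ → Coweight → ℂ} {x : Poly4} {t : Fin 4 → ℂ}
    (hx : ∀ j, (MvPolynomial.X j - MvPolynomial.C (t j)) * x ∈ nullIdeal hq m F)
    (h : Tendsto (fun n => weightedNorm (coneWeight m) (polyAct hq x (F n))) atTop (𝓝 0)) :
    x ∈ nullIdeal hq m F := by
  intro y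
  have h1 := tendsto_of_mem_nullIdeal hq (mul_sub_eval_mul_mem hx y)
  have h2 := (ENNReal.Tendsto.const_mul h
    (Or.inr (enorm_ne_top (x := MvPolynomial.eval t y))))
  have h3 := h1.add h2
  rw [mul_zero, add_zero] at h3
  refine tendsto_of_tendsto_of_tendsto_of_le_of_le tendsto_const_nhds h3 (fun _ => zero_le)
    fun n => ?_
  dsimp only
  rw [← weightedNorm_smul]
  refine le_trans (le_of_eq ?_) (weightedNorm_add_le _ _ _)
  congr 1
  rw [map_sub, LinearMap.sub_apply, map_mul _ (MvPolynomial.C _), Module.End.mul_apply,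
    ← MvPolynomial.algebraMap_eq, AlgHom.commutes, Module.algebraMap_end_apply, sub_add_cancel]

theorem isBdd_polyAct (hm : HeckeWeight q m) (p : Poly4) : IsBdd m (polyAct hq p) := by
  obtain ⟨C, hC, hrot⟩ := hm.rot
  exact isBdd_bernstein _ _ hC hm.refl hrot p

/-- Asymptotic joint eigenvectors have a nonempty set of weights, which satisfy the growth
conditions of the dominant cone and are stable under the reflections that are not blocked. -/
theorem exists_weights (hm : HeckeWeight q m) {F : ℕ → Coweight → ℂ} (hF : ∀ n, IsSymm (F n))
    (h1 : ∀ n, weightedNorm (coneWeight m) (F n) = 1) {z : Fin 4 → ℂ}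
    (hE : ∀ k, Tendsto (fun n => weightedNorm (coneWeight m)
      (polyAct hq (symPoly k) (F n) - MvPolynomial.eval z (symPoly k) • F n)) atTop (𝓝 0)) :
    ∃ wt : Set (Fin 4 → ℂ), wt.Nonempty ∧
      (∀ t ∈ wt, ∀ k, MvPolynomial.eval t (symPoly k) = MvPolynomial.eval z (symPoly k)) ∧
      (∀ t ∈ wt, ∀ i, ‖MvPolynomial.eval t (fundPoly i)‖ ≤ 1) ∧
      (∀ t ∈ wt, ∀ i : Fin 3, ‖MvPolynomial.eval t (fundPoly i)‖ < 1 →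
        t i.succ ≠ q * t i.castSucc → t ∘ Equiv.swap i.castSucc i.succ ∈ wt) := by
  set J := nullIdeal hq m F with hJ
  -- Finiteness is needed to cancel norms in `ℝ≥0∞` below.
  have hfin : ∀ x n, weightedNorm (coneWeight m) (polyAct hq x (F n)) ≠ ∞ := by
    intro x n
    obtain ⟨C, hC, hb⟩ := isBdd_polyAct hq hm x
    refine ne_top_of_le_ne_top ?_ ((weightedNorm_coneWeight_le m _).trans (hb (F n)))
    refine ENNReal.mul_ne_top hC (ne_top_of_le_ne_top ?_ (weightedNorm_le_of_symm hm.refl (hF n)))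
    rw [h1]
    simp
  have hsym : ∀ k, symPoly k - .C (MvPolynomial.eval z (symPoly k)) ∈ J := by
    intro k y
    have hD : ∀ n, IsSymm (polyAct hq (symPoly k) (F n) - MvPolynomial.eval z (symPoly k) • F n) :=
      fun n i ν => by
        rw [Pi.sub_apply, Pi.sub_apply, Pi.smul_apply, Pi.smul_apply,
          isSymm_polyAct_symPoly hq k (hF n), hF n]
    -- The error term is an invariant function, so its full norm tends to zero too, and it stays
    -- null after applying any bounded operator, in particular any `y`.
    have h8 := ENNReal.Tendsto.const_mul (hE k) (Or.inr (by norm_num : (8 : ℝ≥0∞) ≠ ∞))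
    rw [mul_zero] at h8
    have hN : Tendsto (fun n => weightedNorm m
        (polyAct hq (symPoly k) (F n) - MvPolynomial.eval z (symPoly k) • F n)) atTop (𝓝 0) :=
      tendsto_of_tendsto_of_tendsto_of_le_of_le tendsto_const_nhds h8 (fun _ => zero_le)
        fun n => weightedNorm_le_of_symm hm.refl (hD n)
    refine tendsto_of_tendsto_of_tendsto_of_le_of_le tendsto_const_nhds
      ((isBdd_polyAct hq hm y).tendsto_zero hN) (fun _ => zero_le) fun n => ?_
    dsimp only
    refine le_trans (le_of_eq ?_) (weightedNorm_coneWeight_le m _)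
    rw [map_mul, Module.End.mul_apply, map_sub, LinearMap.sub_apply, ← MvPolynomial.algebraMap_eq,
      AlgHom.commutes, Module.algebraMap_end_apply]
  have hprod := prod_X_sub_C_mem hsym
  have htop : J ≠ ⊤ := by
    intro h
    have h2 := tendsto_of_mem_nullIdeal hq ((Ideal.eq_top_iff_one J).mp h)
    simp only [map_one, Module.End.one_apply, h1] at h2
    exact one_ne_zero (tendsto_nhds_unique tendsto_const_nhds h2)
  -- the translate of an eigenvector is close to a multiple of it
  have hshift : ∀ (x : Poly4) (t : Fin 4 → ℂ) (i : Fin 3),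
      (∀ j, (MvPolynomial.X j - MvPolynomial.C (t j)) * x ∈ J) →
      Tendsto (fun n => weightedNorm (coneWeight m) (polyAct hq (fundPoly i) (polyAct hq x (F n)) -
        MvPolynomial.eval t (fundPoly i) • polyAct hq x (F n))) atTop (𝓝 0) := by
    intro x t i hx
    refine (tendsto_of_mem_nullIdeal hq (mul_sub_eval_mul_mem hx (fundPoly i))).congr fun n => ?_
    rw [map_sub, LinearMap.sub_apply, map_mul, map_mul, Module.End.mul_apply, Module.End.mul_apply,
      ← MvPolynomial.algebraMap_eq, AlgHom.commutes, Module.algebraMap_end_apply]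
  refine ⟨weights J, weights_nonempty htop hprod, ?_, ?_, ?_⟩
  · intro t ht k
    have h := eval_eq_zero_of_mem_weights ht (hsym k)
    rwa [map_sub, MvPolynomial.eval_C, sub_eq_zero] at h
  · rintro t ⟨x, hxJ, hx⟩ i
    by_contra! hlt
    apply hxJ
    refine mem_nullIdeal_of_tendsto hq hx ?_
    -- A contraction cannot have an approximate eigenvalue of absolute value greater than 1: `(‖s‖ -
    -- 1) ‖G‖` is at most the error.
    set s := MvPolynomial.eval t (fundPoly i) with hs
    have hε := hshift x t i hx
    have hbound : ∀ n, ENNReal.ofReal (‖s‖ - 1) * weightedNorm (coneWeight m) (polyAct hq x (F n)) ≤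
        weightedNorm (coneWeight m) (polyAct hq (fundPoly i) (polyAct hq x (F n)) -
          s • polyAct hq x (F n)) := by
      intro n
      set G := polyAct hq x (F n) with hG
      have ha : ‖s‖ₑ * weightedNorm (coneWeight m) G ≤ weightedNorm (coneWeight m) G +
          weightedNorm (coneWeight m) (polyAct hq (fundPoly i) G - s • G) := by
        rw [← weightedNorm_smul]
        calc weightedNorm (coneWeight m) (s • G) = weightedNorm (coneWeight m)
              (polyAct hq (fundPoly i) G - (polyAct hq (fundPoly i) G - s • G)) := by
              rw [sub_sub_cancel]
          _ ≤ _ := (weightedNorm_sub_le _ _ _).trans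
              (add_le_add_left (weightedNorm_polyAct_fundPoly_le hq hm i G) _)
      have hb : ‖s‖ₑ = 1 + ENNReal.ofReal (‖s‖ - 1) := by
        rw [← ofReal_norm, ← ENNReal.ofReal_one, ← ENNReal.ofReal_add zero_le_one (by linarith),
          add_sub_cancel]
      rw [hb, add_mul, one_mul] at ha
      exact (ENNReal.add_le_add_iff_left (hfin x n)).mp ha
    have hc : ENNReal.ofReal (‖s‖ - 1) ≠ 0 := by
      rw [Ne, ENNReal.ofReal_eq_zero]
      linarith
    have h3 := ENNReal.Tendsto.const_mul hε
      (Or.inr (ENNReal.inv_ne_top.mpr hc))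
    rw [mul_zero] at h3
    refine tendsto_of_tendsto_of_tendsto_of_le_of_le tendsto_const_nhds h3 (fun _ => zero_le)
      fun n => ?_
    dsimp only
    rw [mul_comm, ← div_eq_mul_inv, ENNReal.le_div_iff_mul_le (Or.inl hc) (Or.inl (by simp)),
      mul_comm]
    exact hbound n
  · rintro t ⟨x, hxJ, hx⟩ i hlt hne
    by_contra hswap
    apply hxJ
    obtain ⟨b, hb, hbx⟩ := exists_polySwap_invariant hprod hx hswap
    -- Modulo the ideal, `y` is the eigenvector `x` multiplied by `t (i+1) - q t i`, which is
    -- nonzero by hypothesis. Since `b` is invariant, `y` produces functions that vanish on the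
    -- wall.
    set y : Poly4 := (MvPolynomial.X (σ := Fin 4) i.succ -
      MvPolynomial.C (q : ℂ) * MvPolynomial.X (σ := Fin 4) i.castSucc) * b with hy
    set d : ℂ := t i.succ - q * t i.castSucc with hd
    have hd0 : d ≠ 0 := sub_ne_zero.mpr hne
    have hyx : y - MvPolynomial.C d * x ∈ J := by
      have e1 := J.mul_mem_left (MvPolynomial.X (σ := Fin 4) i.succ -
        MvPolynomial.C (q : ℂ) * MvPolynomial.X (σ := Fin 4) i.castSucc) hbx
      have e2 := mul_sub_eval_mul_mem hx (MvPolynomial.X (σ := Fin 4) i.succ -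
        MvPolynomial.C (q : ℂ) * MvPolynomial.X (σ := Fin 4) i.castSucc)
      convert J.add_mem e1 e2 using 1
      simp only [map_sub, map_mul, MvPolynomial.eval_X, MvPolynomial.eval_C, hy, hd]
      ring
    have hyw : ∀ j, (MvPolynomial.X j - MvPolynomial.C (t j)) * y ∈ J := by
      intro j
      convert J.add_mem (J.mul_mem_left (MvPolynomial.X j - MvPolynomial.C (t j)) hyx)
        (J.mul_mem_left (MvPolynomial.C d) (hx j)) using 1
      ring
    have hwall : ∀ n, ∀ ν ∈ cone, rootCoord i ν = 0 → polyAct hq y (F n) ν = 0 := by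
      intro n ν _ hν
      exact bernstein_apply_eq_zero_of_wall _ _ hb (heckeT_fixed_of_symm (hF n) _ i) hν
    obtain ⟨C, hC, hCb⟩ := exists_weightedNorm_le_of_wall hq hm
    set s := MvPolynomial.eval t (fundPoly i) with hs
    have hε := hshift y t i hyw
    -- Up to the error, the translate is at once `s` times the function and no smaller than it, so
    -- `‖s‖ < 1` forces the function to be small.
    have hbound : ∀ n, ENNReal.ofReal (1 - ‖s‖) * weightedNorm (coneWeight m) (polyAct hq y (F n)) ≤
        (1 + C) * weightedNorm (coneWeight m) (polyAct hq (fundPoly i) (polyAct hq y (F n)) -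
          s • polyAct hq y (F n)) := by
      intro n
      set G := polyAct hq y (F n) with hG
      set ε := weightedNorm (coneWeight m) (polyAct hq (fundPoly i) G - s • G) with hε
      have ha : weightedNorm (coneWeight m) G ≤ ‖s‖ₑ * weightedNorm (coneWeight m) G +
          (1 + C) * ε := by
        refine (hCb i G s (hwall n)).trans ?_
        rw [add_mul, one_mul, ← add_assoc]
        refine add_le_add_left ?_ _
        rw [← weightedNorm_smul, hε, add_comm]
        calc weightedNorm (coneWeight m) (polyAct hq (fundPoly i) G) = weightedNorm (coneWeight m)
              ((polyAct hq (fundPoly i) G - s • G) + s • G) := by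
              rw [sub_add_cancel]
          _ ≤ _ := weightedNorm_add_le _ _ _
      have hone : 1 = ‖s‖ₑ + ENNReal.ofReal (1 - ‖s‖) := by
        rw [← ofReal_norm, ← ENNReal.ofReal_add (norm_nonneg _) (by linarith), add_sub_cancel,
          ENNReal.ofReal_one]
      nth_rewrite 1 [← one_mul (weightedNorm (coneWeight m) G)] at ha
      rw [hone, add_mul, ← hone] at ha
      exact (ENNReal.add_le_add_iff_left (ENNReal.mul_ne_top enorm_ne_top (hfin y n))).mp ha
    have hc : ENNReal.ofReal (1 - ‖s‖) ≠ 0 := by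
      rw [Ne, ENNReal.ofReal_eq_zero]
      linarith
    have h3 := ENNReal.Tendsto.const_mul (ENNReal.Tendsto.const_mul hε
      (Or.inr (by simp [hC] : (1 + C) ≠ ∞))) (Or.inr (ENNReal.inv_ne_top.mpr hc))
    rw [mul_zero, mul_zero] at h3
    have hyJ : y ∈ J := by
      refine mem_nullIdeal_of_tendsto hq hyw ?_
      refine tendsto_of_tendsto_of_tendsto_of_le_of_le tendsto_const_nhds h3 (fun _ => zero_le)
        fun n => ?_
      dsimp only
      rw [mul_comm, ← div_eq_mul_inv, ENNReal.le_div_iff_mul_le (Or.inl hc) (Or.inl (by simp)),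
        mul_comm]
      exact hbound n
    have h4 := J.sub_mem hyJ hyx
    rw [sub_sub_cancel] at h4
    have h5 := J.mul_mem_left (MvPolynomial.C d⁻¹) h4
    rwa [← mul_assoc, ← MvPolynomial.C_mul, inv_mul_cancel₀ hd0, MvPolynomial.C_1, one_mul] at h5

end ApproximateEigenvector

end Building
end

/-! ### Combinatorics of the weight tuples -/

noncomputable section

namespace Building

open MvPolynomial (eval)
open scoped ComplexConjugate

/-! ### Tuples with the same elementary symmetric functions -/

theorem prod_sub_eq_of_eval_symPoly {s t : Fin 4 → ℂ}
    (h : ∀ k, eval s (symPoly k) = eval t (symPoly k)) (x : ℂ) :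
    ∏ j, (x - s j) = ∏ j, (x - t j) := by
  have key : ∀ r : Fin 4 → ℂ, ∏ j, (x - r j) = x ^ 4 - eval r (symPoly 0) * x ^ 3 +
      eval r (symPoly 1) * x ^ 2 - eval r (symPoly 2) * x + eval r (symPoly 3) := by
    intro r
    simp only [symPoly, Fin.prod_univ_four, map_add, map_mul, MvPolynomial.eval_X]
    ring
  rw [key, key, h, h, h, h]

theorem exists_eq_of_eval_symPoly {s t : Fin 4 → ℂ}
    (h : ∀ k, eval s (symPoly k) = eval t (symPoly k)) (i : Fin 4) : ∃ j, t j = s i := by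
  have h0 := prod_sub_eq_of_eval_symPoly h (s i)
  rw [Finset.prod_eq_zero (Finset.mem_univ i) (sub_self _)] at h0
  obtain ⟨j, -, hj⟩ := Finset.prod_eq_zero_iff.mp h0.symm
  exact ⟨j, (sub_eq_zero.mp hj).symm⟩

/-- Matching each entry of `s` with an equal entry of `t` is injective when `s` is, hence bijective
on four indices, so the entries of `t` are distinct as well. -/
theorem injective_of_eval_symPoly {s t : Fin 4 → ℂ}
    (h : ∀ k, eval s (symPoly k) = eval t (symPoly k)) (hs : Function.Injective s) :
    Function.Injective t := by
  choose g hg using exists_eq_of_eval_symPoly h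
  have hgi : Function.Injective g := fun a b hab => hs (by rw [← hg a, ← hg b, hab])
  intro a b hab
  obtain ⟨a, rfl⟩ := (Finite.injective_iff_surjective.mp hgi) a
  obtain ⟨b, rfl⟩ := (Finite.injective_iff_surjective.mp hgi) b
  rw [hg, hg] at hab
  rw [hs hab]

/-- A set of tuples with the closure properties of the joint spectrum of the commuting operators
`Y₁, …, Y₄` on the span of an approximate eigenvector with parameter `z`. -/
structure IsWeightSet (q : ℝ) (z : Fin 4 → ℂ) (wt : Set (Fin 4 → ℂ)) : Prop where
  nonempty : wt.Nonempty
  symm : ∀ t ∈ wt, ∀ k, eval t (symPoly k) = eval z (symPoly k)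
  norm_le : ∀ t ∈ wt, ∀ i, ‖eval t (fundPoly i)‖ ≤ 1
  swap : ∀ t ∈ wt, ∀ i : Fin 3, ‖eval t (fundPoly i)‖ < 1 → t i.succ ≠ q * t i.castSucc →
    t ∘ Equiv.swap i.castSucc i.succ ∈ wt

namespace IsWeightSet

variable {q : ℝ} {z : Fin 4 → ℂ} {wt : Set (Fin 4 → ℂ)}

theorem of_eval_eq (H : IsWeightSet q z wt) {w : Fin 4 → ℂ}
    (h : ∀ k, eval w (symPoly k) = eval z (symPoly k)) : IsWeightSet q w wt :=
  ⟨H.nonempty, fun t ht k => (H.symm t ht k).trans (h k).symm, H.norm_le, H.swap⟩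

theorem norm_zero_le (H : IsWeightSet q z wt) {t : Fin 4 → ℂ} (ht : t ∈ wt) : ‖t 0‖ ≤ 1 := by
  simpa [fundPoly] using H.norm_le t ht 0

theorem norm_one_le (H : IsWeightSet q z wt) {t : Fin 4 → ℂ} (ht : t ∈ wt) :
    ‖t 0‖ * ‖t 1‖ ≤ 1 := by
  simpa [fundPoly] using H.norm_le t ht 1

theorem norm_two_le (H : IsWeightSet q z wt) {t : Fin 4 → ℂ} (ht : t ∈ wt) :
    ‖t 0‖ * ‖t 1‖ * ‖t 2‖ ≤ 1 := by
  simpa [fundPoly] using H.norm_le t ht 2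

theorem norm_three (H : IsWeightSet q z wt) (hz : eval z (symPoly 3) = 1) {t : Fin 4 → ℂ}
    (ht : t ∈ wt) : ‖t 0‖ * ‖t 1‖ * ‖t 2‖ * ‖t 3‖ = 1 := by
  have h := H.symm t ht 3
  rw [hz] at h
  simpa [symPoly] using congrArg norm h

/-- The prefix product before an entry is small, if the prefix product that ends with a
pair of entries is bounded by one. -/
theorem norm_prefix_lt (H : IsWeightSet q z wt) (hz : eval z (symPoly 3) = 1) {t : Fin 4 → ℂ}
    (ht : t ∈ wt) {i : Fin 3} (hi : 1 < ‖t i.succ‖) : ‖eval t (fundPoly i)‖ < 1 := by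
  have key : ∀ x y : ℝ, 0 ≤ x → 1 < y → x * y ≤ 1 → x < 1 := by
    intro x y hx hy hxy
    nlinarith
  fin_cases i
  · simpa [fundPoly] using key _ _ (norm_nonneg _) hi (H.norm_one_le ht)
  · simpa [fundPoly] using key _ _ (by positivity) hi (H.norm_two_le ht)
  · simpa [fundPoly] using key _ _ (by positivity) hi (H.norm_three hz ht).le

/-- A large entry can be moved one place forward: the product up to and including it is at most 1,
so the product before it is strictly less than 1 and the exchange is permitted. -/
theorem exists_mem_castSucc (H : IsWeightSet q z wt) (hz : eval z (symPoly 3) = 1)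
    {t : Fin 4 → ℂ} (ht : t ∈ wt) {i : Fin 3} {v : ℂ} (hi : t i.succ = v) (hv : 1 < ‖v‖)
    (hne : v ≠ q * t i.castSucc) : ∃ t' ∈ wt, t' i.castSucc = v :=
  ⟨_, H.swap t ht i (H.norm_prefix_lt hz ht (hi ▸ hv)) (hi ▸ hne), by simp [hi]⟩

theorem exists_mem_apply_eq (H : IsWeightSet q z wt) (j : Fin 4) : ∃ t ∈ wt, ∃ i, t i = z j := by
  obtain ⟨t, ht⟩ := H.nonempty
  obtain ⟨i, hi⟩ := exists_eq_of_eval_symPoly (fun k => (H.symm t ht k).symm) j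
  exact ⟨t, ht, i, hi⟩

/-- An entry outside of the closed unit disc has, in some tuple, an entry `q` times smaller
immediately before it. -/
theorem exists_adjacent (H : IsWeightSet q z wt) (hz : eval z (symPoly 3) = 1) {j : Fin 4}
    (hv : 1 < ‖z j‖) : ∃ t ∈ wt, ∃ i : Fin 3, t i.succ = z j ∧ z j = q * t i.castSucc := by
  -- If nothing ever blocked the entry it could be moved to the front, where absolute values are at
  -- most 1.
  by_contra! hno
  have step : ∀ i : Fin 3, (∃ t ∈ wt, t i.succ = z j) → ∃ t ∈ wt, t i.castSucc = z j := by
    rintro i ⟨t, ht, hi⟩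
    exact H.exists_mem_castSucc hz ht hi hv (hno t ht i hi)
  have h0 : ¬ ∃ t ∈ wt, t 0 = z j := by
    rintro ⟨t, ht, h⟩
    have := H.norm_zero_le ht
    rw [h] at this
    linarith
  have h1 : ¬ ∃ t ∈ wt, t 1 = z j := fun h => h0 (step 0 h)
  have h2 : ¬ ∃ t ∈ wt, t 2 = z j := fun h => h1 (step 1 h)
  have h3 : ¬ ∃ t ∈ wt, t 3 = z j := fun h => h2 (step 2 h)
  obtain ⟨t, ht, i, hi⟩ := H.exists_mem_apply_eq j
  fin_cases i
  · exact h0 ⟨t, ht, hi⟩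
  · exact h1 ⟨t, ht, hi⟩
  · exact h2 ⟨t, ht, hi⟩
  · exact h3 ⟨t, ht, hi⟩

theorem exists_eq_mul (H : IsWeightSet q z wt) (hz : eval z (symPoly 3) = 1) {j : Fin 4}
    (hv : 1 < ‖z j‖) : ∃ l, z j = q * z l := by
  obtain ⟨t, ht, i, -, hi⟩ := H.exists_adjacent hz hv
  obtain ⟨l, hl⟩ := exists_eq_of_eval_symPoly (H.symm t ht) i.castSucc
  exact ⟨l, hl ▸ hi⟩

/-- A pair of entries `(z l, z j)` with `z j = q z l` and product outside of the closed unit disc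
cannot move to the front of the tuple. -/
theorem exists_eq_mul_of_pair (H : IsWeightSet q z wt) (hz : eval z (symPoly 3) = 1)
    (hinj : Function.Injective z) (hq : q ≠ 0) {j l : Fin 4} (hj : 1 < ‖z j‖) (hl : ‖z l‖ < 1)
    (hjl : z j = q * z l) (hmul : 1 < ‖z l‖ * ‖z j‖) : ∃ x, z l = q * z x := by
  by_contra! hno
  have hq' : (q : ℂ) ≠ 0 := Complex.ofReal_ne_zero.mpr hq
  obtain ⟨t, ht, i, hi, hi'⟩ := H.exists_adjacent hz hj
  have hi'' : t i.castSucc = z l := mul_left_cancel₀ hq' (hi'.symm.trans hjl)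
  have hpos : ∀ t ∈ wt, ∀ x, t x ≠ 0 := by
    intro t ht x hx
    have h3 := H.norm_three hz ht
    fin_cases x <;> simp_all
  -- The pair cannot stand at the front, because the product of the first two entries is bounded by
  -- 1. The next steps move it forward as a unit.
  have h0 : ¬ ∃ t ∈ wt, t 0 = z l ∧ t 1 = z j := by
    rintro ⟨t, ht, h, h'⟩
    have := H.norm_one_le ht
    rw [h, h'] at this
    linarith
  have hne : ∀ t ∈ wt, ∀ x, z l ≠ q * t x := by
    intro t ht x
    obtain ⟨y, hy⟩ := exists_eq_of_eval_symPoly (H.symm t ht) x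
    rw [← hy]
    exact hno y
  -- The only entry that can block `z j` is `z l` itself, since the entries are distinct.
  have hne' : ∀ t ∈ wt, ∀ x y, x ≠ y → t y = z l → z j ≠ q * t x := by
    intro t ht x y hxy hy hx
    have : t x = t y := by
      rw [hy]
      exact mul_left_cancel₀ hq' (hx.symm.trans hjl)
    exact hxy (injective_of_eval_symPoly (fun k => (H.symm t ht k).symm) hinj this)
  have key : ∀ x y : ℝ, 0 ≤ x → 1 < y → x * y ≤ 1 → x < 1 := by
    intro x y hx hy hxy
    nlinarith
  -- The pair has product greater than 1, so the entry before it is less than 1. That entry is first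
  -- exchanged with `z l`, permitted because no entry is q times smaller than `z l`, and then with
  -- `z j`.
  have h1 : ¬ ∃ t ∈ wt, t 1 = z l ∧ t 2 = z j := by
    rintro ⟨t, ht, h, h'⟩
    have hp : ‖t 0‖ < 1 := by
      have := H.norm_two_le ht
      rw [h, h', mul_assoc] at this
      exact key _ _ (norm_nonneg _) hmul this
    have hs := H.swap t ht 0 (by simpa [fundPoly] using hp) (by simpa [h] using hne t ht 0)
    have e : ∀ x, (Equiv.swap (0 : Fin 4) 1) x = ![1, 0, 2, 3] x := by decide
    have e' : ∀ x, (Equiv.swap (1 : Fin 4) 2) x = ![0, 2, 1, 3] x := by decide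
    have hs' := H.swap _ hs 1 (by
      simpa [fundPoly, e, h] using mul_lt_one_of_nonneg_of_lt_one_left (norm_nonneg _) hl hp.le)
      (by simpa [e, h'] using hne' t ht 0 1 (by decide) h)
    exact h0 ⟨_, hs', by simp [e, e', h], by simp [e, e', h']⟩
  have h2 : ¬ ∃ t ∈ wt, t 2 = z l ∧ t 3 = z j := by
    rintro ⟨t, ht, h, h'⟩
    have hp : ‖t 0‖ * ‖t 1‖ < 1 := by
      have := (H.norm_three hz ht).le
      rw [h, h', mul_assoc] at this
      exact key _ _ (by positivity) hmul this
    have hs := H.swap t ht 1 (by simpa [fundPoly] using hp) (by simpa [h] using hne t ht 1)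
    have e : ∀ x, (Equiv.swap (1 : Fin 4) 2) x = ![0, 2, 1, 3] x := by decide
    have e' : ∀ x, (Equiv.swap (2 : Fin 4) 3) x = ![0, 1, 3, 2] x := by decide
    have hs' := H.swap _ hs 2 (by
      have hlt : ‖z l‖ * (‖t 0‖ * ‖t 1‖) < 1 :=
        mul_lt_one_of_nonneg_of_lt_one_left (norm_nonneg _) hl hp.le
      have e3 : ‖t 0‖ * ‖z l‖ * ‖t 1‖ = ‖z l‖ * (‖t 0‖ * ‖t 1‖) := by ring
      simpa [fundPoly, e, h, e3] using hlt)
      (by simpa [e, h'] using hne' t ht 1 2 (by decide) h)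
    exact h1 ⟨_, hs', by simp [e, e', h], by simp [e, e', h']⟩
  fin_cases i
  · exact h0 ⟨t, ht, hi'', hi⟩
  · exact h1 ⟨t, ht, hi'', hi⟩
  · exact h2 ⟨t, ht, hi'', hi⟩

end IsWeightSet

end Building
end

/-! ### Tuples stable under inversion in the unit circle -/

noncomputable section

namespace Building

open MvPolynomial (eval)
open scoped ComplexConjugate

theorem eval_symPoly_zero (z : Fin 4 → ℂ) : eval z (symPoly 0) = z 0 + z 1 + z 2 + z 3 := by
  simp [symPoly]

theorem eval_symPoly_one (z : Fin 4 → ℂ) : eval z (symPoly 1) =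
    z 0 * z 1 + z 0 * z 2 + z 0 * z 3 + z 1 * z 2 + z 1 * z 3 + z 2 * z 3 := by
  simp [symPoly]

theorem eval_symPoly_two (z : Fin 4 → ℂ) : eval z (symPoly 2) =
    z 0 * z 1 * z 2 + z 0 * z 1 * z 3 + z 0 * z 2 * z 3 + z 1 * z 2 * z 3 := by
  simp [symPoly]

theorem eval_symPoly_three (z : Fin 4 → ℂ) : eval z (symPoly 3) = z 0 * z 1 * z 2 * z 3 := by
  simp [symPoly]

/-- The elementary symmetric functions of the tuple are those of a tuple that is stable under
`z ↦ 1 / conj z`. -/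
structure IsHermitianTuple (z : Fin 4 → ℂ) : Prop where
  three : eval z (symPoly 3) = 1
  zero_two : eval z (symPoly 2) = conj (eval z (symPoly 0))
  one : conj (eval z (symPoly 1)) = eval z (symPoly 1)

theorem eval_comp_perm_symPoly (z : Fin 4 → ℂ) (p : Equiv.Perm (Fin 4)) (k : Fin 4) :
    eval (z ∘ p) (symPoly k) = eval z (symPoly k) := by
  have hs : ∀ (i : Fin 3) (z : Fin 4 → ℂ),
      eval (z ∘ Equiv.swap i.castSucc i.succ) (symPoly k) = eval z (symPoly k) := by
    intro i z
    have h0 : ∀ j, (Equiv.swap (0 : Fin 4) 1) j = ![1, 0, 2, 3] j := by decide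
    have h1 : ∀ j, (Equiv.swap (1 : Fin 4) 2) j = ![0, 2, 1, 3] j := by decide
    have h2 : ∀ j, (Equiv.swap (2 : Fin 4) 3) j = ![0, 1, 3, 2] j := by decide
    fin_cases i <;> fin_cases k <;>
      simp [symPoly, h0, h1, h2, -mul_eq_mul_right_iff, -mul_eq_mul_left_iff] <;> ring
  -- Adjacent transpositions generate the symmetric group.
  induction p using Submonoid.induction_of_closure_eq_top_right
    (Equiv.Perm.mclosure_swap_castSucc_succ 3) with
  | one => rfl
  | mul_right p s hs' ih =>
    obtain ⟨i, rfl⟩ := hs'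
    rw [Equiv.Perm.coe_mul, ← Function.comp_assoc, hs, ih]

namespace IsHermitianTuple

variable {z : Fin 4 → ℂ}

theorem comp_perm (h : IsHermitianTuple z) (p : Equiv.Perm (Fin 4)) :
    IsHermitianTuple (z ∘ p) := by
  constructor <;> simp only [eval_comp_perm_symPoly, h.three, h.zero_two, h.one]

theorem ne_zero (h : IsHermitianTuple z) (i : Fin 4) : z i ≠ 0 := by
  have h3 := h.three
  rw [eval_symPoly_three] at h3
  intro hi
  fin_cases i <;> simp_all

/-- The monic polynomial with roots `z` has constant term 1 and is unchanged when its coefficients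
are conjugated and reversed, so its roots are permuted by `x ↦ 1 / conj x`. -/
theorem exists_eq_inv_conj (h : IsHermitianTuple z) (i : Fin 4) : ∃ j, z j = (conj (z i))⁻¹ := by
  have hp : ∀ x : ℂ, ∏ j, (x - z j) = x ^ 4 - eval z (symPoly 0) * x ^ 3 +
      eval z (symPoly 1) * x ^ 2 - eval z (symPoly 2) * x + 1 := by
    intro x
    rw [← h.three]
    simp only [symPoly, Fin.prod_univ_four, map_add, map_mul, MvPolynomial.eval_X]
    ring
  have h0 := hp (z i)
  rw [Finset.prod_eq_zero (Finset.mem_univ i) (sub_self _)] at h0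
  have h1 := congrArg conj h0
  have h2 : eval z (symPoly 0) = conj (eval z (symPoly 2)) := by
    rw [h.zero_two, Complex.conj_conj]
  simp only [map_zero, map_add, map_sub, map_mul, map_pow, map_one, ← h.zero_two, h.one,
    ← h2] at h1
  have hc : conj (z i) ≠ 0 := (map_ne_zero _).mpr (h.ne_zero i)
  have h3 : ∏ j, ((conj (z i))⁻¹ - z j) = 0 := by
    rw [hp]
    field_simp
    linear_combination -h1
  obtain ⟨j, -, hj⟩ := Finset.prod_eq_zero_iff.mp h3
  exact ⟨j, (sub_eq_zero.mp hj).symm⟩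

/-- The relation `exists_eq_inv_conj` ignores multiplicities, so removing one pair needs a separate
argument. The remaining two entries have a product of absolute value 1 and satisfy `z₁ + z₂ = z₁ z₂
(conj z₁ + conj z₂)`; if one is off the unit circle this determines the other. -/
theorem middle (h : IsHermitianTuple z) (h3 : z 3 = (conj (z 0))⁻¹) :
    (‖z 1‖ = 1 ∧ ‖z 2‖ = 1) ∨ z 2 = (conj (z 1))⁻¹ := by
  have hz := h.ne_zero
  have e3 := h.three
  have e2 := h.zero_two
  simp only [eval_symPoly_zero, eval_symPoly_two, eval_symPoly_three, map_add] at e2 e3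
  have hc : conj (z 0) ≠ 0 := (map_ne_zero _).mpr (hz 0)
  have a0 : conj (z 0) * z 3 = 1 := by rw [h3, mul_inv_cancel₀ hc]
  have a3 : z 0 * conj (z 3) = 1 := by simpa using congrArg conj a0
  have key : z 1 + z 2 = z 1 * z 2 * (conj (z 1) + conj (z 2)) := by
    linear_combination (z 1 * z 2) * e2 - (z 1 + z 2) * e3 - z 1 * z 2 * (conj (z 0) + conj (z 3))
      * e3 + (z 1 * z 2) ^ 2 * z 0 * a0 +
      (z 1 * z 2) ^ 2 * z 3 * a3
  have n1 : z 1 * conj (z 1) = (‖z 1‖ ^ 2 : ℝ) := by rw [Complex.mul_conj']; norm_cast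
  have n2 : z 2 * conj (z 2) = (‖z 2‖ ^ 2 : ℝ) := by rw [Complex.mul_conj']; norm_cast
  have h12 : ‖z 1‖ * ‖z 2‖ = 1 := by
    have := congrArg norm e3
    have a0' := congrArg norm a0
    simp only [norm_mul, RCLike.norm_conj, norm_one] at this a0'
    linear_combination this - ‖z 1‖ * ‖z 2‖ * a0'
  by_cases hu : ‖z 1‖ = 1
  · left
    exact ⟨hu, by simpa [hu] using h12⟩
  · right
    have key2 : z 1 * (1 - (‖z 2‖ ^ 2 : ℝ)) = z 2 * ((‖z 1‖ ^ 2 : ℝ) - 1) := by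
      rw [← n1, ← n2]
      linear_combination key
    have key3 : (1 - ‖z 2‖ ^ 2) * ‖z 1‖ ^ 2 = ‖z 1‖ ^ 2 - 1 := by
      linear_combination (-‖z 1‖ * ‖z 2‖ - 1) * h12
    have hne : (((‖z 1‖ ^ 2 - 1 : ℝ)) : ℂ) ≠ 0 := by
      rw [Complex.ofReal_ne_zero]
      intro h0
      have : (‖z 1‖ - 1) * (‖z 1‖ + 1) = 0 := by linear_combination h0
      rcases mul_eq_zero.mp this with h | h
      · exact hu (by linarith)
      · linarith [norm_nonneg (z 1)]
    apply eq_inv_of_mul_eq_one_left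
    apply mul_left_cancel₀ hne
    have key3' := congrArg (fun x : ℝ => (x : ℂ)) key3
    push_cast at key2 key3' n1 ⊢
    linear_combination -conj (z 1) * key2 + (1 - (‖z 2‖ : ℂ) ^ 2) * n1 + key3'

/-- Up to a permutation, a Hermitian tuple consists of numbers of absolute value one and of pairs
`x, 1 / conj x`. -/
theorem exists_perm (h : IsHermitianTuple z) : (∀ i, ‖z i‖ = 1) ∨
    ∃ p : Equiv.Perm (Fin 4), 1 < ‖z (p 0)‖ ∧ z (p 3) = (conj (z (p 0)))⁻¹ ∧
      ((‖z (p 1)‖ = 1 ∧ ‖z (p 2)‖ = 1) ∨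
        (1 < ‖z (p 1)‖ ∧ ‖z (p 1)‖ ≤ ‖z (p 0)‖ ∧ z (p 2) = (conj (z (p 1)))⁻¹)) := by
  by_cases hall : ∀ i, ‖z i‖ = 1
  · exact Or.inl hall
  right
  obtain ⟨a, -, ha⟩ := Finset.exists_max_image Finset.univ (fun i => ‖z i‖) Finset.univ_nonempty
  obtain ⟨b, hb⟩ := h.exists_eq_inv_conj a
  have hbn : ‖z b‖ = ‖z a‖⁻¹ := by rw [hb, norm_inv, RCLike.norm_conj]
  have hpos : ∀ i, 0 < ‖z i‖ := fun i => norm_pos_iff.mpr (h.ne_zero i)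
  have ha1 : 1 < ‖z a‖ := by
    by_contra! hle
    apply hall
    intro i
    refine le_antisymm ((ha i (Finset.mem_univ i)).trans hle) ?_
    obtain ⟨j, hj⟩ := h.exists_eq_inv_conj i
    have hjn := congrArg norm hj
    rw [norm_inv, RCLike.norm_conj] at hjn
    have := (ha j (Finset.mem_univ j)).trans hle
    rw [hjn] at this
    exact (inv_le_one₀ (hpos i)).mp this
  have hab : a ≠ b := by
    rintro rfl
    have := inv_lt_one_of_one_lt₀ ha1
    linarith
  have hσ : ∀ a b : Fin 4, a ≠ b → ∃ c d : Fin 4, Function.Injective ![a, c, d, b] := by decide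
  obtain ⟨c, d, hinj⟩ := hσ a b hab
  let p : Equiv.Perm (Fin 4) :=
    Equiv.ofBijective ![a, c, d, b] (Finite.injective_iff_bijective.mp hinj)
  have hp3 : z (p 3) = (conj (z (p 0)))⁻¹ := hb
  rcases (h.comp_perm p).middle hp3 with hm | hm
  · exact ⟨p, ha1, hp3, Or.inl hm⟩
  · have hm' : z d = (conj (z c))⁻¹ := hm
    have hmn : ‖z d‖ = ‖z c‖⁻¹ := by rw [hm', norm_inv, RCLike.norm_conj]
    rcases lt_trichotomy 1 ‖z c‖ with hc | hc | hc
    · exact ⟨p, ha1, hp3, Or.inr ⟨hc, ha c (Finset.mem_univ c), hm⟩⟩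
    · exact ⟨p, ha1, hp3, Or.inl ⟨hc.symm, by change ‖z d‖ = 1; rw [hmn, ← hc, inv_one]⟩⟩
    -- The larger entry of the second pair is put in position 1.
    · refine ⟨p * Equiv.swap 1 2, ?_, ?_, Or.inr ⟨?_, ?_, ?_⟩⟩
      · exact ha1
      · exact hp3
      · change 1 < ‖z d‖
        rw [hmn]
        exact (one_lt_inv₀ (hpos c)).mpr hc
      · exact ha d (Finset.mem_univ d)
      · change z c = (conj (z d))⁻¹
        rw [hm', map_inv₀, Complex.conj_conj, inv_inv]

end IsHermitianTuple

end Building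
end

/-! ### The five forms and the case analysis -/

noncomputable section

namespace Building

open MvPolynomial (eval)
open scoped ComplexConjugate

/-! ### Multisets of absolute values -/

theorem moduli_vec (a b c d : ℂ) : moduli ![a, b, c, d] = {‖a‖, ‖b‖, ‖c‖, ‖d‖} := rfl

theorem moduli_comp_perm (z : Fin 4 → ℂ) (p : Equiv.Perm (Fin 4)) :
    moduli (z ∘ p) = moduli z := by
  have h := congrArg Finset.val (Finset.map_univ_equiv p)
  rw [Finset.map_val] at h
  rw [moduli, moduli]
  nth_rewrite 2 [← h]
  rw [Multiset.map_map]
  rfl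

section PartitionModuli

variable {q : ℝ}

theorem rpow_half_values (hq : 0 < q) : q ^ (3 / 2 : ℝ) = q * √q ∧ q ^ (1 / 2 : ℝ) = √q ∧
    q ^ (-(1 / 2) : ℝ) = (√q)⁻¹ ∧ q ^ (-(3 / 2) : ℝ) = (q * √q)⁻¹ := by
  have h1 : q ^ (1 / 2 : ℝ) = √q := (Real.sqrt_eq_rpow q).symm
  have h2 : q ^ (3 / 2 : ℝ) = q * √q := by
    rw [show (3 / 2 : ℝ) = 1 + 1 / 2 by norm_num, Real.rpow_add hq, Real.rpow_one, h1]
  exact ⟨h2, h1, by rw [Real.rpow_neg hq.le, h1], by rw [Real.rpow_neg hq.le, h2]⟩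

theorem partitionModuli_eq (q : ℝ) (parts : Multiset ℕ) : partitionModuli q parts =
    parts.bind fun n => (Multiset.range n).map fun j : ℕ => q ^ (((n : ℝ) - 1) / 2 - (j : ℝ)) := by
  simp [partitionModuli, Multiset.bind_def, Multiset.pure_def, Multiset.bind_singleton]

theorem partitionModuli_four (hq : 0 < q) :
    partitionModuli q {4} = {q * √q, √q, (√q)⁻¹, (q * √q)⁻¹} := by
  obtain ⟨h1, h2, h3, h4⟩ := rpow_half_values hq
  have : Multiset.range 4 = {0, 1, 2, 3} := rfl
  simp only [partitionModuli_eq, Multiset.singleton_bind, this, Multiset.insert_eq_cons,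
    Multiset.map_cons, Multiset.map_singleton]
  rw [show (((4 : ℕ) : ℝ) - 1) / 2 - ((0 : ℕ) : ℝ) = 3 / 2 by norm_num,
    show (((4 : ℕ) : ℝ) - 1) / 2 - ((1 : ℕ) : ℝ) = 1 / 2 by norm_num,
    show (((4 : ℕ) : ℝ) - 1) / 2 - ((2 : ℕ) : ℝ) = -(1 / 2) by norm_num,
    show (((4 : ℕ) : ℝ) - 1) / 2 - ((3 : ℕ) : ℝ) = -(3 / 2) by norm_num, h1, h2, h3, h4]

theorem partitionModuli_three_one (hq : 0 < q) :
    partitionModuli q {3, 1} = {q, 1, 1, q⁻¹} := by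
  have : Multiset.range 3 = {0, 1, 2} := rfl
  have h1 : Multiset.range 1 = {0} := rfl
  simp only [partitionModuli_eq, Multiset.singleton_bind, this, h1, Multiset.insert_eq_cons,
    Multiset.map_cons, Multiset.map_singleton, Multiset.cons_bind]
  norm_num [Real.rpow_neg hq.le]
  ext x
  simp only [Multiset.count_cons, Multiset.count_singleton]
  ring

theorem partitionModuli_two_two (hq : 0 < q) :
    partitionModuli q {2, 2} = {√q, √q, (√q)⁻¹, (√q)⁻¹} := by
  obtain ⟨-, h2, h3, -⟩ := rpow_half_values hq
  have : Multiset.range 2 = {0, 1} := rfl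
  simp only [partitionModuli_eq, Multiset.singleton_bind, this, Multiset.insert_eq_cons,
    Multiset.map_cons, Multiset.map_singleton, Multiset.cons_bind]
  rw [show (((2 : ℕ) : ℝ) - 1) / 2 - ((0 : ℕ) : ℝ) = 1 / 2 by norm_num,
    show (((2 : ℕ) : ℝ) - 1) / 2 - ((1 : ℕ) : ℝ) = -(1 / 2) by norm_num, h2, h3]
  norm_num

theorem partitionModuli_two_one_one (hq : 0 < q) :
    partitionModuli q {2, 1, 1} = {√q, 1, 1, (√q)⁻¹} := by
  obtain ⟨-, h2, h3, -⟩ := rpow_half_values hq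
  have : Multiset.range 2 = {0, 1} := rfl
  have h1 : Multiset.range 1 = {0} := rfl
  simp only [partitionModuli_eq, Multiset.singleton_bind, this, h1, Multiset.insert_eq_cons,
    Multiset.map_cons, Multiset.map_singleton, Multiset.cons_bind]
  rw [show (((2 : ℕ) : ℝ) - 1) / 2 - ((0 : ℕ) : ℝ) = 1 / 2 by norm_num,
    show (((2 : ℕ) : ℝ) - 1) / 2 - ((1 : ℕ) : ℝ) = -(1 / 2) by norm_num, h2, h3]
  norm_num
  ext x
  simp only [Multiset.count_cons, Multiset.count_singleton]
  ring

theorem partitionModuli_ones : partitionModuli q {1, 1, 1, 1} = {1, 1, 1, 1} := by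
  have h1 : Multiset.range 1 = {0} := rfl
  simp only [partitionModuli_eq, Multiset.singleton_bind, h1, Multiset.insert_eq_cons,
    Multiset.map_singleton, Multiset.cons_bind]
  norm_num

/-- Taking logarithms to base `q` recovers the exponents, and the sum of their squares is a
numerical invariant of the multiset that is additive over the parts. -/
theorem sum_sq_log_partitionModuli (hq : 1 < q) (parts : Multiset ℕ) :
    ((partitionModuli q parts).map fun x => (Real.log x / Real.log q) ^ 2).sum =
      (parts.map fun n => ((Multiset.range n).map fun j : ℕ =>
        (((n : ℝ) - 1) / 2 - (j : ℝ)) ^ 2).sum).sum := by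
  have hl : Real.log q ≠ 0 := (Real.log_pos hq).ne'
  simp only [partitionModuli_eq, Multiset.map_bind, Multiset.map_map, Multiset.sum_bind,
    Function.comp_def, Real.log_rpow (zero_lt_one.trans hq), mul_div_cancel_right₀ _ hl]

theorem partition_four_parts (P : Nat.Partition 4) : P.parts = {4} ∨ P.parts = {3, 1} ∨
    P.parts = {2, 2} ∨ P.parts = {2, 1, 1} ∨ P.parts = {1, 1, 1, 1} := by
  obtain ⟨l, hl⟩ : ∃ l : List ℕ, (l : Multiset ℕ) = P.parts := Quot.exists_rep _
  have hsum : l.sum = 4 := by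
    rw [← Multiset.sum_coe]
    exact (congrArg Multiset.sum hl).trans P.parts_sum
  have hpos : ∀ n ∈ l, 0 < n := fun n hn => P.parts_pos (hl ▸ Multiset.mem_coe.mpr hn)
  rw [← hl]
  clear hl
  rcases l with _ | ⟨a, _ | ⟨b, _ | ⟨c, _ | ⟨d, _ | ⟨e, l⟩⟩⟩⟩⟩ <;>
    simp only [List.sum_cons, List.sum_nil, List.forall_mem_cons] at hsum hpos
  · omega
  · obtain rfl : a = 4 := by omega
    decide
  · obtain ⟨ha, hb, -⟩ := hpos
    obtain rfl : b = 4 - a := by omega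
    have : a < 4 := by omega
    interval_cases a <;> decide
  · obtain ⟨ha, hb, hc, -⟩ := hpos
    have : a < 3 := by omega
    have : b < 3 := by omega
    obtain rfl : c = 4 - a - b := by omega
    interval_cases a <;> interval_cases b <;> first | decide | omega
  · obtain ⟨rfl, rfl, rfl, rfl⟩ : a = 1 ∧ b = 1 ∧ c = 1 ∧ d = 1 := by omega
    decide
  · omega

/-- The sum of squared exponents is 5, 2, 1, 1/2, 0 on the five partitions, so it separates them. -/
theorem partitionModuli_injective (hq : 1 < q) :
    Function.Injective (fun P : Nat.Partition 4 => partitionModuli q P.parts) := by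
  intro P Q h
  have h' := congrArg (fun S : Multiset ℝ => (S.map fun x => (Real.log x / Real.log q) ^ 2).sum) h
  simp only [sum_sq_log_partitionModuli hq] at h'
  ext1
  rcases partition_four_parts P with hP | hP | hP | hP | hP <;>
    rcases partition_four_parts Q with hQ | hQ | hQ | hQ | hQ <;>
    rw [hP, hQ] at h' ⊢ <;> exfalso <;>
    norm_num [Multiset.range_succ] at h'

end PartitionModuli

/-! ### The five forms -/

/-- The five possible forms of the parameter of a point of the spectrum. -/
def IsPartitionForm (q : ℝ) (w : Fin 4 → ℂ) : Prop :=
  ((∃ j : Fin 4, w =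
      ![((q * √q : ℝ) : ℂ) * Complex.I ^ (j : ℕ), ((√q : ℝ) : ℂ) * Complex.I ^ (j : ℕ),
        ((1 / √q : ℝ) : ℂ) * Complex.I ^ (j : ℕ),
        ((1 / (q * √q) : ℝ) : ℂ) * Complex.I ^ (j : ℕ)]) ∧
    moduli w = partitionModuli q {4}) ∨
  ((∃ θ : ℝ, w =
      ![(q : ℂ) * Complex.exp (θ * Complex.I), Complex.exp (θ * Complex.I),
        Complex.exp (-3 * θ * Complex.I), ((1 / q : ℝ) : ℂ) * Complex.exp (θ * Complex.I)]) ∧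
    moduli w = partitionModuli q {3, 1}) ∨
  ((∃ θ : ℝ, ∃ ε : ℂ, (ε = 1 ∨ ε = -1) ∧ w =
      ![((√q : ℝ) : ℂ) * Complex.exp (θ * Complex.I),
        ε * ((√q : ℝ) : ℂ) * Complex.exp (-θ * Complex.I),
        ((1 / √q : ℝ) : ℂ) * Complex.exp (θ * Complex.I),
        ε * ((1 / √q : ℝ) : ℂ) * Complex.exp (-θ * Complex.I)]) ∧
    moduli w = partitionModuli q {2, 2}) ∨
  ((∃ θ₁ θ₂ : ℝ, w =
      ![((√q : ℝ) : ℂ) * Complex.exp (θ₁ * Complex.I), Complex.exp (θ₂ * Complex.I),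
        Complex.exp (-(θ₂ + 2 * θ₁) * Complex.I),
        ((1 / √q : ℝ) : ℂ) * Complex.exp (θ₁ * Complex.I)]) ∧
    moduli w = partitionModuli q {2, 1, 1}) ∨
  ((∃ θ₁ θ₂ θ₃ : ℝ, w =
      ![Complex.exp (θ₁ * Complex.I), Complex.exp (θ₂ * Complex.I),
        Complex.exp (θ₃ * Complex.I), Complex.exp (-(θ₁ + θ₂ + θ₃) * Complex.I)]) ∧
    moduli w = partitionModuli q {1, 1, 1, 1})

theorem exists_eq_exp {u : ℂ} (hu : ‖u‖ = 1) : ∃ θ : ℝ, u = Complex.exp (θ * Complex.I) :=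
  ⟨u.arg, by simpa [hu] using (Complex.norm_mul_exp_arg_mul_I u).symm⟩

theorem exists_eq_mul_exp {z : ℂ} {r : ℝ} (hz : ‖z‖ = r) :
    ∃ θ : ℝ, z = r * Complex.exp (θ * Complex.I) :=
  ⟨z.arg, by rw [← hz, Complex.norm_mul_exp_arg_mul_I]⟩

theorem conj_exp_mul_I (θ : ℝ) :
    conj (Complex.exp (θ * Complex.I)) = (Complex.exp (θ * Complex.I))⁻¹ := by
  rw [← Complex.exp_conj, ← Complex.exp_neg]
  simp

section Forms

variable {q : ℝ} {z : Fin 4 → ℂ}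

theorem isPartitionForm_of_norm_eq_one (h3 : eval z (symPoly 3) = 1) (h : ∀ i, ‖z i‖ = 1) :
    IsPartitionForm q z := by
  obtain ⟨a, ha⟩ := exists_eq_exp (h 0)
  obtain ⟨b, hb⟩ := exists_eq_exp (h 1)
  obtain ⟨c, hc⟩ := exists_eq_exp (h 2)
  rw [eval_symPoly_three, ha, hb, hc] at h3
  have hd : z 3 = Complex.exp (-(a + b + c) * Complex.I) := by
    rw [neg_mul, Complex.exp_neg]
    apply eq_inv_of_mul_eq_one_right
    rw [← h3, add_mul, add_mul, Complex.exp_add, Complex.exp_add]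
  refine Or.inr (Or.inr (Or.inr (Or.inr ⟨⟨a, b, c, ?_⟩, ?_⟩)))
  · ext i
    fin_cases i <;> assumption
  · rw [partitionModuli_ones]
    change ({‖z 0‖, ‖z 1‖, ‖z 2‖, ‖z 3‖} : Multiset ℝ) = _
    simp only [h]

/-- One phase determines everything: `z 0` and its partner `z 3` share the phase of `z 1`, and the
product condition fixes `z 2`. -/
theorem isPartitionForm_three_one (hq : 1 < q) (h3 : eval z (symPoly 3) = 1)
    (hz3 : z 3 = (conj (z 0))⁻¹) (h1 : ‖z 1‖ = 1) (h01 : z 0 = q * z 1) :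
    IsPartitionForm q z := by
  obtain ⟨θ, hθ⟩ := exists_eq_exp h1
  have hq0 : (q : ℂ) ≠ 0 := Complex.ofReal_ne_zero.mpr (by linarith)
  have he : Complex.exp (θ * Complex.I) ≠ 0 := Complex.exp_ne_zero _
  have hz3' : z 3 = ((1 / q : ℝ) : ℂ) * Complex.exp (θ * Complex.I) := by
    rw [hz3, h01, hθ, map_mul, conj_exp_mul_I, Complex.conj_ofReal]
    push_cast
    field_simp
  rw [hθ] at h01
  have h2 : z 2 = Complex.exp (-3 * θ * Complex.I) := by
    rw [neg_mul, neg_mul, Complex.exp_neg]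
    apply eq_inv_of_mul_eq_one_right
    rw [mul_assoc, show (3 : ℂ) * (θ * Complex.I) = θ * Complex.I + θ * Complex.I + θ * Complex.I by
      ring, Complex.exp_add, Complex.exp_add]
    rw [eval_symPoly_three, h01, hθ, hz3'] at h3
    rw [← h3]
    push_cast
    field_simp
  have hz : z = ![(q : ℂ) * Complex.exp (θ * Complex.I), Complex.exp (θ * Complex.I),
        Complex.exp (-3 * θ * Complex.I), ((1 / q : ℝ) : ℂ) * Complex.exp (θ * Complex.I)] := by
    ext i
    fin_cases i <;> assumption
  refine Or.inr (Or.inl ⟨⟨θ, hz⟩, ?_⟩)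
  rw [partitionModuli_three_one (by linarith), hz, moduli_vec]
  have e : Complex.exp (-3 * θ * Complex.I) = Complex.exp ((-3 * θ : ℝ) * Complex.I) := by
    push_cast
    rfl
  rw [e]
  simp only [norm_mul, Complex.norm_exp_ofReal_mul_I, Complex.norm_real, Real.norm_eq_abs, mul_one,
    one_div, abs_inv, abs_of_pos (zero_lt_one.trans hq)]

theorem isPartitionForm_two_one_one (hq : 1 < q) (h3 : eval z (symPoly 3) = 1)
    (hz3 : z 3 = (conj (z 0))⁻¹) (h1 : ‖z 1‖ = 1) (h0 : ‖z 0‖ = √q) :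
    IsPartitionForm q z := by
  obtain ⟨φ, hφ⟩ := exists_eq_exp h1
  obtain ⟨θ, hθ⟩ := exists_eq_mul_exp h0
  have hs : 0 < √q := Real.sqrt_pos.mpr (by linarith)
  have hq0 : ((√q : ℝ) : ℂ) ≠ 0 := Complex.ofReal_ne_zero.mpr hs.ne'
  have he : Complex.exp (θ * Complex.I) ≠ 0 := Complex.exp_ne_zero _
  have hz3' : z 3 = ((1 / √q : ℝ) : ℂ) * Complex.exp (θ * Complex.I) := by
    rw [hz3, hθ, map_mul, conj_exp_mul_I, Complex.conj_ofReal]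
    push_cast
    field_simp
  have h2 : z 2 = Complex.exp (-(φ + 2 * θ) * Complex.I) := by
    rw [neg_mul, Complex.exp_neg]
    apply eq_inv_of_mul_eq_one_right
    rw [show (φ + 2 * θ : ℂ) * Complex.I = φ * Complex.I + (θ * Complex.I + θ * Complex.I) by
      ring, Complex.exp_add, Complex.exp_add]
    rw [eval_symPoly_three, hθ, hφ, hz3'] at h3
    rw [← h3]
    push_cast
    field_simp
  have hz : z = ![((√q : ℝ) : ℂ) * Complex.exp (θ * Complex.I), Complex.exp (φ * Complex.I),
        Complex.exp (-(φ + 2 * θ) * Complex.I),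
        ((1 / √q : ℝ) : ℂ) * Complex.exp (θ * Complex.I)] := by
    ext i
    fin_cases i <;> assumption
  refine Or.inr (Or.inr (Or.inr (Or.inl ⟨⟨θ, φ, hz⟩, ?_⟩)))
  rw [partitionModuli_two_one_one (by linarith), hz, moduli_vec]
  have e : Complex.exp (-(φ + 2 * θ) * Complex.I) =
      Complex.exp ((-(φ + 2 * θ) : ℝ) * Complex.I) := by
    push_cast
    rfl
  rw [e]
  simp only [norm_mul, Complex.norm_exp_ofReal_mul_I, Complex.norm_real, Real.norm_eq_abs, mul_one,
    one_div, abs_inv, abs_of_pos hs]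

theorem isPartitionForm_two_two (hq : 1 < q) (h3 : eval z (symPoly 3) = 1)
    (hz2 : z 2 = (conj (z 0))⁻¹) (hz3 : z 3 = (conj (z 1))⁻¹) (h0 : ‖z 0‖ = √q) (h1 : ‖z 1‖ = √q) :
    IsPartitionForm q z := by
  obtain ⟨φ, hφ⟩ := exists_eq_mul_exp h1
  obtain ⟨θ, hθ⟩ := exists_eq_mul_exp h0
  have hs : 0 < √q := Real.sqrt_pos.mpr (by linarith)
  have hq0 : ((√q : ℝ) : ℂ) ≠ 0 := Complex.ofReal_ne_zero.mpr hs.ne'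
  have he : Complex.exp (θ * Complex.I) ≠ 0 := Complex.exp_ne_zero _
  have he' : Complex.exp (φ * Complex.I) ≠ 0 := Complex.exp_ne_zero _
  have hz2' : z 2 = ((1 / √q : ℝ) : ℂ) * Complex.exp (θ * Complex.I) := by
    rw [hz2, hθ, map_mul, conj_exp_mul_I, Complex.conj_ofReal]
    push_cast
    field_simp
  have hz3' : z 3 = ((1 / √q : ℝ) : ℂ) * Complex.exp (φ * Complex.I) := by
    rw [hz3, hφ, map_mul, conj_exp_mul_I, Complex.conj_ofReal]
    push_cast
    field_simp
  -- The product of the four entries is the square of the product of the two phases, so this product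
  -- is a sign.
  set ε := Complex.exp (θ * Complex.I) * Complex.exp (φ * Complex.I) with hε
  have hε2 : ε = 1 ∨ ε = -1 := by
    rw [← sq_eq_one_iff, hε]
    rw [eval_symPoly_three, hφ, hθ, hz2', hz3'] at h3
    rw [← h3]
    push_cast
    field_simp
  have hφε : Complex.exp (φ * Complex.I) = ε * Complex.exp (-θ * Complex.I) := by
    rw [neg_mul, Complex.exp_neg, hε]
    field_simp
  have hz : z = ![((√q : ℝ) : ℂ) * Complex.exp (θ * Complex.I),
        ε * ((√q : ℝ) : ℂ) * Complex.exp (-θ * Complex.I),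
        ((1 / √q : ℝ) : ℂ) * Complex.exp (θ * Complex.I),
        ε * ((1 / √q : ℝ) : ℂ) * Complex.exp (-θ * Complex.I)] := by
    rw [hφε] at hφ hz3'
    ext i
    fin_cases i
    · exact hθ
    · exact hφ.trans (by rw [← mul_assoc, mul_comm (_ : ℂ) ε]; rfl)
    · exact hz2'
    · exact hz3'.trans (by rw [← mul_assoc, mul_comm (_ : ℂ) ε]; rfl)
  refine Or.inr (Or.inr (Or.inl ⟨⟨θ, ε, hε2, hz⟩, ?_⟩))
  rw [partitionModuli_two_two (by linarith)]
  change ({‖z 0‖, ‖z 1‖, ‖z 2‖, ‖z 3‖} : Multiset ℝ) = _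
  rw [h0, h1, hz2, hz3, norm_inv, norm_inv, RCLike.norm_conj, RCLike.norm_conj, h0, h1]

/-- All four entries have the same phase, and the product condition makes it a fourth root of unity.
-/
theorem isPartitionForm_four (hq : 1 < q) (h3 : eval z (symPoly 3) = 1)
    (hz2 : z 2 = (conj (z 1))⁻¹) (hz3 : z 3 = (conj (z 0))⁻¹) (h01 : z 0 = q * z 1)
    (h1 : ‖z 1‖ = √q) : IsPartitionForm q z := by
  obtain ⟨θ, hθ⟩ := exists_eq_mul_exp h1
  have hs : 0 < √q := Real.sqrt_pos.mpr (by linarith)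
  have hs0 : ((√q : ℝ) : ℂ) ≠ 0 := Complex.ofReal_ne_zero.mpr hs.ne'
  have hq0 : (q : ℂ) ≠ 0 := Complex.ofReal_ne_zero.mpr (by linarith)
  have he : Complex.exp (θ * Complex.I) ≠ 0 := Complex.exp_ne_zero _
  have hz2' : z 2 = ((1 / √q : ℝ) : ℂ) * Complex.exp (θ * Complex.I) := by
    rw [hz2, hθ, map_mul, conj_exp_mul_I, Complex.conj_ofReal]
    push_cast
    field_simp
  have hz3' : z 3 = ((1 / (q * √q) : ℝ) : ℂ) * Complex.exp (θ * Complex.I) := by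
    rw [hz3, h01, hθ, map_mul, map_mul, conj_exp_mul_I, Complex.conj_ofReal, Complex.conj_ofReal]
    push_cast
    field_simp
  have hz0' : z 0 = ((q * √q : ℝ) : ℂ) * Complex.exp (θ * Complex.I) := by
    rw [h01, hθ]
    push_cast
    ring
  rw [eval_symPoly_three, hz0', hθ, hz2', hz3'] at h3
  have h4 : Complex.exp (θ * Complex.I) ^ 4 = 1 := by
    rw [← h3]
    push_cast
    field_simp
  have hI : ∃ j : Fin 4, Complex.exp (θ * Complex.I) = Complex.I ^ (j : ℕ) := by
    set x := Complex.exp (θ * Complex.I)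
    have h5 : (x - 1) * (x + 1) * ((x - Complex.I) * (x + Complex.I)) = 0 := by
      linear_combination h4 + (1 - x ^ 2) * Complex.I_sq
    rcases mul_eq_zero.mp h5 with h | h <;> rcases mul_eq_zero.mp h with h | h
    · exact ⟨0, by simpa using sub_eq_zero.mp h⟩
    · exact ⟨2, by simpa using eq_neg_of_add_eq_zero_left h⟩
    · exact ⟨1, by simpa using sub_eq_zero.mp h⟩
    · exact ⟨3, by simpa [Complex.I_pow_three] using eq_neg_of_add_eq_zero_left h⟩
  obtain ⟨j, hj⟩ := hI
  refine Or.inl ⟨⟨j, ?_⟩, ?_⟩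
  · rw [← hj]
    ext i
    fin_cases i <;> assumption
  · rw [partitionModuli_four (by linarith)]
    change ({‖z 0‖, ‖z 1‖, ‖z 2‖, ‖z 3‖} : Multiset ℝ) = _
    rw [hz3, hz2, norm_inv, norm_inv, RCLike.norm_conj, RCLike.norm_conj, h01, norm_mul, h1,
      Complex.norm_real, Real.norm_eq_abs, abs_of_pos (by linarith)]

end Forms

/-- The parameters of approximate eigenvectors are of one of the five forms. -/
theorem exists_isPartitionForm {q : ℝ} (hq : 1 < q) {z : Fin 4 → ℂ} (hz : IsHermitianTuple z)
    {wt : Set (Fin 4 → ℂ)} (H : IsWeightSet q z wt) :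
    ∃ p : Equiv.Perm (Fin 4), IsPartitionForm q (z ∘ p) := by
  rcases hz.exists_perm with h | ⟨p, hB, hb, h⟩
  · exact ⟨1, isPartitionForm_of_norm_eq_one hz.three h⟩
  -- reduce to the case where the permutation is trivial
  suffices ∀ w : Fin 4 → ℂ, IsHermitianTuple w → IsWeightSet q w wt → 1 < ‖w 0‖ →
      w 3 = (conj (w 0))⁻¹ → ((‖w 1‖ = 1 ∧ ‖w 2‖ = 1) ∨
        (1 < ‖w 1‖ ∧ ‖w 1‖ ≤ ‖w 0‖ ∧ w 2 = (conj (w 1))⁻¹)) →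
      ∃ p : Equiv.Perm (Fin 4), IsPartitionForm q (w ∘ p) by
    obtain ⟨p', hp'⟩ := this (z ∘ p) (hz.comp_perm p)
      (H.of_eval_eq (eval_comp_perm_symPoly z p)) hB hb h
    exact ⟨p * p', hp'⟩
  clear h hb hB p H hz z
  intro z hz H hB hb h
  have hq0 : 0 < q := by linarith
  have hsq := Real.sq_sqrt hq0.le
  have hnq : ‖(q : ℂ)‖ = q := by rw [Complex.norm_real, Real.norm_eq_abs, abs_of_pos hq0]
  have hb' : ‖z 3‖ = ‖z 0‖⁻¹ := by rw [hb, norm_inv, RCLike.norm_conj]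
  -- This covers an entry that is q times its own partner under inversion.
  have sqrt_of : ∀ x : ℝ, 0 < x → x = q * x⁻¹ → x = √q := by
    intro x hx h
    rw [eq_comm, Real.sqrt_eq_iff_mul_self_eq hq0.le hx.le]
    field_simp at h
    linarith
  have hself : ∀ j, 0 < ‖z j‖ → ‖z j‖ ≠ q * ‖z j‖ := by
    intro j hj h
    nlinarith
  obtain ⟨l, hl⟩ := H.exists_eq_mul hz.three hB
  have hln := congrArg norm hl
  rw [norm_mul, hnq] at hln
  rcases h with ⟨hu, hv⟩ | ⟨hC, hCB, hc⟩
  -- Only one pair is off the unit circle. Its large member is q times an entry on the circle,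
  -- giving 3+1, or q times its partner, giving 2+1+1.
  · have h03 : z 0 = q * z 3 → IsPartitionForm q z := by
      intro h
      have hn := congrArg norm h
      rw [norm_mul, hnq, hb'] at hn
      exact isPartitionForm_two_one_one hq hz.three hb hu (sqrt_of _ (by linarith) hn)
    fin_cases l
    · exact absurd hln (hself 0 (by linarith))
    · exact ⟨1, isPartitionForm_three_one hq hz.three hb hu hl⟩
    · exact ⟨Equiv.swap 1 2, isPartitionForm_three_one hq
        ((hz.comp_perm _).three) hb hv hl⟩
    · exact ⟨1, h03 hl⟩
  · have hc' : ‖z 2‖ = ‖z 1‖⁻¹ := by rw [hc, norm_inv, RCLike.norm_conj]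
    obtain ⟨m, hm⟩ := H.exists_eq_mul hz.three hC
    have hmn := congrArg norm hm
    rw [norm_mul, hnq] at hmn
    have h22 : ‖z 0‖ = √q → ‖z 1‖ = √q →
        ∃ p : Equiv.Perm (Fin 4), IsPartitionForm q (z ∘ p) := by
      intro h0 h1
      exact ⟨Equiv.swap 2 3, isPartitionForm_two_two hq ((hz.comp_perm _).three) hb hc h0 h1⟩
    -- The second largest entry cannot be q times the largest one, nor q times itself.
    have hm23 : m = 2 ∨ m = 3 := by
      fin_cases m
      · exfalso
        have : ‖z 1‖ = q * ‖z 0‖ := hmn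
        nlinarith
      · exact absurd hmn (hself 1 (by linarith))
      · exact Or.inl rfl
      · exact Or.inr rfl
    have hl123 : l = 1 ∨ l = 2 ∨ l = 3 := by
      fin_cases l
      · exact absurd hln (hself 0 (by linarith))
      · exact Or.inl rfl
      · exact Or.inr (Or.inl rfl)
      · exact Or.inr (Or.inr rfl)
    have hB0 : 0 < ‖z 0‖ := by linarith
    have hC0 : 0 < ‖z 1‖ := by linarith
    have of_eq : ‖z 0‖ * ‖z 1‖ = q → ‖z 0‖ = ‖z 1‖ →
        ∃ p : Equiv.Perm (Fin 4), IsPartitionForm q (z ∘ p) := by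
      intro hmul heq
      have h1 : ‖z 1‖ = √q := by
        apply sqrt_of _ hC0
        rw [heq] at hmul
        field_simp
        linarith
      exact h22 (heq.trans h1) h1
    rcases hm23 with rfl | rfl
    · have h1 : ‖z 1‖ = √q := sqrt_of _ hC0 (by rw [← hc']; exact hmn)
      rcases hl123 with rfl | rfl | rfl
      · exact ⟨1, isPartitionForm_four hq hz.three hc hb hl h1⟩
      · have : ‖z 0‖ = ‖z 1‖ := by rw [hln, hmn]
        exact h22 (this.trans h1) h1
      · exact h22 (sqrt_of _ hB0 (by rw [← hb']; exact hln)) h1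
    · have hmul : ‖z 0‖ * ‖z 1‖ = q := by
        rw [hmn, hb']
        field_simp
      rcases hl123 with rfl | rfl | rfl
      -- Here `z 0 = q z 1` and `z 1 = q z 3` would make `z 1` an entry of absolute value 1.
      · exfalso
        rw [hln] at hmul
        have : ‖z 1‖ * ‖z 1‖ = 1 := mul_left_cancel₀ hq0.ne' (by linarith)
        nlinarith
      · by_cases heq : ‖z 0‖ = ‖z 1‖
        · exact of_eq hmul heq
        -- Here `z 0 = q z 2`, `z 1 = q z 3` and `|z 0| > |z 1|`. The conditions on single entries
        -- allow a continuum of such tuples. The pair `(z 2, z 0)` has product greater than 1 in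
        -- absolute value, so `z 2` would be q times an entry; but q times even the least entry is
        -- `|z 1| > 1 > |z 2|`.
        · exfalso
          have hlt : ‖z 1‖ < ‖z 0‖ := lt_of_le_of_ne hCB (Ne.symm heq)
          have h2lt : ‖z 2‖ < 1 := by rw [hc']; exact inv_lt_one_of_one_lt₀ hC
          have h32 : ‖z 3‖ < ‖z 2‖ := by
            rw [hc', hb']
            exact inv_strictAnti₀ hC0 hlt
          have hinj : Function.Injective z := by
            intro i j hij
            have hij' := congrArg norm hij
            fin_cases i <;> fin_cases j <;> first | rfl | (exfalso; simp at hij'; linarith)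
          obtain ⟨x, hx⟩ := H.exists_eq_mul_of_pair hz.three hinj hq0.ne' hB h2lt hl (by
            rw [hc']
            have := mul_lt_mul_of_pos_left hlt (inv_pos.mpr hC0)
            rwa [inv_mul_cancel₀ hC0.ne'] at this)
          have hxn := congrArg norm hx
          rw [norm_mul, hnq] at hxn
          have hx3 : ‖z 3‖ ≤ ‖z x‖ := by
            fin_cases x <;> simp <;> linarith
          have := mul_le_mul_of_nonneg_left hx3 hq0.le
          linarith
      · have h0 : ‖z 0‖ = √q := sqrt_of _ hB0 (by rw [← hb']; exact hln)
        refine of_eq hmul ?_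
        have : ‖z 0‖ * ‖z 1‖ = ‖z 0‖ * ‖z 0‖ := by rw [hmul, h0, ← sq, hsq]
        exact (mul_left_cancel₀ hB0.ne' this).symm

end Building
end

/-! ### The quotient of the building: matrices, lattices and diagonal representatives -/

noncomputable section

namespace Building

/-! ### Integral and polynomial matrices -/

section Rings

variable (k : Type*) [Field k]

/-- The valuation ring `O` as a subring of `F`. -/
def intRing : Subring k⸨X⸩ := (algebraMap k⟦X⟧ k⸨X⸩).range

/-- The ring `k[t]` as a subring of `F`. -/
def polyRing : Subring k⸨X⸩ := (Polynomial.aeval (R := k) (tElem k)).toRingHom.range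

/-- `GL(4, O)` as a subgroup of `GL(4, F)`. -/
def GLO : Subgroup (GL (Fin 4) k⸨X⸩) :=
  (Matrix.GeneralLinearGroup.map (n := Fin 4) (algebraMap k⟦X⟧ k⸨X⸩)).range

/-- `GL(4, k[t])` as a subgroup of `GL(4, F)`. -/
def GLP : Subgroup (GL (Fin 4) k⸨X⸩) :=
  (Matrix.GeneralLinearGroup.map (n := Fin 4)
    (Polynomial.aeval (R := k) (tElem k)).toRingHom).range

variable {k}

theorem mem_intRing {x : k⸨X⸩} : x ∈ intRing k ↔ ∀ n < 0, x.coeff n = 0 := by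
  constructor
  · rintro ⟨p, rfl⟩ n hn
    change HahnSeries.coeff (p : k⸨X⸩) n = 0
    rw [PowerSeries.coeff_coe, if_pos hn]
  · intro h
    refine ⟨PowerSeries.mk fun n => x.coeff n, ?_⟩
    ext n
    change HahnSeries.coeff ((PowerSeries.mk fun n => x.coeff n : k⟦X⟧) : k⸨X⸩) n = _
    rw [PowerSeries.coeff_coe]
    split_ifs with hn
    · exact (h n hn).symm
    · rw [PowerSeries.coeff_mk, Int.natCast_natAbs, abs_of_nonneg (not_lt.mp hn)]

theorem order_nonneg_of_mem_intRing {x : k⸨X⸩} (hx : x ∈ intRing k) : 0 ≤ x.order := by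
  by_cases h0 : x = 0
  · simp [h0]
  by_contra! hlt
  exact (HahnSeries.coeff_order_eq_zero.not.mpr h0) (mem_intRing.mp hx _ hlt)

theorem mem_intRing_of_order_nonneg {x : k⸨X⸩} (hx : 0 ≤ x.order) : x ∈ intRing k :=
  mem_intRing.mpr fun _ hn => HahnSeries.coeff_eq_zero_of_lt_order (hn.trans_le hx)

theorem single_mem_intRing {n : ℤ} (hn : 0 ≤ n) (a : k) : HahnSeries.single n a ∈ intRing k :=
  mem_intRing.mpr fun m hm => HahnSeries.coeff_single_of_ne (by omega)

theorem tElem_pow (n : ℕ) : tElem k ^ n = HahnSeries.single (-(n : ℤ)) 1 := by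
  rw [tElem, HahnSeries.single_pow]
  simp

theorem single_mem_polyRing {n : ℤ} (hn : n ≤ 0) (a : k) :
    HahnSeries.single n a ∈ polyRing k := by
  refine ⟨Polynomial.monomial (-n).toNat a, ?_⟩
  change Polynomial.aeval (tElem k) _ = _
  rw [Polynomial.aeval_monomial, tElem_pow, LaurentSeries.algebraMap_apply, HahnSeries.C_apply,
    HahnSeries.single_mul_single]
  simp [hn]

theorem coeff_of_mem_polyRing {x : k⸨X⸩} (hx : x ∈ polyRing k) {n : ℤ} (hn : 0 < n) :
    x.coeff n = 0 := by
  obtain ⟨p, rfl⟩ := hx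
  change (Polynomial.aeval (tElem k) p).coeff n = 0
  induction p using Polynomial.induction_on' with
  | add p q hp hq => rw [map_add, HahnSeries.coeff_add, hp, hq, add_zero]
  | monomial i a =>
    rw [Polynomial.aeval_monomial, tElem_pow, LaurentSeries.algebraMap_apply, HahnSeries.C_apply,
      HahnSeries.single_mul_single]
    exact HahnSeries.coeff_single_of_ne (by omega)

theorem order_nonpos_of_mem_polyRing {x : k⸨X⸩} (hx : x ∈ polyRing k) : x.order ≤ 0 := by
  by_cases h0 : x = 0
  · simp [h0]
  by_contra! hlt
  exact (HahnSeries.coeff_order_eq_zero.not.mpr h0) (coeff_of_mem_polyRing hx hlt)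

/-- The coefficients of the polynomial reappear as the coefficients of the Laurent series at
nonpositive exponents. -/
theorem aeval_tElem_injective :
    Function.Injective (Polynomial.aeval (R := k) (tElem k)).toRingHom := by
  rw [injective_iff_map_eq_zero]
  intro p hp
  change Polynomial.aeval (tElem k) p = 0 at hp
  ext n
  have h : ∀ p : Polynomial k, (Polynomial.aeval (tElem k) p).coeff (-(n : ℤ)) = p.coeff n := by
    intro p
    induction p using Polynomial.induction_on' with
    | add p q hp hq => rw [map_add, HahnSeries.coeff_add, hp, hq, Polynomial.coeff_add]
    | monomial i a =>
      rw [Polynomial.aeval_monomial, tElem_pow, LaurentSeries.algebraMap_apply,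
        HahnSeries.C_apply, HahnSeries.single_mul_single, HahnSeries.coeff_single,
        Polynomial.coeff_monomial]
      simp [eq_comm]
  rw [← h, hp]
  simp

/-- Injectivity makes the lifts of `g` and of its inverse mutually inverse, which turns membership
in `GLO` or `GLP` into an entrywise condition. -/
theorem mem_range_map_iff {R S : Type*} [CommRing R] [CommRing S] {f : R →+* S}
    (hf : Function.Injective f) {g : GL (Fin 4) S} :
    g ∈ (Matrix.GeneralLinearGroup.map (n := Fin 4) f).range ↔
      g.val ∈ f.range.matrix ∧ g⁻¹.val ∈ f.range.matrix := by
  constructor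
  · rintro ⟨a, rfl⟩
    refine ⟨fun i j => ⟨a.val i j, rfl⟩, fun i j => ?_⟩
    rw [← map_inv]
    exact ⟨(a⁻¹).val i j, rfl⟩
  · rintro ⟨h1, h2⟩
    choose A hA using h1
    choose B hB using h2
    have hA' : f.mapMatrix (Matrix.of A) = g.val := by ext i j; exact hA i j
    have hB' : f.mapMatrix (Matrix.of B) = g⁻¹.val := by ext i j; exact hB i j
    have hinj : Function.Injective (f.mapMatrix : Matrix (Fin 4) (Fin 4) R →+* _) := by
      intro P Q h
      ext i j
      exact hf (congrFun (congrFun h i) j)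
    refine ⟨⟨Matrix.of A, Matrix.of B, hinj ?_, hinj ?_⟩, ?_⟩
    · rw [map_mul, hA', hB', map_one, ← Units.val_mul, mul_inv_cancel, Units.val_one]
    · rw [map_mul, hA', hB', map_one, ← Units.val_mul, inv_mul_cancel, Units.val_one]
    · exact Units.ext hA'

theorem mem_GLO_iff {g : GL (Fin 4) k⸨X⸩} :
    g ∈ GLO k ↔ g.val ∈ (intRing k).matrix ∧ g⁻¹.val ∈ (intRing k).matrix :=
  mem_range_map_iff (FaithfulSMul.algebraMap_injective _ _)

theorem mem_GLP_iff {g : GL (Fin 4) k⸨X⸩} :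
    g ∈ GLP k ↔ g.val ∈ (polyRing k).matrix ∧ g⁻¹.val ∈ (polyRing k).matrix :=
  mem_range_map_iff aeval_tElem_injective

theorem mem_Gam_iff {x : PGL(4, k⸨X⸩)} :
    x ∈ Gam k ↔ ∃ g ∈ GLP k, Matrix.ProjGenLinGroup.mk g = x := by
  constructor
  · rintro ⟨a, rfl⟩
    exact ⟨_, ⟨a, rfl⟩, rfl⟩
  · rintro ⟨_, ⟨a, rfl⟩, rfl⟩
    exact ⟨a, rfl⟩

theorem mem_W_iff {x : PGL(4, k⸨X⸩)} :
    x ∈ W k ↔ ∃ g ∈ GLO k, Matrix.ProjGenLinGroup.mk g = x := by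
  constructor
  · rintro ⟨a, rfl⟩
    exact ⟨_, ⟨a, rfl⟩, rfl⟩
  · rintro ⟨_, ⟨a, rfl⟩, rfl⟩
    exact ⟨a, rfl⟩

/-! ### Diagonal matrices of powers of the uniformizer -/

theorem single_mul_single_neg (n : ℤ) :
    (HahnSeries.single n 1 : k⸨X⸩) * HahnSeries.single (-n) 1 = 1 := by
  rw [HahnSeries.single_mul_single]
  simp

/-- The diagonal matrix with entries `π ^ ν j`. -/
def diagX (ν : Fin 4 → ℤ) : GL (Fin 4) k⸨X⸩ where
  val := Matrix.diagonal fun j => HahnSeries.single (ν j) 1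
  inv := Matrix.diagonal fun j => HahnSeries.single (-ν j) 1
  val_inv := by
    rw [Matrix.diagonal_mul_diagonal]
    simp only [single_mul_single_neg, Matrix.diagonal_one]
  inv_val := by
    rw [Matrix.diagonal_mul_diagonal]
    simp only [mul_comm (HahnSeries.single (-_) (1 : k)), single_mul_single_neg,
      Matrix.diagonal_one]

theorem diagX_add (ν μ : Fin 4 → ℤ) : (diagX (ν + μ) : GL (Fin 4) k⸨X⸩) = diagX ν * diagX μ := by
  apply Units.ext
  rw [Units.val_mul]
  change Matrix.diagonal _ = Matrix.diagonal _ * Matrix.diagonal _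
  rw [Matrix.diagonal_mul_diagonal]
  simp only [HahnSeries.single_mul_single, Pi.add_apply, mul_one]

theorem diagX_zero : (diagX 0 : GL (Fin 4) k⸨X⸩) = 1 := by
  apply Units.ext
  change Matrix.diagonal _ = 1
  simp

theorem diagX_neg (ν : Fin 4 → ℤ) : (diagX (-ν) : GL (Fin 4) k⸨X⸩) = (diagX ν)⁻¹ := by
  rw [eq_inv_iff_mul_eq_one, ← diagX_add, neg_add_cancel, diagX_zero]

theorem diagX_const (n : ℤ) : ∃ u : (k⸨X⸩)ˣ, (diagX (fun _ => n) : GL (Fin 4) k⸨X⸩) =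
    Matrix.GeneralLinearGroup.scalar (Fin 4) u :=
  ⟨⟨HahnSeries.single n 1, HahnSeries.single (-n) 1, single_mul_single_neg n, by
    rw [mul_comm, single_mul_single_neg]⟩, Units.ext (by
      change Matrix.diagonal _ = Matrix.scalar _ _
      simp [Matrix.scalar_apply])⟩

theorem diagX_const_mul (n : ℤ) (g : GL (Fin 4) k⸨X⸩) :
    diagX (fun _ => n) * g = g * diagX fun _ => n := by
  obtain ⟨u, hu⟩ := diagX_const (k := k) n
  rw [hu, Matrix.GeneralLinearGroup.scalar_commute]

theorem mk_diagX_const (n : ℤ) :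
    Matrix.ProjGenLinGroup.mk (diagX (fun _ => n) : GL (Fin 4) k⸨X⸩) = 1 := by
  obtain ⟨u, hu⟩ := diagX_const (k := k) n
  rw [hu, Matrix.ProjGenLinGroup.mk_scalar]

theorem diagX_mul_apply (ν : Fin 4 → ℤ) (M : Matrix (Fin 4) (Fin 4) k⸨X⸩) (i j : Fin 4) :
    ((diagX ν).val * M : Matrix (Fin 4) (Fin 4) k⸨X⸩) i j = HahnSeries.single (ν i) 1 * M i j :=
  Matrix.diagonal_mul _ _ _ _

theorem mul_diagX_apply (ν : Fin 4 → ℤ) (M : Matrix (Fin 4) (Fin 4) k⸨X⸩) (i j : Fin 4) :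
    (M * (diagX ν).val : Matrix (Fin 4) (Fin 4) k⸨X⸩) i j = M i j * HahnSeries.single (ν j) 1 :=
  Matrix.mul_diagonal _ _ _ _

theorem diagX_mem_matrix {ν : Fin 4 → ℤ} (h : ∀ j, 0 ≤ ν j) :
    (diagX ν).val ∈ (intRing k).matrix := by
  intro i j
  change Matrix.diagonal _ i j ∈ intRing k
  by_cases hij : i = j
  · subst hij
    rw [Matrix.diagonal_apply_eq]
    exact single_mem_intRing (h i) 1
  · rw [Matrix.diagonal_apply_ne _ hij]
    exact (intRing k).zero_mem

/-- Every nonzero element is a power of the uniformizer times a unit of the valuation ring. -/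
theorem exists_eq_single_mul {x : k⸨X⸩} (hx : x ≠ 0) : ∃ y : k⸨X⸩,
    x = HahnSeries.single x.order 1 * y ∧ y ∈ intRing k ∧ y⁻¹ ∈ intRing k := by
  have hs : (HahnSeries.single x.order 1 : k⸨X⸩) ≠ 0 := HahnSeries.single_ne_zero one_ne_zero
  have hs' : (HahnSeries.single (-x.order) 1 : k⸨X⸩) ≠ 0 := HahnSeries.single_ne_zero one_ne_zero
  set y := HahnSeries.single (-x.order) 1 * x with hy
  have hy0 : y ≠ 0 := mul_ne_zero hs' hx
  have ho : y.order = 0 := by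
    rw [hy, HahnSeries.order_mul hs' hx, HahnSeries.order_single one_ne_zero, neg_add_cancel]
  refine ⟨y, ?_, mem_intRing_of_order_nonneg ho.ge, mem_intRing_of_order_nonneg ?_⟩
  · rw [hy, ← mul_assoc, single_mul_single_neg, one_mul]
  · have h1 := HahnSeries.order_mul hy0 (inv_ne_zero hy0)
    rw [mul_inv_cancel₀ hy0, HahnSeries.order_one, ho, zero_add] at h1
    exact h1.le

theorem diagonal_mem_GLO {g : GL (Fin 4) k⸨X⸩} {y : Fin 4 → k⸨X⸩}
    (hg : g.val = Matrix.diagonal y) (h : ∀ j, y j ∈ intRing k) (h' : ∀ j, (y j)⁻¹ ∈ intRing k) :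
    g ∈ GLO k := by
  have hy : ∀ j, y j ≠ 0 := by
    intro j hj
    apply Matrix.GeneralLinearGroup.det_ne_zero g
    rw [hg, Matrix.det_diagonal]
    exact Finset.prod_eq_zero (Finset.mem_univ j) hj
  have hinv : g⁻¹.val = Matrix.diagonal fun j => (y j)⁻¹ := by
    have : g.val * (Matrix.diagonal fun j => (y j)⁻¹) = 1 := by
      rw [hg, Matrix.diagonal_mul_diagonal]
      simp only [mul_inv_cancel₀ (hy _), Matrix.diagonal_one]
    calc g⁻¹.val = g⁻¹.val * (g.val * (Matrix.diagonal fun j => (y j)⁻¹)) := by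
          rw [this, mul_one]
      _ = _ := by rw [← mul_assoc, ← Units.val_mul, inv_mul_cancel, Units.val_one, one_mul]
  rw [mem_GLO_iff, hg, hinv]
  constructor <;> refine (Matrix.diagonal_mem_matrix_iff (intRing k).zero_mem).mpr ?_
  · exact h
  · exact h'

/-! ### Vertices -/

theorem smul_vertexOf (γ g : GL (Fin 4) k⸨X⸩) :
    Matrix.ProjGenLinGroup.mk γ • vertexOf g = vertexOf (γ * g) := by
  rw [vertexOf, vertexOf, map_mul]
  rfl

theorem exists_vertexOf_eq (x : Vertex k) : ∃ g, vertexOf g = x := by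
  obtain ⟨p, rfl⟩ := QuotientGroup.mk_surjective x
  obtain ⟨g, rfl⟩ := Matrix.ProjGenLinGroup.mk_surjective p
  exact ⟨g, rfl⟩

theorem vertexOf_mul_of_mem {g a : GL (Fin 4) k⸨X⸩} (ha : a ∈ GLO k) :
    vertexOf (g * a) = vertexOf g := by
  rw [vertexOf, vertexOf, QuotientGroup.eq, mem_W_iff]
  refine ⟨a⁻¹, inv_mem ha, ?_⟩
  simp only [map_mul, map_inv, mul_inv_rev, mul_assoc, inv_mul_cancel, mul_one]

theorem vertexOf_diagX_const_mul (n : ℤ) (g : GL (Fin 4) k⸨X⸩) :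
    vertexOf (diagX (fun _ => n) * g : GL (Fin 4) k⸨X⸩) = vertexOf g := by
  rw [vertexOf, map_mul, mk_diagX_const, one_mul, vertexOf]

/-- The scalar coming from the projective group is split into a power of the uniformizer and a unit,
and the unit is absorbed in `GLO`. -/
theorem vertexOf_eq_iff {g h : GL (Fin 4) k⸨X⸩} : vertexOf g = vertexOf h ↔
    ∃ n : ℤ, ∃ a ∈ GLO k, h = diagX (fun _ => n) * g * a := by
  constructor
  · intro hgh
    rw [vertexOf, vertexOf, QuotientGroup.eq, mem_W_iff] at hgh
    obtain ⟨a, ha, hgh⟩ := hgh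
    rw [eq_inv_mul_iff_mul_eq, ← map_mul, Matrix.ProjGenLinGroup.mk_eq_mk_iff] at hgh
    obtain ⟨u, hu⟩ := hgh
    obtain ⟨y, hy, hy1, hy2⟩ := exists_eq_single_mul u.ne_zero
    have hs : Matrix.GeneralLinearGroup.scalar (Fin 4) u =
        diagX (fun _ => u.val.order) *
          ((diagX fun _ => u.val.order)⁻¹ * Matrix.GeneralLinearGroup.scalar (Fin 4) u) := by
      rw [mul_inv_cancel_left]
    have hb : (diagX fun _ => u.val.order)⁻¹ * Matrix.GeneralLinearGroup.scalar (Fin 4) u ∈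
        GLO k := by
      refine diagonal_mem_GLO (y := fun _ => y) ?_ (fun _ => hy1) (fun _ => hy2)
      rw [← diagX_neg]
      apply Matrix.ext
      intro i j
      rw [Units.val_mul, diagX_mul_apply, Matrix.GeneralLinearGroup.coe_scalar,
        Matrix.scalar_apply]
      by_cases hij : i = j
      · subst hij
        rw [Matrix.diagonal_apply_eq, Matrix.diagonal_apply_eq]
        nth_rewrite 2 [hy]
        rw [← mul_assoc, Pi.neg_apply, mul_comm (HahnSeries.single _ _), single_mul_single_neg,
          one_mul]
      · rw [Matrix.diagonal_apply_ne _ hij, Matrix.diagonal_apply_ne _ hij, mul_zero]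
    refine ⟨u.val.order, a * _, mul_mem ha hb, ?_⟩
    rw [← hu, hs, ← mul_assoc, ← diagX_const_mul, mul_assoc, mul_assoc, mul_assoc]
    congr 3
    rw [mul_inv_cancel_left]
  · rintro ⟨n, a, ha, rfl⟩
    rw [vertexOf_mul_of_mem ha, vertexOf_diagX_const_mul]

theorem toQ_eq_iff {g h : GL (Fin 4) k⸨X⸩} : toQ (vertexOf g) = toQ (vertexOf h) ↔
    ∃ n : ℤ, ∃ γ ∈ GLP k, ∃ a ∈ GLO k, h = diagX (fun _ => n) * γ * g * a := by
  rw [toQ, toQ, eq_comm, Quotient.eq'', MulAction.orbitRel_apply, MulAction.mem_orbit_iff]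
  constructor
  · rintro ⟨⟨x, hx⟩, hxg⟩
    obtain ⟨γ, hγ, rfl⟩ := mem_Gam_iff.mp hx
    change Matrix.ProjGenLinGroup.mk γ • vertexOf g = vertexOf h at hxg
    rw [smul_vertexOf, vertexOf_eq_iff] at hxg
    obtain ⟨n, a, ha, rfl⟩ := hxg
    exact ⟨n, γ, hγ, a, ha, by rw [mul_assoc _ γ]⟩
  · rintro ⟨n, γ, hγ, a, ha, rfl⟩
    refine ⟨⟨_, mem_Gam_iff.mpr ⟨γ, hγ, rfl⟩⟩, ?_⟩
    change Matrix.ProjGenLinGroup.mk γ • vertexOf g = _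
    rw [smul_vertexOf, vertexOf_mul_of_mem ha, mul_assoc, vertexOf_diagX_const_mul]

end Rings

end Building
end

noncomputable section

namespace Building

/-! ### Lattices and adjacency -/

section Lattices

variable {k : Type*} [Field k]

theorem smul_fun_apply (o : k⟦X⟧) (v : Fin 4 → k⸨X⸩) (i : Fin 4) :
    (o • v) i = algebraMap k⟦X⟧ k⸨X⸩ o * v i := by
  rw [Pi.smul_apply, Algebra.smul_def]

/-- The entries of `g⁻¹ v` are the coordinates of `v` in the basis of columns of `g`. -/
theorem mem_latticeOf {g : GL (Fin 4) k⸨X⸩} {v : Fin 4 → k⸨X⸩} :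
    v ∈ latticeOf g ↔ ∀ i, (g⁻¹.val.mulVec v) i ∈ intRing k := by
  constructor
  · intro hv
    induction hv using Submodule.span_induction with
    | mem v hv =>
      obtain ⟨j, rfl⟩ := hv
      intro i
      have h : (g⁻¹.val * g.val) i j ∈ intRing k := by
        rw [← Units.val_mul, inv_mul_cancel, Units.val_one, Matrix.one_apply]
        split_ifs
        · exact (intRing k).one_mem
        · exact (intRing k).zero_mem
      exact h
    | zero => simp [(intRing k).zero_mem]
    | add v w _ _ hv hw =>
      intro i
      rw [Matrix.mulVec_add]
      exact (intRing k).add_mem (hv i) (hw i)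
    | smul o v _ hv =>
      intro i
      have h : g⁻¹.val.mulVec (o • v) = o • g⁻¹.val.mulVec v := Matrix.mulVec_smul _ _ _
      rw [h, smul_fun_apply]
      exact (intRing k).mul_mem ⟨o, rfl⟩ (hv i)
  · intro h
    choose o ho using h
    have hv : v = ∑ j, o j • (fun i => g.val i j : Fin 4 → k⸨X⸩) := by
      have h1 : g.val.mulVec (g⁻¹.val.mulVec v) = v := by
        rw [Matrix.mulVec_mulVec, ← Units.val_mul, mul_inv_cancel, Units.val_one,
          Matrix.one_mulVec]
      rw [← h1]
      ext1 i
      rw [Finset.sum_apply, Matrix.mulVec, dotProduct]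
      refine Finset.sum_congr rfl fun j _ => ?_
      rw [smul_fun_apply, ho, mul_comm]
    rw [hv]
    exact Submodule.sum_mem _ fun j _ =>
      Submodule.smul_mem _ _ (Submodule.subset_span ⟨j, rfl⟩)

theorem latticeOf_le_iff {g h : GL (Fin 4) k⸨X⸩} :
    latticeOf h ≤ latticeOf g ↔ (g⁻¹ * h).val ∈ (intRing k).matrix := by
  constructor
  · intro hle i j
    have hj : (fun i => h.val i j) ∈ latticeOf h := Submodule.subset_span ⟨j, rfl⟩
    exact mem_latticeOf.mp (hle hj) i
  · intro hM
    rw [latticeOf, Submodule.span_le]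
    rintro _ ⟨j, rfl⟩
    exact mem_latticeOf.mpr fun i => hM i j

theorem X_smul_latticeOf (g : GL (Fin 4) k⸨X⸩) :
    (PowerSeries.X : k⟦X⟧) • latticeOf g = latticeOf (diagX (fun _ => 1) * g) := by
  have hX : algebraMap k⟦X⟧ k⸨X⸩ PowerSeries.X = HahnSeries.single 1 1 :=
    PowerSeries.coe_X (R := k)
  apply le_antisymm
  · rintro _ ⟨v, hv, rfl⟩
    rw [mem_latticeOf]
    intro i
    have h := mem_latticeOf.mp hv i
    convert h using 1
    change ((diagX (fun _ => 1) * g)⁻¹.val.mulVec ((PowerSeries.X : k⟦X⟧) • v)) i = _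
    rw [diagX_const_mul, mul_inv_rev, ← diagX_neg, Units.val_mul, ← Matrix.mulVec_mulVec,
      Matrix.mulVec_smul]
    change (Matrix.diagonal _).mulVec _ i = _
    rw [Matrix.mulVec_diagonal, smul_fun_apply, hX, ← mul_assoc, mul_comm (HahnSeries.single _ _)]
    rw [Pi.neg_apply, single_mul_single_neg, one_mul]
  · rw [latticeOf, Submodule.span_le]
    rintro _ ⟨j, rfl⟩
    refine ⟨fun i => g.val i j, Submodule.subset_span ⟨j, rfl⟩, ?_⟩
    ext1 i
    change ((PowerSeries.X : k⟦X⟧) • fun i => g.val i j) i = _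
    rw [smul_fun_apply, hX]
    exact (diagX_mul_apply (fun _ => 1) g.val i j).symm

/-- The matrix `M` describes a lattice strictly between `O⁴` and `π O⁴`. -/
structure IsStep (M : GL (Fin 4) k⸨X⸩) : Prop where
  mem : M.val ∈ (intRing k).matrix
  inv_mem : (diagX (fun _ => 1) * M⁻¹).val ∈ (intRing k).matrix
  inv_notMem : M⁻¹.val ∉ (intRing k).matrix
  notMem : (diagX (fun _ => -1) * M).val ∉ (intRing k).matrix

theorem diagX_const_neg (n : ℤ) :
    (diagX (fun _ => -n) : GL (Fin 4) k⸨X⸩) = (diagX fun _ => n)⁻¹ :=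
  diagX_neg fun _ => n

theorem IsStep.mul_left {M a : GL (Fin 4) k⸨X⸩} (hM : IsStep M) (ha : a ∈ GLO k) :
    IsStep (a * M) := by
  obtain ⟨h1, h2⟩ := mem_GLO_iff.mp ha
  refine ⟨?_, ?_, fun h => hM.inv_notMem ?_, fun h => hM.notMem ?_⟩
  · rw [Units.val_mul]
    exact Subring.mul_mem _ h1 hM.mem
  · rw [mul_inv_rev, ← mul_assoc, Units.val_mul]
    exact Subring.mul_mem _ hM.inv_mem h2
  · have := Subring.mul_mem _ h h1
    rwa [← Units.val_mul, mul_inv_rev, inv_mul_cancel_right] at this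
  · have := Subring.mul_mem _ h2 h
    rwa [← Units.val_mul, ← mul_assoc, ← diagX_const_mul, mul_assoc, inv_mul_cancel_left] at this

/-- From `π L ⊊ L' ⊊ L` follows `π L' ⊊ π L ⊊ L'`, so adjacency is symmetric up to a homothety. -/
theorem IsStep.symm {M : GL (Fin 4) k⸨X⸩} (hM : IsStep M) : IsStep (diagX (fun _ => 1) * M⁻¹) := by
  refine ⟨hM.inv_mem, ?_, ?_, ?_⟩
  · rw [mul_inv_rev, inv_inv, diagX_const_mul, inv_mul_cancel_right]
    exact hM.mem
  · rw [mul_inv_rev, inv_inv, ← diagX_const_neg, ← diagX_const_mul]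
    exact hM.notMem
  · rw [diagX_const_neg, inv_mul_cancel_left]
    exact hM.inv_notMem

theorem isStep_iff {g h : GL (Fin 4) k⸨X⸩} : IsStep (g⁻¹ * h) ↔
    (PowerSeries.X : k⟦X⟧) • latticeOf g < latticeOf h ∧ latticeOf h < latticeOf g := by
  rw [X_smul_latticeOf, lt_iff_le_not_ge, lt_iff_le_not_ge, latticeOf_le_iff, latticeOf_le_iff,
    latticeOf_le_iff, latticeOf_le_iff]
  have e1 : h⁻¹ * (diagX (fun _ => 1) * g) = diagX (fun _ => 1) * (g⁻¹ * h)⁻¹ := by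
    rw [mul_inv_rev, inv_inv, ← mul_assoc, ← diagX_const_mul, mul_assoc]
  have e2 : (diagX (fun _ => 1) * g)⁻¹ * h = diagX (fun _ => -1) * (g⁻¹ * h) := by
    rw [diagX_const_mul, mul_inv_rev, mul_assoc, ← diagX_const_neg]
  have e3 : h⁻¹ * g = (g⁻¹ * h)⁻¹ := by rw [mul_inv_rev, inv_inv]
  rw [e1, e2, e3]
  exact ⟨fun H => ⟨⟨H.inv_mem, H.notMem⟩, H.mem, H.inv_notMem⟩,
    fun ⟨⟨h1, h2⟩, h3, h4⟩ => ⟨h3, h1, h4, h2⟩⟩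

/-- Any representative of the first vertex may be used: changing it alters the second lattice by a
homothety and the step matrix by a factor in `GLO`. -/
theorem adj_vertexOf_iff {g : GL (Fin 4) k⸨X⸩} {y : Vertex k} :
    Adj (vertexOf g) y ↔ ∃ M, IsStep M ∧ vertexOf (g * M) = y := by
  constructor
  · rintro ⟨g', h, hg, rfl, hlt⟩
    rw [← isStep_iff] at hlt
    obtain ⟨n, a, ha, rfl⟩ := vertexOf_eq_iff.mp hg
    refine ⟨a⁻¹ * (g'⁻¹ * h), hlt.mul_left (inv_mem ha), ?_⟩
    rw [mul_assoc, mul_inv_cancel_left, mul_assoc, mul_inv_cancel_left, vertexOf_diagX_const_mul]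
  · rintro ⟨M, hM, rfl⟩
    refine ⟨g, g * M, rfl, rfl, ?_⟩
    rw [← isStep_iff, inv_mul_cancel_left]
    exact hM

theorem Adj.smul {x y : Vertex k} (h : Adj x y) (γ : PGL(4, k⸨X⸩)) : Adj (γ • x) (γ • y) := by
  obtain ⟨g, rfl⟩ := exists_vertexOf_eq x
  obtain ⟨γ, rfl⟩ := Matrix.ProjGenLinGroup.mk_surjective γ
  obtain ⟨M, hM, rfl⟩ := adj_vertexOf_iff.mp h
  rw [smul_vertexOf, smul_vertexOf, ← mul_assoc]
  exact adj_vertexOf_iff.mpr ⟨M, hM, rfl⟩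

theorem Adj.symm {x y : Vertex k} (h : Adj x y) : Adj y x := by
  obtain ⟨g, rfl⟩ := exists_vertexOf_eq x
  obtain ⟨M, hM, rfl⟩ := adj_vertexOf_iff.mp h
  refine adj_vertexOf_iff.mpr ⟨_, hM.symm, ?_⟩
  rw [mul_assoc, diagX_const_mul, mul_inv_cancel_left, ← diagX_const_mul,
    vertexOf_diagX_const_mul]

/-! ### Colors -/

theorem color_vertexOf (g : GL (Fin 4) k⸨X⸩) : color (vertexOf g) = ((g.val.det.order : ℤ) : ZMod 4) :=
  rfl

theorem color_smul (γ : PGL(4, k⸨X⸩)) (x : Vertex k) :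
    color (γ • x) = Multiplicative.toAdd (ordDet k γ) + color x := by
  obtain ⟨p, rfl⟩ := QuotientGroup.mk_surjective x
  change Multiplicative.toAdd (ordDet k (γ * p)) = _
  rw [map_mul, toAdd_mul]
  rfl

theorem color_vertexOf_mul (g h : GL (Fin 4) k⸨X⸩) :
    color (vertexOf (g * h)) = color (vertexOf g) + color (vertexOf h) := by
  rw [color_vertexOf, color_vertexOf, color_vertexOf, Units.val_mul, Matrix.det_mul,
    HahnSeries.order_mul (Matrix.GeneralLinearGroup.det_ne_zero g)
      (Matrix.GeneralLinearGroup.det_ne_zero h), Int.cast_add]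

theorem det_diagX (ν : Fin 4 → ℤ) :
    (diagX ν : GL (Fin 4) k⸨X⸩).val.det = HahnSeries.single (∑ j, ν j) 1 := by
  change (Matrix.diagonal _).det = _
  rw [Matrix.det_diagonal]
  simp [Fin.prod_univ_four, Fin.sum_univ_four, HahnSeries.single_mul_single]

theorem order_det_diagX (ν : Fin 4 → ℤ) :
    (diagX ν : GL (Fin 4) k⸨X⸩).val.det.order = ∑ j, ν j := by
  rw [det_diagX, HahnSeries.order_single one_ne_zero]

theorem det_mem_of_mem_matrix {R : Type*} [CommRing R] {S : Subring R}
    {M : Matrix (Fin 4) (Fin 4) R} (hM : M ∈ S.matrix) : M.det ∈ S := by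
  rw [Matrix.det_apply']
  exact S.sum_mem fun σ _ => S.mul_mem (by simp) (S.prod_mem fun i _ => hM _ _)

theorem order_det_add_order_det_inv (g : GL (Fin 4) k⸨X⸩) :
    g.val.det.order + g⁻¹.val.det.order = 0 := by
  rw [← HahnSeries.order_mul (Matrix.GeneralLinearGroup.det_ne_zero g)
      (Matrix.GeneralLinearGroup.det_ne_zero g⁻¹), ← Matrix.det_mul, ← Units.val_mul,
    mul_inv_cancel, Units.val_one, Matrix.det_one, HahnSeries.order_one]

theorem order_det_of_mem_GLO {a : GL (Fin 4) k⸨X⸩} (ha : a ∈ GLO k) : a.val.det.order = 0 := by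
  obtain ⟨h1, h2⟩ := mem_GLO_iff.mp ha
  have e1 := order_nonneg_of_mem_intRing (det_mem_of_mem_matrix h1)
  have e2 := order_nonneg_of_mem_intRing (det_mem_of_mem_matrix h2)
  have := order_det_add_order_det_inv a
  omega

/-- The determinants of `a` and `a⁻¹` are polynomials in `t`, of order at most 0 at infinity, and
their orders add up to 0. -/
theorem order_det_of_mem_GLP {a : GL (Fin 4) k⸨X⸩} (ha : a ∈ GLP k) : a.val.det.order = 0 := by
  obtain ⟨h1, h2⟩ := mem_GLP_iff.mp ha
  have e1 := order_nonpos_of_mem_polyRing (det_mem_of_mem_matrix h1)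
  have e2 := order_nonpos_of_mem_polyRing (det_mem_of_mem_matrix h2)
  have := order_det_add_order_det_inv a
  omega

theorem order_det_mul (g h : GL (Fin 4) k⸨X⸩) :
    (g * h).val.det.order = g.val.det.order + h.val.det.order := by
  rw [Units.val_mul, Matrix.det_mul,
    HahnSeries.order_mul (Matrix.GeneralLinearGroup.det_ne_zero g)
      (Matrix.GeneralLinearGroup.det_ne_zero h)]

end Lattices

end Building
end

noncomputable section

namespace Building

/-! ### Schubert cells in `k⁴` -/

section Cells

variable {k : Type*} [Field k]

/-- The coordinates of the Schubert cell of subspaces of `k⁴` with set of pivots `Jᶜ`. -/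
abbrev Cell (k : Type*) (J : Finset (Fin 4)) : Type _ :=
  {p : Fin 4 × Fin 4 // p.1 ∈ J ∧ p.2 ∉ J ∧ p.2 < p.1} → k

/-- The strictly lower triangular matrix attached to a point of a Schubert cell. -/
def cellMat {J : Finset (Fin 4)} (c : Cell k J) : Matrix (Fin 4) (Fin 4) k :=
  fun a j => if h : a ∈ J ∧ j ∉ J ∧ j < a then c ⟨(a, j), h⟩ else 0

/-- The vectors of the subspace attached to a point of a Schubert cell: the coordinates in `J`
are linear combinations of the preceding coordinates that are not in `J`. -/
def InCell {J : Finset (Fin 4)} (c : Cell k J) (v : Fin 4 → k) : Prop :=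
  ∀ a ∈ J, v a = ∑ i, cellMat c a i * v i

theorem cellMat_eq_zero {J : Finset (Fin 4)} (c : Cell k J) {a j : Fin 4}
    (h : ¬ (a ∈ J ∧ j ∉ J ∧ j < a)) : cellMat c a j = 0 := dif_neg h

/-- Every subspace of `k⁴` belongs to a Schubert cell. -/
theorem exists_inCell (V : Submodule k (Fin 4 → k)) :
    ∃ (J : Finset (Fin 4)) (c : Cell k J), ∀ v, v ∈ V ↔ InCell c v := by
  classical
  -- The complement of `J` is the set of positions where some vector of `V` has its first nonzero
  -- coordinate.
  let J : Finset (Fin 4) := Finset.univ.filter fun a => ∀ v ∈ V, (∀ i < a, v i = 0) → v a = 0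
  have hJ : ∀ a, a ∈ J ↔ ∀ v ∈ V, (∀ i < a, v i = 0) → v a = 0 := by
    intro a
    simp [J]
  have hzero : ∀ v ∈ V, (∀ i, i ∉ J → v i = 0) → v = 0 := by
    intro v hv h
    ext a
    induction a using WellFoundedLT.induction with
    | ind a ih =>
      by_cases ha : a ∈ J
      · exact (hJ a).mp ha v hv ih
      · exact h a ha
  -- The pivot coordinates of a vector of `V` can be prescribed, one after the other from the left.
  have hex : ∀ (w : Fin 4 → k) (m : ℕ), ∃ v ∈ V, ∀ i : Fin 4, i ∉ J → (i : ℕ) < m → v i = w i := by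
    intro w m
    induction m with
    | zero => exact ⟨0, V.zero_mem, fun i _ h => absurd h (by omega)⟩
    | succ m ih =>
      obtain ⟨v, hv, hvw⟩ := ih
      by_cases hm : ∃ i : Fin 4, (i : ℕ) = m ∧ i ∉ J
      · obtain ⟨a, rfl, ha⟩ := hm
        have ha' := ha
        rw [hJ] at ha'
        push Not at ha'
        obtain ⟨b, hb, hb0, hba⟩ := ha'
        refine ⟨v + ((w a - v a) / b a) • b, V.add_mem hv (V.smul_mem _ hb), ?_⟩
        intro i hi him
        rw [Pi.add_apply, Pi.smul_apply, smul_eq_mul]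
        rcases (Nat.lt_succ_iff_lt_or_eq.mp him) with h | h
        · rw [hb0 i h, mul_zero, add_zero, hvw i hi h]
        · rw [Fin.ext h, div_mul_cancel₀ _ hba, add_sub_cancel]
      · refine ⟨v, hv, fun i hi him => hvw i hi ?_⟩
        rcases (Nat.lt_succ_iff_lt_or_eq.mp him) with h | h
        · exact h
        · exact absurd ⟨i, h, hi⟩ hm
  choose b hbV hb using fun j : Fin 4 => hex (Pi.single j 1) 4
  replace hb : ∀ j i : Fin 4, i ∉ J → b j i = Pi.single (M := fun _ => k) j 1 i := fun j i hi =>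
    hb j i hi i.isLt
  have hbJ : ∀ j ∈ J, b j = 0 := by
    intro j hj
    refine hzero _ (hbV j) fun i hi => ?_
    rw [hb j i hi, Pi.single_eq_of_ne]
    rintro rfl
    exact hi hj
  have hblt : ∀ j a, a < j → b j a = 0 := by
    intro j a
    induction a using WellFoundedLT.induction with
    | ind a ih =>
      intro haj
      by_cases ha : a ∈ J
      · exact (hJ a).mp ha _ (hbV j) fun i hi => ih i hi (hi.trans haj)
      · rw [hb j a ha, Pi.single_eq_of_ne haj.ne]
  -- The vectors `b j` form the reduced echelon basis of `V`; their entries in the rows of `J` are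
  -- the cell coordinates.
  let c : Cell k J := fun p => b p.1.2 p.1.1
  have hc : ∀ a ∈ J, ∀ j, cellMat c a j = b j a := by
    intro a ha j
    by_cases hj : j ∈ J
    · rw [cellMat_eq_zero c (by tauto), hbJ j hj, Pi.zero_apply]
    · rcases lt_trichotomy j a with h | h | h
      · exact dif_pos ⟨ha, hj, h⟩
      · exact absurd (h ▸ ha) hj
      · rw [cellMat_eq_zero c (fun h' => (h'.2.2.trans h).false), hblt j a h]
  have hsum : ∀ (v : Fin 4 → k) (i : Fin 4), i ∉ J → (∑ j, v j • b j) i = v i := by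
    intro v i hi
    rw [Finset.sum_apply, Finset.sum_eq_single i]
    · rw [Pi.smul_apply, hb i i hi, Pi.single_eq_same, smul_eq_mul, mul_one]
    · intro j _ hj
      rw [Pi.smul_apply, hb j i hi, Pi.single_eq_of_ne hj.symm, smul_zero]
    · simp
  have hmem : ∀ v : Fin 4 → k, ∑ j, v j • b j ∈ V := fun v =>
    V.sum_mem fun j _ => V.smul_mem _ (hbV j)
  refine ⟨J, c, fun v => ⟨fun hv a ha => ?_, fun hv => ?_⟩⟩
  · have h0 := hzero (v - ∑ j, v j • b j) (V.sub_mem hv (hmem v)) fun i hi => by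
      rw [Pi.sub_apply, hsum v i hi, sub_self]
    have h1 := congrFun (sub_eq_zero.mp h0) a
    rw [h1, Finset.sum_apply]
    refine Finset.sum_congr rfl fun j _ => ?_
    rw [Pi.smul_apply, hc a ha, smul_eq_mul, mul_comm]
  · convert hmem v using 1
    ext a
    by_cases ha : a ∈ J
    · rw [hv a ha, Finset.sum_apply]
      refine Finset.sum_congr rfl fun j _ => ?_
      rw [Pi.smul_apply, hc a ha, smul_eq_mul, mul_comm]
    · exact (hsum v a ha).symm

/-- The basis vectors of the subspace attached to a point of a Schubert cell. -/
def cellVec {J : Finset (Fin 4)} (c : Cell k J) (j : Fin 4) : Fin 4 → k :=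
  fun i => if i = j then 1 else cellMat c i j

theorem inCell_cellVec {J : Finset (Fin 4)} (c : Cell k J) {j : Fin 4} (hj : j ∉ J) :
    InCell c (cellVec c j) := by
  intro a ha
  have haj : a ≠ j := fun h => hj (h ▸ ha)
  rw [Finset.sum_eq_single j]
  · simp [cellVec, haj]
  · intro i _ hij
    by_cases hi : i ∈ J
    · rw [cellMat_eq_zero c (by tauto), zero_mul]
    · rw [cellVec, if_neg hij, cellMat_eq_zero c (a := i) (by tauto), mul_zero]
  · simp

/-- A subspace determines its Schubert cell and its point. -/
theorem cell_unique {J J' : Finset (Fin 4)} {c : Cell k J} {c' : Cell k J'}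
    (h : ∀ v, InCell c v ↔ InCell c' v) : (⟨J, c⟩ : Σ J, Cell k J) = ⟨J', c'⟩ := by
  have key : ∀ (J : Finset (Fin 4)) (c : Cell k J) (a : Fin 4),
      a ∈ J ↔ ∀ v, InCell c v → (∀ i < a, v i = 0) → v a = 0 := by
    intro J c a
    constructor
    · intro ha v hv h0
      rw [hv a ha]
      refine Finset.sum_eq_zero fun i _ => ?_
      by_cases hi : i < a
      · rw [h0 i hi, mul_zero]
      · rw [cellMat_eq_zero c (by tauto), zero_mul]
    · intro H
      by_contra ha
      have := H _ (inCell_cellVec c ha) fun i hi => by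
        rw [cellVec, if_neg hi.ne, cellMat_eq_zero c (fun h => (h.2.2.trans hi).false)]
      simp [cellVec] at this
  have hJ : J = J' := by
    ext a
    rw [key J c, key J' c']
    simp only [h]
  subst hJ
  congr 1
  ext ⟨⟨a, j⟩, ha, hj, hlt⟩
  have h1 := (h _).mp (inCell_cellVec c hj) a ha
  have hc : ∀ c : Cell k J, cellMat c a j = c ⟨(a, j), ha, hj, hlt⟩ := fun c =>
    dif_pos ⟨ha, hj, hlt⟩
  rw [Finset.sum_eq_single j] at h1
  · rw [← hc c, ← hc c']
    have haj : a ≠ j := hlt.ne'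
    simpa [cellVec, haj] using h1
  · intro i _ hij
    by_cases hi : i ∈ J
    · rw [cellMat_eq_zero c' (by tauto), zero_mul]
    · rw [cellVec, if_neg hij, cellMat_eq_zero c (a := i) (by tauto), mul_zero]
  · simp

end Cells

theorem card_cell (k : Type*) [Fintype k] (J : Finset (Fin 4)) : Fintype.card (Cell k J) =
    Fintype.card k ^ (Finset.univ.filter fun p : Fin 4 × Fin 4 =>
      p.1 ∈ J ∧ p.2 ∉ J ∧ p.2 < p.1).card := by
  rw [Fintype.card_fun, Fintype.card_subtype]

end Building
end

noncomputable section

namespace Building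

/-! ### The neighbours of a vertex -/

section Neighbours

variable {k : Type*} [Field k]

theorem coeff_zero_mul {x y : k⸨X⸩} (hx : x ∈ intRing k) (hy : y ∈ intRing k) :
    (x * y).coeff 0 = x.coeff 0 * y.coeff 0 := by
  obtain ⟨p, rfl⟩ := hx
  obtain ⟨r, rfl⟩ := hy
  have h : ∀ p : k⟦X⟧, (algebraMap k⟦X⟧ k⸨X⸩ p).coeff 0 = PowerSeries.constantCoeff p := by
    intro p
    change HahnSeries.coeff (p : k⸨X⸩) 0 = _
    rw [PowerSeries.coeff_coe]
    simp
  rw [← map_mul, h, h, h, map_mul]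

theorem single_neg_one_mul_mem_iff {x : k⸨X⸩} (hx : x ∈ intRing k) :
    HahnSeries.single (-1) 1 * x ∈ intRing k ↔ x.coeff 0 = 0 := by
  rw [mem_intRing]
  have h : ∀ n, (HahnSeries.single (-1 : ℤ) (1 : k) * x).coeff n = x.coeff (n + 1) := by
    intro n
    have := HahnSeries.coeff_single_mul_add (r := (1 : k)) (x := x) (a := n + 1) (b := (-1 : ℤ))
    rwa [one_mul, add_neg_cancel_right] at this
  simp only [h]
  constructor
  · intro H
    simpa using H (-1) (by norm_num)
  · intro H n hn
    rcases (show n + 1 ≤ 0 by omega).lt_or_eq with h | h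
    · exact mem_intRing.mp hx _ h
    · rw [h, H]

/-- The reduction modulo the maximal ideal of a matrix with entries in `O`. -/
def redMat (M : Matrix (Fin 4) (Fin 4) k⸨X⸩) : Matrix (Fin 4) (Fin 4) k := M.map fun x => x.coeff 0

theorem redMat_mul {M N : Matrix (Fin 4) (Fin 4) k⸨X⸩} (hM : M ∈ (intRing k).matrix)
    (hN : N ∈ (intRing k).matrix) : redMat (M * N) = redMat M * redMat N := by
  ext i j
  simp only [redMat, Matrix.map_apply, Matrix.mul_apply, HahnSeries.coeff_sum]
  exact Finset.sum_congr rfl fun l _ => coeff_zero_mul (hM i l) (hN l j)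

/-- The matrix over `F` of a matrix over `k`. -/
def constMat (M : Matrix (Fin 4) (Fin 4) k) : Matrix (Fin 4) (Fin 4) k⸨X⸩ :=
  M.map fun x => HahnSeries.single 0 x

theorem constMat_mem (M : Matrix (Fin 4) (Fin 4) k) : constMat M ∈ (intRing k).matrix :=
  fun _ _ => single_mem_intRing le_rfl _

theorem redMat_constMat (M : Matrix (Fin 4) (Fin 4) k) : redMat (constMat M) = M := by
  ext i j
  simp [redMat, constMat]

theorem redMat_sub (M N : Matrix (Fin 4) (Fin 4) k⸨X⸩) : redMat (M - N) = redMat M - redMat N := by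
  ext i j
  simp [redMat]

/-- The block of a matrix with rows in `J` and columns outside of `J`. -/
def maskMat (J : Finset (Fin 4)) (N : Matrix (Fin 4) (Fin 4) k⸨X⸩) :
    Matrix (Fin 4) (Fin 4) k⸨X⸩ :=
  fun a j => if a ∈ J ∧ j ∉ J then N a j else 0

theorem maskMat_mul_self (J : Finset (Fin 4)) (N : Matrix (Fin 4) (Fin 4) k⸨X⸩) :
    maskMat J N * maskMat J N = 0 := by
  apply Matrix.ext
  intro a j
  rw [Matrix.mul_apply, Matrix.zero_apply]
  refine Finset.sum_eq_zero fun i _ => ?_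
  by_cases hi : i ∈ J
  · rw [maskMat, if_neg (by tauto), zero_mul]
  · rw [maskMat, maskMat, if_neg (by tauto : ¬ (i ∈ J ∧ j ∉ J)), mul_zero]

/-- The unipotent matrix with a given block. -/
def blockUnip (J : Finset (Fin 4)) (N : Matrix (Fin 4) (Fin 4) k⸨X⸩) : GL (Fin 4) k⸨X⸩ where
  val := 1 + maskMat J N
  inv := 1 - maskMat J N
  val_inv := by rw [mul_sub, mul_one, add_mul, maskMat_mul_self]; simp
  inv_val := by rw [mul_add, mul_one, sub_mul, maskMat_mul_self]; simp

theorem blockUnip_val_mem {S : Subring k⸨X⸩} {J : Finset (Fin 4)}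
    {N : Matrix (Fin 4) (Fin 4) k⸨X⸩} (hN : ∀ a ∈ J, ∀ j, j ∉ J → N a j ∈ S) :
    (blockUnip J N).val ∈ S.matrix ∧ (blockUnip J N)⁻¹.val ∈ S.matrix := by
  have h : maskMat J N ∈ S.matrix := by
    intro a j
    rw [maskMat]
    split_ifs with h
    · exact hN a h.1 j h.2
    · exact S.zero_mem
  exact ⟨Subring.add_mem _ (Subring.one_mem _) h, Subring.sub_mem _ (Subring.one_mem _) h⟩

/-- Conjugation multiplies the entry in place `(a, j)` by `π ^ (ν a - ν j)`. For dominant `ν` and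
entries below the diagonal the exponent is nonpositive, which makes constants polynomial in `t`. -/
theorem diagX_mul_blockUnip (ν : Fin 4 → ℤ) (J : Finset (Fin 4))
    (N : Matrix (Fin 4) (Fin 4) k⸨X⸩) : diagX ν * blockUnip J N =
      blockUnip J (fun a j => N a j * HahnSeries.single (ν a - ν j) 1) * diagX ν := by
  apply Units.ext
  rw [Units.val_mul, Units.val_mul]
  change _ * (1 + maskMat J N) = (1 + maskMat J _) * _
  rw [mul_add, add_mul, mul_one, one_mul]
  congr 1
  ext1 a j
  rw [diagX_mul_apply, mul_diagX_apply]
  simp only [maskMat]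
  split_ifs
  · rw [mul_assoc, HahnSeries.single_mul_single, sub_add_cancel, one_mul, mul_comm]
  · rw [mul_zero, zero_mul]

/-- The indicator vector of a set. -/
def indVec (J : Finset (Fin 4)) : Fin 4 → ℤ := fun j => if j ∈ J then 1 else 0

theorem sum_indVec (J : Finset (Fin 4)) : ∑ j, indVec J j = J.card := by
  simp [indVec]

/-- The unipotent matrix of a point of a Schubert cell. -/
def cellGL {J : Finset (Fin 4)} (c : Cell k J) : GL (Fin 4) k⸨X⸩ :=
  blockUnip J (constMat (cellMat c))

theorem maskMat_cellMat {J : Finset (Fin 4)} (c : Cell k J) :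
    maskMat J (constMat (cellMat c)) = constMat (cellMat c) := by
  ext1 a j
  rw [maskMat]
  split_ifs with h
  · rfl
  · rw [constMat, Matrix.map_apply, cellMat_eq_zero c (by tauto), HahnSeries.single_eq_zero]

theorem cellGL_mem {J : Finset (Fin 4)} (c : Cell k J) : cellGL c ∈ GLO k :=
  mem_GLO_iff.mpr (blockUnip_val_mem fun _ _ _ _ => single_mem_intRing le_rfl _)

/-- The matrix of the lattice attached to a point of a Schubert cell. -/
def stepMat {J : Finset (Fin 4)} (c : Cell k J) : GL (Fin 4) k⸨X⸩ := cellGL c * diagX (indVec J)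

theorem diagX_ind_isStep {J : Finset (Fin 4)} (h1 : J ≠ ∅) (h2 : J ≠ Finset.univ) :
    IsStep (diagX (indVec J) : GL (Fin 4) k⸨X⸩) := by
  have hneg : (HahnSeries.single (-1) 1 : k⸨X⸩) ∉ intRing k := by
    intro h
    have := mem_intRing.mp h (-1) (by norm_num)
    rw [HahnSeries.coeff_single_same] at this
    exact one_ne_zero this
  have hdiag : ∀ (ν : Fin 4 → ℤ) (j : Fin 4), ν j = -1 →
      (diagX ν : GL (Fin 4) k⸨X⸩).val ∉ (intRing k).matrix := by
    intro ν j hj h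
    have := h j j
    change Matrix.diagonal _ j j ∈ intRing k at this
    rw [Matrix.diagonal_apply_eq, hj] at this
    exact hneg this
  obtain ⟨i, hi⟩ := Finset.nonempty_iff_ne_empty.mpr h1
  obtain ⟨j, hj⟩ : ∃ j, j ∉ J := by
    by_contra! h
    exact h2 (Finset.eq_univ_of_forall h)
  refine ⟨diagX_mem_matrix fun j => ?_, ?_, ?_, ?_⟩
  · rw [indVec]
    split_ifs <;> norm_num
  · rw [← diagX_neg, ← diagX_add]
    refine diagX_mem_matrix fun j => ?_
    rw [Pi.add_apply, Pi.neg_apply, indVec]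
    split_ifs <;> norm_num
  · rw [← diagX_neg]
    exact hdiag _ i (by rw [Pi.neg_apply, indVec, if_pos hi])
  · rw [← diagX_add]
    exact hdiag _ j (by rw [Pi.add_apply, indVec, if_neg hj, add_zero])

theorem stepMat_isStep {J : Finset (Fin 4)} (h1 : J ≠ ∅) (h2 : J ≠ Finset.univ) (c : Cell k J) :
    IsStep (stepMat c) :=
  (diagX_ind_isStep h1 h2).mul_left (cellGL_mem c)

theorem stepMat_mem {J : Finset (Fin 4)} (c : Cell k J) : (stepMat c).val ∈ (intRing k).matrix := by
  rw [stepMat, Units.val_mul]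
  refine Subring.mul_mem _ (mem_GLO_iff.mp (cellGL_mem c)).1 (diagX_mem_matrix fun j => ?_)
  rw [indVec]
  split_ifs <;> norm_num

theorem redMat_stepMat {J : Finset (Fin 4)} (c : Cell k J) (i j : Fin 4) :
    redMat (stepMat c).val i j = if j ∈ J then 0 else cellVec c j i := by
  have h : (stepMat c).val i j =
      (1 + constMat (cellMat c)) i j * HahnSeries.single (indVec J j) 1 := by
    rw [stepMat, Units.val_mul, mul_diagX_apply, ← maskMat_cellMat]
    rfl
  have hi : (1 + constMat (cellMat c)) i j ∈ intRing k :=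
    (intRing k).matrix.add_mem (Subring.one_mem _) (constMat_mem _) i j
  rw [redMat, Matrix.map_apply, h]
  by_cases hj : j ∈ J
  · rw [if_pos hj, indVec, if_pos hj, coeff_zero_mul hi (single_mem_intRing zero_le_one _),
      HahnSeries.coeff_single_of_ne (by norm_num), mul_zero]
  · rw [if_neg hj, indVec, if_neg hj, coeff_zero_mul hi (single_mem_intRing le_rfl _),
      HahnSeries.coeff_single_same, mul_one, Matrix.add_apply, HahnSeries.coeff_add,
      Matrix.one_apply, constMat, Matrix.map_apply, HahnSeries.coeff_single_same, cellVec]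
    split_ifs with hij
    · subst hij
      rw [HahnSeries.coeff_one, if_pos rfl, cellMat_eq_zero c (by tauto), add_zero]
    · simp

theorem inCell_redMat_stepMat {J : Finset (Fin 4)} (c : Cell k J) (j : Fin 4) :
    InCell c fun i => redMat (stepMat c).val i j := by
  by_cases hj : j ∈ J
  · intro a _
    simp only [redMat_stepMat, if_pos hj, mul_zero, Finset.sum_const_zero]
  · simp only [redMat_stepMat, if_neg hj]
    exact inCell_cellVec c hj

theorem InCell.sum {J : Finset (Fin 4)} {c : Cell k J} {M : Matrix (Fin 4) (Fin 4) k}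
    (h : ∀ j, InCell c fun i => M i j) (u : Fin 4 → k) : InCell c (M.mulVec u) := by
  intro a ha
  simp only [Matrix.mulVec, dotProduct, Finset.mul_sum]
  rw [Finset.sum_comm]
  refine Finset.sum_congr rfl fun j _ => ?_
  rw [show M a j = ∑ i, cellMat c a i * M i j from h j a ha, Finset.sum_mul]
  exact Finset.sum_congr rfl fun i _ => mul_assoc _ _ _

/-- Modulo the uniformizer the columns of the step matrix in `J` vanish and the others are the
echelon basis, so a vector of the subspace is recovered from its own pivot coordinates. -/
theorem inCell_iff_mem_range {J : Finset (Fin 4)} {c : Cell k J} {v : Fin 4 → k} :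
    InCell c v ↔ ∃ u, (redMat (stepMat c).val).mulVec u = v := by
  constructor
  · intro hv
    refine ⟨v, ?_⟩
    ext a
    have e : ((redMat (stepMat c).val).mulVec v) a =
        ∑ j, (if a = j ∧ j ∉ J then v j else cellMat c a j * v j) := by
      rw [Matrix.mulVec, dotProduct]
      refine Finset.sum_congr rfl fun j _ => ?_
      rw [redMat_stepMat]
      by_cases hj : j ∈ J
      · rw [if_pos hj, if_neg (by tauto), cellMat_eq_zero c (by tauto)]
      · rw [if_neg hj, cellVec]
        by_cases haj : a = j
        · rw [if_pos haj, if_pos ⟨haj, hj⟩, one_mul]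
        · rw [if_neg haj, if_neg (by tauto)]
    rw [e]
    by_cases ha : a ∈ J
    · rw [hv a ha]
      refine Finset.sum_congr rfl fun j _ => if_neg ?_
      rintro ⟨rfl, h⟩
      exact h ha
    · rw [Finset.sum_eq_single a]
      · rw [if_pos ⟨rfl, ha⟩]
      · intro j _ hj
        rw [if_neg (by tauto), cellMat_eq_zero c (by tauto), zero_mul]
      · simp
  · rintro ⟨u, rfl⟩
    exact InCell.sum (inCell_redMat_stepMat c) u

/-- Every lattice between `O⁴` and `π O⁴` is attached to a point of a Schubert cell. -/
theorem IsStep.exists_stepMat {M : GL (Fin 4) k⸨X⸩} (hM : IsStep M) :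
    ∃ (J : Finset (Fin 4)) (c : Cell k J), J ≠ ∅ ∧ J ≠ Finset.univ ∧
      ∃ a ∈ GLO k, M = stepMat c * a := by
  obtain ⟨J, c, hV⟩ := exists_inCell (LinearMap.range (Matrix.mulVecLin (redMat M.val)))
  have hV' : ∀ v, InCell c v ↔ ∃ u, (redMat M.val).mulVec u = v := by
    intro v
    rw [← hV]
    exact LinearMap.mem_range
  have hcol : ∀ j, InCell c fun i => redMat M.val i j := by
    intro j
    rw [hV']
    refine ⟨Pi.single j 1, ?_⟩
    ext i
    simp
  have hQ := stepMat_mem c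
  obtain ⟨U, hU⟩ : ∃ U : Matrix (Fin 4) (Fin 4) k, redMat M.val * U = redMat (stepMat c).val := by
    choose u hu using fun j => (hV' _).mp (inCell_redMat_stepMat c j)
    refine ⟨fun i j => u j i, ?_⟩
    ext i j
    exact congrFun (hu j) i
  -- Modulo π the step matrix is `M U`; the remainder is π times an integral matrix, and `π M⁻¹` is
  -- integral.
  have hinv : (M⁻¹ * stepMat c).val ∈ (intRing k).matrix := by
    set R := (stepMat c).val - M.val * constMat U with hR
    have hMU := Subring.mul_mem _ hM.mem (constMat_mem U)
    have hRmem : R ∈ (intRing k).matrix := Subring.sub_mem _ hQ hMU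
    have hR0 : redMat R = 0 := by
      rw [hR, redMat_sub, redMat_mul hM.mem (constMat_mem U), redMat_constMat, hU, sub_self]
    have hR1 : (diagX fun _ => -1).val * R ∈ (intRing k).matrix := by
      intro i j
      rw [diagX_mul_apply]
      exact (single_neg_one_mul_mem_iff (hRmem i j)).mpr (congrFun (congrFun hR0 i) j)
    have e : (M⁻¹ * stepMat c).val = constMat U +
        (diagX (fun _ => 1) * M⁻¹).val * ((diagX fun _ => -1).val * R) := by
      have e1 : diagX (fun _ => 1) * M⁻¹ * (diagX fun _ => -1) = M⁻¹ := by
        rw [diagX_const_mul, mul_assoc, ← diagX_add]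
        have : ((fun _ => 1) + fun _ => -1 : Fin 4 → ℤ) = 0 := by ext; simp
        rw [this, diagX_zero, mul_one]
      rw [← mul_assoc, ← Units.val_mul, e1, hR, mul_sub, Units.val_mul, ← mul_assoc,
        ← Units.val_mul M⁻¹ M, inv_mul_cancel, Units.val_one, one_mul, add_sub_cancel]
    rw [e]
    exact Subring.add_mem _ (constMat_mem U) (Subring.mul_mem _ hM.inv_mem hR1)
  -- The inverse step matrix divides the rows in `J` by π after subtracting the linear relations of
  -- the cell; the columns of `M` satisfy these relations modulo π.
  have hdir : ((stepMat c)⁻¹ * M).val ∈ (intRing k).matrix := by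
    have hcM : ((cellGL c)⁻¹ * M).val ∈ (intRing k).matrix := by
      rw [Units.val_mul]
      exact Subring.mul_mem _ (mem_GLO_iff.mp (cellGL_mem c)).2 hM.mem
    have hval : ((cellGL c)⁻¹ * M).val = M.val - constMat (cellMat c) * M.val := by
      rw [← maskMat_cellMat, ← one_mul M.val, ← mul_assoc, mul_one, ← sub_mul]
      rfl
    intro a j
    rw [stepMat, mul_inv_rev, mul_assoc, ← diagX_neg, Units.val_mul, diagX_mul_apply]
    change _ ∈ intRing k
    by_cases ha : a ∈ J
    · have hja : (-indVec J) a = -1 := by rw [Pi.neg_apply, indVec, if_pos ha]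
      rw [hja]
      refine (single_neg_one_mul_mem_iff (hcM a j)).mpr ?_
      have h0 : redMat ((cellGL c)⁻¹ * M).val a j = 0 := by
        rw [hval, redMat_sub, redMat_mul (constMat_mem _) hM.mem, redMat_constMat,
          Matrix.sub_apply, sub_eq_zero]
        exact hcol j a ha
      exact h0
    · have hja : (-indVec J) a = 0 := by rw [Pi.neg_apply, indVec, if_neg ha, neg_zero]
      rw [hja]
      exact (intRing k).mul_mem (single_mem_intRing le_rfl _) (hcM a j)
  have ha : (stepMat c)⁻¹ * M ∈ GLO k := by
    rw [mem_GLO_iff, mul_inv_rev, inv_inv]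
    exact ⟨hdir, hinv⟩
  refine ⟨J, c, ?_, ?_, _, ha, (mul_inv_cancel_left _ _).symm⟩
  · rintro rfl
    apply hM.inv_notMem
    have h0 : (stepMat c) ∈ GLO k := by
      have : indVec ∅ = 0 := by ext; simp [indVec]
      rw [stepMat, this, diagX_zero, mul_one]
      exact cellGL_mem c
    have := mul_mem h0 ha
    rw [mul_inv_cancel_left] at this
    exact (mem_GLO_iff.mp this).2
  · rintro rfl
    apply hM.notMem
    have h0 : diagX (fun _ => -1) * stepMat c ∈ GLO k := by
      have : indVec Finset.univ = fun _ => 1 := by ext; simp [indVec]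
      rw [stepMat, this, diagX_const_neg, ← diagX_const_mul, inv_mul_cancel_left]
      exact cellGL_mem c
    have := mul_mem h0 ha
    rw [mul_assoc, mul_inv_cancel_left] at this
    exact (mem_GLO_iff.mp this).1

theorem order_det_stepMat {J : Finset (Fin 4)} (c : Cell k J) :
    (stepMat c).val.det.order = J.card := by
  rw [stepMat, order_det_mul, order_det_of_mem_GLO (cellGL_mem c), order_det_diagX, sum_indVec,
    zero_add]

theorem card_pos_of_ne {J : Finset (Fin 4)} (h1 : J ≠ ∅) (h2 : J ≠ Finset.univ) :
    0 < J.card ∧ J.card < 4 :=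
  ⟨Finset.card_pos.mpr (Finset.nonempty_iff_ne_empty.mpr h1), by
    simpa using Finset.card_lt_univ_of_notMem
      (Classical.choose_spec (by simpa [Finset.eq_univ_iff_forall] using h2 : ∃ j, j ∉ J))⟩

/-- The neighbour of a vertex attached to a point of a Schubert cell. -/
def neighbour (g : GL (Fin 4) k⸨X⸩) (p : Σ J : Finset (Fin 4), Cell k J) : Vertex k :=
  vertexOf (g * stepMat p.2)

/-- Two equal neighbours have the same subspace of `k⁴` as reduction, and the subspace determines
its cell and coordinates. -/
theorem neighbour_injOn (g : GL (Fin 4) k⸨X⸩) : Set.InjOn (neighbour g)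
    {p : Σ J : Finset (Fin 4), Cell k J | p.1 ≠ ∅ ∧ p.1 ≠ Finset.univ} := by
  rintro ⟨J, c⟩ ⟨h1, h2⟩ ⟨J', c'⟩ ⟨h1', h2'⟩ h
  obtain ⟨n, a, ha, h⟩ := vertexOf_eq_iff.mp h
  rw [diagX_const_mul, mul_assoc, mul_assoc, mul_left_cancel_iff, ← mul_assoc,
    ← diagX_const_mul, mul_assoc] at h
  dsimp only at h h1 h2 h1' h2'
  -- The determinants have orders between 1 and 3 that differ by `4 n`.
  have hn : n = 0 := by
    have ho := congrArg (fun g : GL (Fin 4) k⸨X⸩ => g.val.det.order) h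
    simp only [order_det_mul, order_det_stepMat, order_det_diagX, order_det_of_mem_GLO ha,
      Fin.sum_univ_four] at ho
    have e1 := card_pos_of_ne h1 h2
    have e2 := card_pos_of_ne h1' h2'
    omega
  subst hn
  have h0 : (diagX fun _ => 0 : GL (Fin 4) k⸨X⸩) = 1 := diagX_zero
  rw [h0, one_mul] at h
  have key : ∀ (J J' : Finset (Fin 4)) (c : Cell k J) (c' : Cell k J') (a : GL (Fin 4) k⸨X⸩),
      a ∈ GLO k → stepMat c' = stepMat c * a → ∀ v, InCell c' v → InCell c v := by
    intro J J' c c' a ha h v hv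
    rw [inCell_iff_mem_range] at hv ⊢
    obtain ⟨u, rfl⟩ := hv
    refine ⟨(redMat a.val).mulVec u, ?_⟩
    rw [h, Matrix.mulVec_mulVec, Units.val_mul,
      redMat_mul (stepMat_mem c) (mem_GLO_iff.mp ha).1]
  exact cell_unique fun v => ⟨key J' J c' c a⁻¹ (inv_mem ha) (by rw [h, mul_inv_cancel_right]) v,
    key J J' c c' a ha h v⟩

theorem adj_iff_exists_neighbour {g : GL (Fin 4) k⸨X⸩} {y : Vertex k} : Adj (vertexOf g) y ↔
    ∃ p : Σ J : Finset (Fin 4), Cell k J, (p.1 ≠ ∅ ∧ p.1 ≠ Finset.univ) ∧ neighbour g p = y := by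
  rw [adj_vertexOf_iff]
  constructor
  · rintro ⟨M, hM, rfl⟩
    obtain ⟨J, c, h1, h2, a, ha, rfl⟩ := hM.exists_stepMat
    refine ⟨⟨J, c⟩, ⟨h1, h2⟩, ?_⟩
    rw [neighbour, ← mul_assoc, vertexOf_mul_of_mem ha]
  · rintro ⟨p, ⟨h1, h2⟩, rfl⟩
    exact ⟨_, stepMat_isStep h1 h2 p.2, rfl⟩

theorem color_neighbour (g : GL (Fin 4) k⸨X⸩) (p : Σ J : Finset (Fin 4), Cell k J) :
    color (neighbour g p) = color (vertexOf g) + (p.1.card : ZMod 4) := by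
  rw [neighbour, color_vertexOf_mul, color_vertexOf (stepMat p.2), order_det_stepMat,
    Int.cast_natCast]

end Neighbours

end Building
end

noncomputable section

namespace Building

/-! ### Diagonal representatives of the orbits of vertices -/

section Orbits

variable {k : Type*} [Field k]

/-- The orbit of the vertex of the diagonal matrix `π ^ ν`. -/
def diagQ (k : Type*) [Field k] (ν : Fin 4 → ℤ) : QVertex k :=
  toQ (vertexOf (diagX ν))

theorem toQ_smul {γ : GL (Fin 4) k⸨X⸩} (hγ : γ ∈ GLP k) (g : GL (Fin 4) k⸨X⸩) :
    toQ (vertexOf (γ * g)) = toQ (vertexOf g) := by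
  rw [eq_comm, toQ_eq_iff]
  refine ⟨0, γ, hγ, 1, one_mem _, ?_⟩
  have h0 : (diagX fun _ => 0 : GL (Fin 4) k⸨X⸩) = 1 := diagX_zero
  rw [h0, one_mul, mul_one]

theorem toQ_eq_toQ_iff {x y : Vertex k} :
    toQ x = toQ y ↔ ∃ γ : Gam k, γ • y = x := by
  rw [toQ, toQ, Quotient.eq'', MulAction.orbitRel_apply, MulAction.mem_orbit_iff]

theorem toQ_gam_smul (γ : Gam k) (x : Vertex k) : toQ (γ • x) = toQ x :=
  toQ_eq_toQ_iff.mpr ⟨γ, rfl⟩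

/-- The permutation matrices. -/
def permGL (σ : Equiv.Perm (Fin 4)) : GL (Fin 4) k⸨X⸩ where
  val := (1 : Matrix (Fin 4) (Fin 4) k⸨X⸩).submatrix σ (Equiv.refl _)
  inv := (1 : Matrix (Fin 4) (Fin 4) k⸨X⸩).submatrix (Equiv.refl _) σ
  val_inv := by
    rw [Matrix.one_submatrix_mul]
    ext1 i j
    simp [Matrix.one_apply]
  inv_val := by
    rw [Matrix.submatrix_mul_equiv, mul_one, Matrix.submatrix_one_equiv]

theorem permGL_apply (σ : Equiv.Perm (Fin 4)) (i j : Fin 4) :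
    (permGL σ : GL (Fin 4) k⸨X⸩).val i j = if σ i = j then 1 else 0 := by
  change (1 : Matrix (Fin 4) (Fin 4) k⸨X⸩) (σ i) j = _
  rw [Matrix.one_apply]

theorem permGL_val_mem (S : Subring k⸨X⸩) (σ : Equiv.Perm (Fin 4)) :
    (permGL σ).val ∈ S.matrix ∧ (permGL σ)⁻¹.val ∈ S.matrix := by
  have h : ∀ i j, (1 : Matrix (Fin 4) (Fin 4) k⸨X⸩) i j ∈ S := fun i j =>
    (Subring.one_mem S.matrix) i j
  exact ⟨fun i j => h _ _, fun i j => h _ _⟩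

theorem permGL_mul_diagX (σ : Equiv.Perm (Fin 4)) (ν : Fin 4 → ℤ) :
    (permGL σ * diagX ν : GL (Fin 4) k⸨X⸩) = diagX (ν ∘ σ) * permGL σ := by
  apply Units.ext
  rw [Units.val_mul, Units.val_mul]
  apply Matrix.ext
  intro i j
  rw [diagX_mul_apply, mul_diagX_apply, permGL_apply]
  split_ifs with h
  · rw [one_mul, mul_one, ← h, Function.comp_apply]
  · rw [zero_mul, mul_zero]

theorem diagQ_comp_perm (ν : Fin 4 → ℤ) (σ : Equiv.Perm (Fin 4)) :
    diagQ k (ν ∘ σ) = diagQ k ν := by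
  have hP : (permGL σ : GL (Fin 4) k⸨X⸩) ∈ GLP k := mem_GLP_iff.mpr (permGL_val_mem _ σ)
  have hO : (permGL σ : GL (Fin 4) k⸨X⸩) ∈ GLO k := mem_GLO_iff.mpr (permGL_val_mem _ σ)
  rw [diagQ, diagQ, ← toQ_smul hP (diagX ν), permGL_mul_diagX, vertexOf_mul_of_mem hO]

theorem diagQ_add_const (ν : Fin 4 → ℤ) (n : ℤ) : diagQ k (ν + fun _ => n) = diagQ k ν := by
  rw [diagQ, add_comm, diagX_add, vertexOf_diagX_const_mul, diagQ]

/-- Moved to the left of a dominant diagonal matrix, the unipotent matrix of the cell acquires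
polynomial entries and is absorbed by Γ. So the orbit of a neighbour depends only on the cell, and
its multiplicity is the number of points of the cell. -/
theorem neighbour_diagX {ν : Fin 4 → ℤ} (hν : Antitone ν)
    (p : Σ J : Finset (Fin 4), Cell k J) :
    toQ (neighbour (diagX ν) p) = diagQ k (ν + indVec p.1) := by
  rw [neighbour, stepMat, ← mul_assoc, cellGL, diagX_mul_blockUnip, mul_assoc, ← diagX_add,
    toQ_smul, diagQ]
  refine mem_GLP_iff.mpr (blockUnip_val_mem fun a ha j hj => ?_)
  by_cases hja : j < a
  · rw [constMat, Matrix.map_apply, HahnSeries.single_mul_single, zero_add]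
    exact single_mem_polyRing (by have := hν hja.le; omega) _
  · rw [constMat, Matrix.map_apply, cellMat_eq_zero p.2 (by tauto), map_zero, zero_mul]
    exact (polyRing k).zero_mem

theorem adj_diagX (ν : Fin 4 → ℤ) {J : Finset (Fin 4)} (h1 : J ≠ ∅) (h2 : J ≠ Finset.univ) :
    Adj (vertexOf (diagX ν : GL (Fin 4) k⸨X⸩)) (vertexOf (diagX (ν + indVec J))) :=
  adj_vertexOf_iff.mpr ⟨_, diagX_ind_isStep h1 h2, by rw [diagX_add]⟩

/-! ### Separation of orbits -/

/-- A nonzero term of the determinant gives a permutation with nonzero entries, and a nonzero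
polynomial in `t` has a nonzero coefficient at some exponent at most 0. -/
theorem exists_perm_le {P : Matrix (Fin 4) (Fin 4) k⸨X⸩} (hP : P.det ≠ 0)
    (h : P ∈ (polyRing k).matrix) {ν μ : Fin 4 → ℤ}
    (hc : ∀ i j, ∀ n < ν i - μ j, (P i j).coeff n = 0) :
    ∃ σ : Equiv.Perm (Fin 4), ∀ i, ν (σ i) ≤ μ i := by
  rw [Matrix.det_apply] at hP
  obtain ⟨σ, -, hσ⟩ := Finset.exists_ne_zero_of_sum_ne_zero hP
  refine ⟨σ, fun i => ?_⟩
  have hi : P (σ i) i ≠ 0 := by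
    intro h0
    apply hσ
    have h00 : ∏ i, P (σ i) i = 0 := Finset.prod_eq_zero (Finset.mem_univ i) h0
    rw [h00, smul_zero]
  by_contra! hlt
  apply hi
  ext n
  rw [HahnSeries.coeff_zero]
  rcases le_or_gt n 0 with hn | hn
  · exact hc _ _ n (by omega)
  · exact coeff_of_mem_polyRing (h _ _) hn

theorem coeff_diagX_conj {a : GL (Fin 4) k⸨X⸩} (ha : a.val ∈ (intRing k).matrix)
    (ν μ : Fin 4 → ℤ) (i j : Fin 4) {n : ℤ} (hn : n < ν i - μ j) :
    ((diagX ν * a * (diagX μ)⁻¹).val i j).coeff n = 0 := by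
  have e : (diagX ν * a * (diagX μ)⁻¹).val i j = HahnSeries.single (ν i - μ j) 1 * a.val i j := by
    rw [← diagX_neg, Units.val_mul, mul_diagX_apply, Units.val_mul, diagX_mul_apply, mul_right_comm,
      HahnSeries.single_mul_single, mul_one]
    rfl
  have h2 := HahnSeries.coeff_single_mul_add (r := (1 : k)) (x := a.val i j)
    (a := n - (ν i - μ j)) (b := ν i - μ j)
  rw [sub_add_cancel, one_mul] at h2
  rw [e, h2]
  exact mem_intRing.mp (ha i j) _ (by omega)

/-- The inequalities of `exists_perm_le` are equalities, since comparing determinants shows that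
both sides have the same sum. -/
theorem exists_perm_of_diagQ_eq {ν μ : Fin 4 → ℤ} (h : diagQ k ν = diagQ k μ) :
    ∃ (σ : Equiv.Perm (Fin 4)) (n : ℤ), ν ∘ σ = μ + fun _ => n := by
  obtain ⟨n, γ, hγ, a, ha, h⟩ := toQ_eq_iff.mp h
  have hdet := congrArg (fun g : GL (Fin 4) k⸨X⸩ => g.val.det.order) h
  simp only [order_det_mul, order_det_diagX, order_det_of_mem_GLO ha, order_det_of_mem_GLP hγ,
    Fin.sum_univ_four] at hdet
  have hγ' : γ⁻¹ = diagX ν * a * (diagX (μ + fun _ => -n))⁻¹ := by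
    rw [eq_mul_inv_iff_mul_eq, inv_mul_eq_iff_eq_mul, diagX_add, h, diagX_const_neg,
      ← diagX_const_neg, ← diagX_const_mul, diagX_const_neg]
    simp only [mul_assoc, inv_mul_cancel_left]
  obtain ⟨h1, -⟩ := mem_GLP_iff.mp (inv_mem hγ)
  obtain ⟨σ, hσ⟩ := exists_perm_le (ν := ν) (μ := μ + fun _ => -n)
    (Matrix.GeneralLinearGroup.det_ne_zero γ⁻¹) h1 fun i j m hm => by
      rw [hγ']
      exact coeff_diagX_conj (mem_GLO_iff.mp ha).1 _ _ i j hm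
  refine ⟨σ, -n, ?_⟩
  have hsum : ∑ i, ν (σ i) = ∑ i, ν i := Equiv.sum_comp σ ν
  simp only [Fin.sum_univ_four] at hsum
  simp only [Pi.add_apply] at hσ
  have e0 := hσ 0
  have e1 := hσ 1
  have e2 := hσ 2
  have e3 := hσ 3
  ext i
  simp only [Function.comp_apply, Pi.add_apply]
  fin_cases i <;> simp only [Fin.zero_eta, Fin.mk_one, Fin.reduceFinMk] <;> omega

/-! ### Coordinates on the quotient -/

/-- The tuple with given successive differences and last entry `0`. -/
def coordTuple (μ : Coweight) : Fin 4 → ℤ := ![μ.1 + μ.2.1 + μ.2.2, μ.2.1 + μ.2.2, μ.2.2, 0]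

/-- The orbit with given coordinates. -/
def coordQ (k : Type*) [Field k] (μ : Coweight) : QVertex k := diagQ k (coordTuple μ)

/-- The successive differences of a tuple. -/
def diffs (ν : Fin 4 → ℤ) : Coweight := (ν 0 - ν 1, ν 1 - ν 2, ν 2 - ν 3)

theorem diagQ_eq_coordQ (ν : Fin 4 → ℤ) : diagQ k ν = coordQ k (diffs ν) := by
  rw [coordQ, ← diagQ_add_const (coordTuple _) (ν 3)]
  congr 1
  ext i
  fin_cases i <;> simp [coordTuple, diffs]

theorem coordQ_refl (i : Fin 3) (μ : Coweight) : coordQ k (refl i μ) = coordQ k μ := by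
  obtain ⟨a, b, c⟩ := μ
  have h0 : ∀ j, (Equiv.swap (0 : Fin 4) 1) j = ![1, 0, 2, 3] j := by decide
  have h1 : ∀ j, (Equiv.swap (1 : Fin 4) 2) j = ![0, 2, 1, 3] j := by decide
  have h2 : ∀ j, (Equiv.swap (2 : Fin 4) 3) j = ![0, 1, 3, 2] j := by decide
  fin_cases i
  · rw [coordQ, coordQ, ← diagQ_comp_perm _ (Equiv.swap 0 1), diagQ_eq_coordQ, diagQ_eq_coordQ]
    congr 1
    simp [diffs, coordTuple, refl, h0]
  · rw [coordQ, coordQ, ← diagQ_comp_perm _ (Equiv.swap 1 2), diagQ_eq_coordQ, diagQ_eq_coordQ]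
    congr 1
    simp [diffs, coordTuple, refl, h1]
  · rw [coordQ, coordQ, ← diagQ_comp_perm _ (Equiv.swap 2 3), diagQ_eq_coordQ, diagQ_eq_coordQ]
    congr 1
    simp [diffs, coordTuple, refl, h2]
    ring

theorem diffs_mem_cone {ν : Fin 4 → ℤ} : diffs ν ∈ cone ↔ Antitone ν := by
  rw [Fin.antitone_iff_succ_le]
  simp [diffs, mem_cone, Fin.forall_fin_succ]

theorem exists_antitone_comp (ν : Fin 4 → ℤ) : ∃ σ : Equiv.Perm (Fin 4), Antitone (ν ∘ σ) := by
  refine ⟨Tuple.sort (-ν), fun i j hij => ?_⟩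
  have := Tuple.monotone_sort (-ν) hij
  simpa using this

theorem antitone_coordTuple {μ : Coweight} (hμ : μ ∈ cone) : Antitone (coordTuple μ) := by
  rw [← diffs_mem_cone]
  convert hμ
  simp [diffs, coordTuple]

theorem diffs_coordTuple (μ : Coweight) : diffs (coordTuple μ) = μ := by
  simp [diffs, coordTuple]

/-- Two antitone tuples that are rearrangements of each other up to a constant have the same
differences, because a sorted rearrangement is unique. -/
theorem coordQ_injOn : Set.InjOn (coordQ k) cone := by
  intro μ hμ μ' hμ' h
  obtain ⟨σ, n, hσ⟩ := exists_perm_of_diagQ_eq h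
  have hmono := antitone_coordTuple hμ
  have hmono' : Antitone (coordTuple μ ∘ σ) := by
    rw [hσ]
    intro i j hij
    simpa using antitone_coordTuple hμ' hij
  have heq : coordTuple μ ∘ σ = coordTuple μ := by
    have := Tuple.unique_monotone (f := OrderDual.toDual ∘ coordTuple μ) (σ := σ) (τ := 1)
      (fun i j hij => hmono' hij) (fun i j hij => hmono hij)
    exact this
  rw [heq] at hσ
  rw [← diffs_coordTuple μ, hσ]
  conv_rhs => rw [← diffs_coordTuple μ']
  simp only [diffs, Pi.add_apply, add_sub_add_right_eq_sub]

theorem exists_mem_cone (ν : Fin 4 → ℤ) : ∃ μ ∈ cone, coordQ k μ = diagQ k ν := by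
  obtain ⟨σ, hσ⟩ := exists_antitone_comp ν
  exact ⟨diffs (ν ∘ σ), diffs_mem_cone.mpr hσ, by rw [← diagQ_eq_coordQ, diagQ_comp_perm]⟩

end Orbits

end Building
end

noncomputable section

namespace Building

/-! ### Every vertex is equivalent to a diagonal one -/

section Exhaustion

variable {k : Type*} [Field k]

/-- The vertices that are equivalent to a diagonal vertex. -/
def IsDiagonalizable (x : Vertex k) : Prop := ∃ ν, toQ x = diagQ k ν

theorem IsDiagonalizable.exists_antitone {x : Vertex k} (hx : IsDiagonalizable x) :
    ∃ ν, Antitone ν ∧ toQ x = diagQ k ν := by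
  obtain ⟨ν, hν⟩ := hx
  obtain ⟨σ, hσ⟩ := exists_antitone_comp ν
  exact ⟨_, hσ, by rw [diagQ_comp_perm, hν]⟩

/-- After translation by Γ the first vertex is diagonal and dominant, and then all its neighbours
are equivalent to diagonal ones. Exhaustion thus reduces to connecting vertices by edges. -/
theorem IsDiagonalizable.of_adj {x y : Vertex k} (hx : IsDiagonalizable x) (h : Adj x y) :
    IsDiagonalizable y := by
  obtain ⟨ν, hν, hxν⟩ := hx.exists_antitone
  obtain ⟨γ, rfl⟩ := toQ_eq_toQ_iff.mp hxν
  have h' := h.smul (γ⁻¹ : Gam k)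
  change Adj (γ⁻¹ • γ • vertexOf (diagX ν)) (γ⁻¹ • y) at h'
  rw [inv_smul_smul, adj_iff_exists_neighbour] at h'
  obtain ⟨p, -, hp⟩ := h'
  refine ⟨ν + indVec p.1, ?_⟩
  rw [← neighbour_diagX hν, hp, toQ_gam_smul]

/-- Right multiplication by the matrix preserves diagonalizability of vertices. -/
def PreservesDiagonalizable (h : GL (Fin 4) k⸨X⸩) : Prop :=
  ∀ g, IsDiagonalizable (vertexOf g) → IsDiagonalizable (vertexOf (g * h))

theorem PreservesDiagonalizable.mul {h h' : GL (Fin 4) k⸨X⸩} (H : PreservesDiagonalizable h)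
    (H' : PreservesDiagonalizable h') : PreservesDiagonalizable (h * h') := by
  intro g hg
  rw [← mul_assoc]
  exact H' _ (H _ hg)

theorem preservesDiagonalizable_of_mem_GLO {a : GL (Fin 4) k⸨X⸩} (ha : a ∈ GLO k) :
    PreservesDiagonalizable a := by
  intro g hg
  rwa [vertexOf_mul_of_mem ha]

theorem preservesDiagonalizable_one : PreservesDiagonalizable (1 : GL (Fin 4) k⸨X⸩) :=
  preservesDiagonalizable_of_mem_GLO (one_mem _)

theorem preservesDiagonalizable_diagX (ν : Fin 4 → ℤ) :
    PreservesDiagonalizable (diagX ν : GL (Fin 4) k⸨X⸩) := by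
  have h1 : ∀ j : Fin 4, PreservesDiagonalizable (diagX (indVec {j}) : GL (Fin 4) k⸨X⸩) := by
    intro j g hg
    exact hg.of_adj (adj_vertexOf_iff.mpr ⟨_, diagX_ind_isStep (by simp) (by revert j; decide), rfl⟩)
  have h2 : ∀ (j : Fin 4) (n : ℕ),
      PreservesDiagonalizable (diagX (n • indVec {j}) : GL (Fin 4) k⸨X⸩) := by
    intro j n
    induction n with
    | zero =>
      rw [zero_smul, diagX_zero]
      exact preservesDiagonalizable_one
    | succ n ih =>
      rw [succ_nsmul, diagX_add]
      exact ih.mul (h1 j)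
  have h3 : ∀ ν : Fin 4 → ℤ, (∀ j, 0 ≤ ν j) →
      PreservesDiagonalizable (diagX ν : GL (Fin 4) k⸨X⸩) := by
    intro ν hν
    have e : ν = (ν 0).toNat • indVec {0} + (ν 1).toNat • indVec {1} +
        (ν 2).toNat • indVec {2} + (ν 3).toNat • indVec {3} := by
      ext j
      have := hν j
      fin_cases j <;> simp_all [indVec]
    rw [e, diagX_add, diagX_add, diagX_add]
    exact (((h2 _ _).mul (h2 _ _)).mul (h2 _ _)).mul (h2 _ _)
  -- A constant shift does not change the vertex, so the exponents may be taken nonnegative.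
  obtain ⟨m, hm⟩ : ∃ m : ℤ, ∀ j, 0 ≤ ν j + m := by
    refine ⟨|ν 0| + |ν 1| + |ν 2| + |ν 3|, fun j => ?_⟩
    have h0 := abs_nonneg (ν 0)
    have h1 := abs_nonneg (ν 1)
    have h2 := abs_nonneg (ν 2)
    have h3 := abs_nonneg (ν 3)
    have h4 := neg_abs_le (ν j)
    fin_cases j <;> simp only [Fin.zero_eta, Fin.mk_one, Fin.reduceFinMk] at h4 ⊢ <;> omega
  intro g hg
  have := h3 (ν + fun _ => m) hm g hg
  rwa [diagX_add, ← diagX_const_mul, ← mul_assoc, ← diagX_const_mul, mul_assoc,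
    vertexOf_diagX_const_mul] at this

/-- Every invertible matrix is a product of diagonal matrices and transvections, and each of these
is a product of powers of the uniformizer on the diagonal and matrices in `GLO`. -/
theorem preservesDiagonalizable (h : GL (Fin 4) k⸨X⸩) : PreservesDiagonalizable h := by
  suffices ∀ g : GL (Fin 4) k⸨X⸩, g.val = h.val → PreservesDiagonalizable g from this h rfl
  refine Matrix.diagonal_transvection_induction_of_det_ne_zero
    (fun M => ∀ g : GL (Fin 4) k⸨X⸩, g.val = M → PreservesDiagonalizable g) h.val
    (Matrix.GeneralLinearGroup.det_ne_zero h) ?_ ?_ ?_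
  · intro D hD g hg
    have hD0 : ∀ j, D j ≠ 0 := by
      intro j hj
      apply hD
      rw [Matrix.det_diagonal]
      exact Finset.prod_eq_zero (Finset.mem_univ j) hj
    choose y hy hy1 hy2 using fun j => exists_eq_single_mul (hD0 j)
    have e : g = diagX (fun j => (D j).order) * ((diagX fun j => (D j).order)⁻¹ * g) := by
      rw [mul_inv_cancel_left]
    rw [e]
    refine (preservesDiagonalizable_diagX _).mul (preservesDiagonalizable_of_mem_GLO ?_)
    refine diagonal_mem_GLO (y := y) ?_ hy1 hy2
    rw [← diagX_neg, Units.val_mul, hg]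
    change Matrix.diagonal _ * _ = _
    rw [Matrix.diagonal_mul_diagonal]
    congr 1
    ext1 j
    rw [Pi.neg_apply]
    nth_rewrite 2 [hy j]
    rw [← mul_assoc, mul_comm (HahnSeries.single _ _), single_mul_single_neg,
      one_mul]
  · rintro ⟨i, j, hij, c⟩ g hg
    by_cases hc : c = 0
    · have : g = 1 := by
        apply Units.ext
        rw [hg, hc]
        simp [Matrix.TransvectionStruct.toMatrix]
      rw [this]
      exact preservesDiagonalizable_one
    let N : Matrix (Fin 4) (Fin 4) k⸨X⸩ := fun _ b => if b = j then c else 0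
    -- Conjugation by this diagonal matrix divides `c` by its power of the uniformizer, which makes
    -- the transvection integral.
    let ν : Fin 4 → ℤ := fun l => if l = i then -c.order else 0
    have hgN : g = blockUnip {i} N := by
      apply Units.ext
      rw [hg]
      change Matrix.transvection i j c = 1 + maskMat {i} N
      rw [Matrix.transvection]
      congr 1
      apply Matrix.ext
      intro a b
      simp only [Matrix.single_apply, maskMat, Finset.mem_singleton, N]
      by_cases ha : a = i <;> by_cases hb : b = j <;> grind
    have e : g = diagX (-ν) * blockUnip {i} (fun a b => N a b * HahnSeries.single (ν a - ν b) 1) *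
        diagX ν := by
      rw [mul_assoc, ← diagX_mul_blockUnip, diagX_neg, inv_mul_cancel_left, hgN]
    rw [e]
    refine ((preservesDiagonalizable_diagX _).mul (preservesDiagonalizable_of_mem_GLO ?_)).mul
      (preservesDiagonalizable_diagX _)
    refine mem_GLO_iff.mpr (blockUnip_val_mem fun a ha b hb => ?_)
    rw [Finset.mem_singleton] at ha hb
    simp only [N, ν]
    rw [if_pos ha, if_neg hb]
    split_ifs
    · obtain ⟨y, hy, hy1, -⟩ := exists_eq_single_mul hc
      rw [sub_zero, mul_comm]
      nth_rewrite 2 [hy]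
      rw [← mul_assoc, mul_comm (HahnSeries.single _ _), single_mul_single_neg, one_mul]
      exact hy1
    · rw [zero_mul]
      exact (intRing k).zero_mem
  · intro A B hA hB ihA ihB g hg
    have e : g = Matrix.GeneralLinearGroup.mkOfDetNeZero A hA *
        Matrix.GeneralLinearGroup.mkOfDetNeZero B hB := Units.ext hg
    rw [e]
    exact (ihA _ rfl).mul (ihB _ rfl)

theorem isDiagonalizable (x : Vertex k) : IsDiagonalizable x := by
  obtain ⟨g, rfl⟩ := exists_vertexOf_eq x
  have h1 : IsDiagonalizable (vertexOf (1 : GL (Fin 4) k⸨X⸩)) := ⟨0, by rw [diagQ, diagX_zero]⟩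
  simpa using preservesDiagonalizable g 1 h1

theorem exists_toQ_eq (u : QVertex k) : ∃ x : Vertex k, toQ x = u := Quotient.exists_rep u

theorem exists_coordQ_eq (u : QVertex k) : ∃ μ ∈ cone, coordQ k μ = u := by
  obtain ⟨x, rfl⟩ := exists_toQ_eq u
  obtain ⟨ν, hν⟩ := isDiagonalizable x
  rw [hν]
  exact exists_mem_cone ν

end Exhaustion

/-! ### Finiteness of stabilizers -/

section Stabilizers

variable {k : Type*} [Field k] [Finite k]

theorem finite_bounded_series (N : ℕ) :
    Finite {x : k⸨X⸩ // ∀ n : ℤ, n < -(N : ℤ) ∨ 0 < n → x.coeff n = 0} := by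
  refine Finite.of_injective
    (fun x => fun n : Finset.Icc (-(N : ℤ)) 0 => x.1.coeff n) fun x y h => ?_
  apply Subtype.ext
  ext n
  by_cases hn : n ∈ Finset.Icc (-(N : ℤ)) 0
  · exact congrFun h ⟨n, hn⟩
  · rw [Finset.mem_Icc, not_and_or, not_le, not_le] at hn
    rw [x.2 n hn, y.2 n hn]

/-- An element of the stabilizer has a representative whose entries are polynomials in `t`, of
degree bounded by the differences of the exponents of `ν`; over a finite field there are finitely
many. -/
theorem finite_stabilizer_diagX (ν : Fin 4 → ℤ) :
    Finite (MulAction.stabilizer (Gam k) (vertexOf (diagX ν : GL (Fin 4) k⸨X⸩))) := by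
  obtain ⟨N, hN⟩ : ∃ N : ℕ, ∀ i j, -(N : ℤ) ≤ ν i - ν j := by
    refine ⟨∑ i, ∑ j, (ν i - ν j).natAbs, fun i j => ?_⟩
    have h1 : (ν i - ν j).natAbs ≤ ∑ j, (ν i - ν j).natAbs :=
      Finset.single_le_sum (f := fun j => (ν i - ν j).natAbs) (fun _ _ => Nat.zero_le _)
        (Finset.mem_univ j)
    have h2 : ∑ j, (ν i - ν j).natAbs ≤ ∑ i, ∑ j, (ν i - ν j).natAbs :=
      Finset.single_le_sum (f := fun i => ∑ j, (ν i - ν j).natAbs) (fun _ _ => Nat.zero_le _)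
        (Finset.mem_univ i)
    omega
  have key : ∀ γ : MulAction.stabilizer (Gam k) (vertexOf (diagX ν : GL (Fin 4) k⸨X⸩)),
      ∃ g : GL (Fin 4) k⸨X⸩, Matrix.ProjGenLinGroup.mk g = γ.1.1 ∧
        ∀ i j, ∀ n : ℤ, n < -(N : ℤ) ∨ 0 < n → (g.val i j).coeff n = 0 := by
    rintro ⟨⟨γ, hγ⟩, hst⟩
    obtain ⟨g, hg, rfl⟩ := mem_Gam_iff.mp hγ
    refine ⟨g, rfl, fun i j n hn => ?_⟩
    rcases hn with hn | hn
    · have h1 : vertexOf (g * diagX ν) = vertexOf (diagX ν) := hst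
      obtain ⟨m, a, ha, h1⟩ := vertexOf_eq_iff.mp h1
      have hdet := congrArg (fun g : GL (Fin 4) k⸨X⸩ => g.val.det.order) h1
      simp only [order_det_mul, order_det_diagX, order_det_of_mem_GLO ha, order_det_of_mem_GLP hg,
        Fin.sum_univ_four] at hdet
      -- The homothety is trivial because elements of `GLP` and `GLO` have determinants of order 0.
      obtain rfl : m = 0 := by omega
      have h0 : (diagX fun _ => 0 : GL (Fin 4) k⸨X⸩) = 1 := diagX_zero
      rw [h0, one_mul] at h1
      have e : g = diagX ν * a⁻¹ * (diagX ν)⁻¹ := by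
        rw [eq_mul_inv_iff_mul_eq, eq_mul_inv_iff_mul_eq]
        exact h1.symm
      rw [e]
      exact coeff_diagX_conj (mem_GLO_iff.mp (inv_mem ha)).1 _ _ i j (hn.trans_le (hN i j))
    · exact coeff_of_mem_polyRing ((mem_GLP_iff.mp hg).1 i j) hn
  choose g hg hgc using key
  have := finite_bounded_series (k := k) N
  refine Finite.of_injective (fun γ => fun i j =>
    (⟨(g γ).val i j, hgc γ i j⟩ : {x : k⸨X⸩ // ∀ n : ℤ, n < -(N : ℤ) ∨ 0 < n → x.coeff n = 0}))
    fun γ γ' h => ?_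
  have hgg : g γ = g γ' := by
    apply Units.ext
    apply Matrix.ext
    intro i j
    exact congrArg Subtype.val (congrFun (congrFun h i) j)
  exact Subtype.ext (Subtype.ext (by rw [← hg, hgg, hg]))

theorem finite_stabilizer (x : Vertex k) : Finite (MulAction.stabilizer (Gam k) x) := by
  obtain ⟨ν, hν⟩ := isDiagonalizable x
  have := finite_stabilizer_diagX (k := k) ν
  exact Finite.of_equiv _ (MulAction.stabilizerEquivStabilizerOfOrbitRel
    (Quotient.eq''.mp hν.symm)).toEquiv

theorem finite_adj (x : Vertex k) : {y | Adj x y}.Finite := by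
  obtain ⟨g, rfl⟩ := exists_vertexOf_eq x
  refine (Set.finite_range (neighbour g)).subset fun y hy => ?_
  obtain ⟨p, -, rfl⟩ := adj_iff_exists_neighbour.mp hy
  exact ⟨p, rfl⟩

end Stabilizers

end Building
end

/-! ### Adjacency operators and orbit weights in coordinates -/

noncomputable section

namespace Building

/-! ### The adjacency operators as sums over neighbours -/

section AdjOp

variable {k : Type*} [Field k]

theorem orbitWeight_toQ (x : Vertex k) :
    orbitWeight (toQ x) = (Nat.card (MulAction.stabilizer (Gam k) x) : ℝ)⁻¹ := rfl

theorem orbitWeight_toQPair (x y : Vertex k) : orbitWeight (toQPair x y) =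
    (Nat.card (MulAction.stabilizer (Gam k) (x, y)) : ℝ)⁻¹ := rfl

theorem toQPair_eq_iff {x y x' y' : Vertex k} : toQPair x y = toQPair x' y' ↔
    ∃ γ : Gam k, γ • x' = x ∧ γ • y' = y := by
  rw [toQPair, toQPair, Quotient.eq'', MulAction.orbitRel_apply, MulAction.mem_orbit_iff]
  exact ⟨fun ⟨γ, h⟩ => ⟨γ, congrArg Prod.fst h, congrArg Prod.snd h⟩,
    fun ⟨γ, h1, h2⟩ => ⟨γ, Prod.ext h1 h2⟩⟩

theorem stabilizer_swap (x y : Vertex k) :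
    MulAction.stabilizer (Gam k) (x, y) = MulAction.stabilizer (Gam k) (y, x) := by
  ext γ
  exact ⟨fun h => Prod.ext (congrArg Prod.snd h) (congrArg Prod.fst h),
    fun h => Prod.ext (congrArg Prod.snd h) (congrArg Prod.fst h)⟩

theorem gam_smul_adj_color (γ : Gam k) {x y : Vertex k} {i : ZMod 4} (h : Adj x y)
    (hc : color y = color x + i) : Adj (γ • x) (γ • y) ∧ color (γ • y) = color (γ • x) + i := by
  refine ⟨h.smul γ.1, ?_⟩
  change color (γ.1 • y) = color (γ.1 • x) + i
  rw [color_smul, color_smul, hc, add_assoc]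

theorem edgesFrom_toQ (i : ZMod 4) (x : Vertex k) : edgesFrom i (toQ x) =
    toQPair x '' {y | Adj x y ∧ color y = color x + i} := by
  ext e
  constructor
  · rintro ⟨x', y', h, hc, hx, rfl⟩
    obtain ⟨γ, rfl⟩ := toQ_eq_toQ_iff.mp hx
    have h' := gam_smul_adj_color γ⁻¹ h hc
    rw [inv_smul_smul] at h'
    exact ⟨γ⁻¹ • y', h', toQPair_eq_iff.mpr ⟨γ⁻¹, inv_smul_smul _ _, rfl⟩⟩
  · rintro ⟨y, ⟨h, hc⟩, rfl⟩
    exact ⟨x, y, h, hc, rfl, rfl⟩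

/-- The orbit of `y` under the stabilizer of `x`. -/
theorem card_orbit_mul (x y : Vertex k) :
    Nat.card (MulAction.stabilizer (Gam k) (x, y)) *
      {y' | toQPair x y' = toQPair x y}.ncard = Nat.card (MulAction.stabilizer (Gam k) x) := by
  have h1 : {y' | toQPair x y' = toQPair x y} =
      MulAction.orbit (MulAction.stabilizer (Gam k) x) y := by
    ext y'
    rw [Set.mem_ofPred_eq, toQPair_eq_iff, MulAction.mem_orbit_iff]
    exact ⟨fun ⟨γ, h1, h2⟩ => ⟨⟨γ, h1⟩, h2⟩, fun ⟨γ, h⟩ => ⟨γ.1, γ.2, h⟩⟩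
  have h2 : Nat.card (MulAction.stabilizer (Gam k) (x, y)) =
      Nat.card (MulAction.stabilizer (MulAction.stabilizer (Gam k) x) y) := by
    refine Nat.card_congr
      { toFun := fun γ => ⟨⟨γ.1, congrArg Prod.fst γ.2⟩, congrArg Prod.snd γ.2⟩
        invFun := fun γ => ⟨γ.1.1, Prod.ext γ.1.2 γ.2⟩
        left_inv := fun _ => rfl
        right_inv := fun _ => rfl }
  rw [h1, h2, ← MulAction.index_stabilizer, Subgroup.card_mul_index]

/-- The edges between two vertices of the quotient. -/
def edgesBetween (i : ZMod 4) (u v : QVertex k) : Set (QPair k) :=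
  {e | ∃ x y : Vertex k, Adj x y ∧ color y = color x + i ∧ toQ x = u ∧ toQ y = v ∧
    toQPair x y = e}

/-- The reversal of an edge of the quotient. -/
def swapPair (e : QPair k) : QPair k :=
  Quotient.liftOn' e (fun p => toQPair p.2 p.1) (by
    rintro ⟨a, b⟩ ⟨c, d⟩ ⟨γ, hγ⟩
    exact toQPair_eq_iff.mpr ⟨γ, congrArg Prod.snd hγ, congrArg Prod.fst hγ⟩)

theorem orbitWeight_swapPair (e : QPair k) : orbitWeight (swapPair e) = orbitWeight e := by
  obtain ⟨⟨x, y⟩, rfl⟩ := Quotient.exists_rep e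
  change orbitWeight (toQPair y x) = orbitWeight (toQPair x y)
  rw [orbitWeight_toQPair, orbitWeight_toQPair, stabilizer_swap]

theorem swapPair_mem {i : ZMod 4} {u v : QVertex k} {e : QPair k} (he : e ∈ edgesBetween i u v) :
    swapPair e ∈ edgesBetween (-i) v u := by
  obtain ⟨x, y, h, hc, hx, hy, rfl⟩ := he
  exact ⟨y, x, h.symm, by rw [hc, add_neg_cancel_right], hy, hx, rfl⟩

theorem swapPair_swapPair (e : QPair k) : swapPair (swapPair e) = e := by
  obtain ⟨⟨x, y⟩, rfl⟩ := Quotient.exists_rep e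
  rfl

theorem finsum_edgesBetween_swap (i : ZMod 4) (u v : QVertex k) :
    ∑ᶠ e ∈ edgesBetween i u v, orbitWeight e = ∑ᶠ e ∈ edgesBetween (-i) v u, orbitWeight e := by
  refine finsum_mem_eq_of_bijOn swapPair ⟨fun e he => swapPair_mem he, ?_, ?_⟩
    fun e _ => (orbitWeight_swapPair e).symm
  · intro e _ e' _ h
    rw [← swapPair_swapPair e, h, swapPair_swapPair]
  · intro e he
    refine ⟨swapPair e, ?_, swapPair_swapPair e⟩
    have := swapPair_mem he
    rwa [neg_neg] at this

variable [Finite k]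

theorem orbitWeight_pos (u : QVertex k) : 0 < orbitWeight u := by
  obtain ⟨x, rfl⟩ := exists_toQ_eq u
  have := finite_stabilizer x
  rw [orbitWeight_toQ]
  exact inv_pos.mpr (Nat.cast_pos.mpr Nat.card_pos)

open scoped Classical in
/-- The neighbours of a vertex whose color differs by `i`. -/
def nbrs (i : ZMod 4) (x : Vertex k) : Finset (Vertex k) :=
  (finite_adj x).toFinset.filter fun y => color y = color x + i

theorem mem_nbrs {i : ZMod 4} {x y : Vertex k} :
    y ∈ nbrs i x ↔ Adj x y ∧ color y = color x + i := by
  simp [nbrs]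

theorem finite_edgesFrom (i : ZMod 4) (u : QVertex k) : (edgesFrom i u).Finite := by
  obtain ⟨x, rfl⟩ := exists_toQ_eq u
  rw [edgesFrom_toQ]
  exact ((finite_adj x).subset fun y hy => hy.1).image _

/-- The ratio of weights of an edge and its origin is the index of the stabilizer of the edge in
that of the origin, i.e. the number of neighbours of `x` that give the same edge of the quotient. -/
theorem adjOp_toQ (i : ZMod 4) (f : QVertex k → ℂ) (x : Vertex k) :
    adjOp i f (toQ x) = ∑ y ∈ nbrs i x, f (toQ y) := by
  classical
  have h : edgesFrom i (toQ x) = ↑((nbrs i x).image (toQPair x)) := by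
    rw [edgesFrom_toQ, Finset.coe_image]
    congr 1
    ext y
    rw [Finset.mem_coe, mem_nbrs, Set.mem_ofPred_eq]
  rw [adjOp, h, finsum_mem_coe_finset]
  refine Finset.sum_image' _ fun y hy => ?_
  have hfib : {y' | toQPair x y' = toQPair x y} =
      ↑((nbrs i x).filter fun y' => toQPair x y' = toQPair x y) := by
    ext y'
    rw [Finset.mem_coe, Finset.mem_filter, Set.mem_ofPred_eq, iff_and_self, mem_nbrs]
    intro hy'
    obtain ⟨γ, h1, h2⟩ := toQPair_eq_iff.mp hy'
    have := gam_smul_adj_color γ (mem_nbrs.mp hy).1 (mem_nbrs.mp hy).2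
    rwa [h1, h2] at this
  have hconst : ∀ y' ∈ (nbrs i x).filter (fun y' => toQPair x y' = toQPair x y),
      f (toQ y') = f (target (toQPair x y)) := by
    intro y' hy'
    rw [← (Finset.mem_filter.mp hy').2]
    rfl
  rw [Finset.sum_congr rfl hconst, Finset.sum_const, nsmul_eq_mul]
  congr 1
  have hcard := card_orbit_mul x y
  rw [hfib, Set.ncard_coe_finset] at hcard
  have := finite_stabilizer x
  have hpos : Nat.card (MulAction.stabilizer (Gam k) x) ≠ 0 := Nat.card_pos.ne'
  rw [← hcard, mul_ne_zero_iff] at hpos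
  rw [orbitWeight_toQ, orbitWeight_toQPair, ← hcard]
  have h1 : ((Nat.card (MulAction.stabilizer (Gam k) (x, y)) : ℕ) : ℂ) ≠ 0 :=
    Nat.cast_ne_zero.mpr hpos.1
  push_cast
  field_simp

open scoped Classical in
/-- The number of neighbours of `x` in the orbit `v`, with color of `x` plus `i`. -/
def nbrCount (i : ZMod 4) (x : Vertex k) (v : QVertex k) : ℕ :=
  ((nbrs i x).filter fun y => toQ y = v).card

open scoped Classical in
theorem adjOp_single (i : ZMod 4) (x : Vertex k) (v : QVertex k) :
    adjOp i (Pi.single v 1) (toQ x) = nbrCount i x v := by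
  rw [adjOp_toQ, nbrCount, Finset.card_filter, Nat.cast_sum]
  refine Finset.sum_congr rfl fun y _ => ?_
  rw [Pi.single_apply, Nat.cast_ite, Nat.cast_one, Nat.cast_zero]

/-- The operator is applied to the indicator of `v`. The right side is invariant under reversal of
edges, and this gives `balance`. -/
theorem orbitWeight_mul_nbrCount (i : ZMod 4) (x : Vertex k) (v : QVertex k) :
    orbitWeight (toQ x) * nbrCount i x v = ∑ᶠ e ∈ edgesBetween i (toQ x) v, orbitWeight e := by
  classical
  have h := adjOp_single i x v
  have hfin := finite_edgesFrom i (toQ x)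
  have hw : ((orbitWeight (toQ x) : ℝ) : ℂ) ≠ 0 := Complex.ofReal_ne_zero.mpr (orbitWeight_pos _).ne'
  have hset : edgesBetween i (toQ x) v = edgesFrom i (toQ x) ∩ {e | target e = v} := by
    ext e
    constructor
    · rintro ⟨x', y', h, hc, hx, hy, rfl⟩
      exact ⟨⟨x', y', h, hc, hx, rfl⟩, hy⟩
    · rintro ⟨⟨x', y', h, hc, hx, rfl⟩, hy⟩
      exact ⟨x', y', h, hc, hx, hy, rfl⟩
  apply Complex.ofReal_injective
  rw [adjOp, finsum_mem_eq_finite_toFinset_sum _ hfin] at h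
  rw [Complex.ofReal_mul, Complex.ofReal_natCast, ← h, Finset.mul_sum, hset,
    finsum_mem_eq_finite_toFinset_sum _ (hfin.subset Set.inter_subset_left), Complex.ofReal_sum]
  symm
  refine Finset.sum_subset_zero_on_sdiff (fun e he => ?_) (fun e he => ?_) (fun e he => ?_)
  · rw [Set.Finite.mem_toFinset] at he ⊢
    exact he.1
  · rw [Finset.mem_sdiff, Set.Finite.mem_toFinset, Set.Finite.mem_toFinset] at he
    have : target e ≠ v := fun h => he.2 ⟨he.1, h⟩
    rw [Pi.single_apply, if_neg this, mul_zero, mul_zero]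
  · rw [Set.Finite.mem_toFinset] at he
    rw [Pi.single_apply, if_pos (show target e = v from he.2), mul_one, Complex.ofReal_div, mul_div_cancel₀ _ hw]

/-- The balance of the weights along the edges between two orbits. -/
theorem balance (i : ZMod 4) (x y : Vertex k) : orbitWeight (toQ x) * nbrCount i x (toQ y) =
    orbitWeight (toQ y) * nbrCount (-i) y (toQ x) := by
  rw [orbitWeight_mul_nbrCount, orbitWeight_mul_nbrCount, finsum_edgesBetween_swap]

end AdjOp

/-! ### The adjacency operators in coordinates -/

section Coordinates

variable {k : Type*} [Field k]

theorem diagQ_coordTuple_add (a b c : ℤ) (ν : Fin 4 → ℤ) : diagQ k (coordTuple (a, b, c) + ν) =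
    coordQ k (a + (ν 0 - ν 1), b + (ν 1 - ν 2), c + (ν 2 - ν 3)) := by
  rw [diagQ_eq_coordQ]
  congr 1
  refine Prod.ext ?_ (Prod.ext ?_ ?_) <;> simp [diffs, coordTuple] <;> ring

variable [Fintype k]

/-- The number of inversions of a subset, i.e. the dimension of its Schubert cell. -/
def invNumber (J : Finset (Fin 4)) : ℕ :=
  (Finset.univ.filter fun p : Fin 4 × Fin 4 => p.1 ∈ J ∧ p.2 ∉ J ∧ p.2 < p.1).card

/-- A bound for the number of neighbours of a vertex. -/
def nbrBound (k : Type*) [Fintype k] : ℕ := Fintype.card (Σ J : Finset (Fin 4), Cell k J)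

theorem card_nbrs_le (i : ZMod 4) (x : Vertex k) : (nbrs i x).card ≤ nbrBound k := by
  classical
  obtain ⟨g, rfl⟩ := exists_vertexOf_eq x
  have h : nbrs i (vertexOf g) ⊆ Finset.univ.image (neighbour g) := by
    intro y hy
    obtain ⟨p, -, rfl⟩ := adj_iff_exists_neighbour.mp (mem_nbrs.mp hy).1
    exact Finset.mem_image_of_mem _ (Finset.mem_univ p)
  exact (Finset.card_le_card h).trans Finset.card_image_le

theorem nbrCount_le (i : ZMod 4) (x : Vertex k) (v : QVertex k) :
    nbrCount i x v ≤ nbrBound k := by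
  classical
  exact (Finset.card_filter_le _ _).trans (card_nbrs_le i x)

/-- The neighbours of the given color are the points of the Schubert cells of `i`-element sets, and
each cell falls into a single orbit by `neighbour_diagX`. -/
theorem adjOp_diagQ {ν : Fin 4 → ℤ} (hν : Antitone ν) {i : ℕ} (h0 : 0 < i) (h4 : i < 4)
    (f : QVertex k → ℂ) : adjOp (i : ZMod 4) f (diagQ k ν) =
      ∑ J ∈ Finset.powersetCard i Finset.univ,
        (Fintype.card k : ℂ) ^ invNumber J * f (diagQ k (ν + indVec J)) := by
  classical
  let P : Finset (Σ J : Finset (Fin 4), Cell k J) :=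
    (Finset.powersetCard i Finset.univ).sigma fun J => Finset.univ
  have hmem : ∀ p, p ∈ P ↔ p.1.card = i := by
    intro p
    simp [P, Finset.mem_powersetCard]
  have hne : ∀ J : Finset (Fin 4), J.card = i → J ≠ ∅ ∧ J ≠ Finset.univ := by
    rintro J hJ
    constructor
    · rintro rfl
      simp at hJ
      omega
    · rintro rfl
      simp at hJ
      omega
  have hcast : ∀ J : Finset (Fin 4), J ≠ ∅ → J ≠ Finset.univ → ((J.card : ZMod 4) = i ↔ J.card = i) := by
    intro J h1 h2
    have := card_pos_of_ne h1 h2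
    rw [ZMod.natCast_eq_natCast_iff, Nat.ModEq, Nat.mod_eq_of_lt h4, Nat.mod_eq_of_lt this.2]
  have himage : nbrs (i : ZMod 4) (vertexOf (diagX ν : GL (Fin 4) k⸨X⸩)) =
      P.image (neighbour (diagX ν)) := by
    ext y
    rw [mem_nbrs, Finset.mem_image, adj_iff_exists_neighbour]
    constructor
    · rintro ⟨⟨p, ⟨h1, h2⟩, rfl⟩, hc⟩
      rw [color_neighbour, add_right_inj, hcast _ h1 h2] at hc
      exact ⟨p, (hmem p).mpr hc, rfl⟩
    · rintro ⟨p, hp, rfl⟩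
      rw [hmem] at hp
      exact ⟨⟨p, hne _ hp, rfl⟩, by rw [color_neighbour, hp]⟩
  rw [diagQ, adjOp_toQ, himage, Finset.sum_image fun p hp p' hp' h =>
    neighbour_injOn (diagX ν) (hne _ ((hmem p).mp hp)) (hne _ ((hmem p').mp hp')) h]
  rw [Finset.sum_sigma]
  refine Finset.sum_congr rfl fun J _ => ?_
  have hterm : ∀ c : Cell k J,
      f (toQ (neighbour (diagX ν) ⟨J, c⟩)) = f (diagQ k (ν + indVec J)) :=
    fun c => congrArg f (neighbour_diagX hν ⟨J, c⟩)
  rw [Finset.sum_congr rfl fun c _ => hterm c, Finset.sum_const, Finset.card_univ, card_cell,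
    nsmul_eq_mul, Nat.cast_pow]
  rfl

theorem adjOp_one_coordQ (f : QVertex k → ℂ) {a b c : ℤ} (h : ((a, b, c) : Coweight) ∈ cone) :
    adjOp 1 f (coordQ k (a, b, c)) = f (coordQ k (a + 1, b, c)) +
      (Fintype.card k : ℂ) * f (coordQ k (a - 1, b + 1, c)) +
      (Fintype.card k : ℂ) ^ 2 * f (coordQ k (a, b - 1, c + 1)) +
      (Fintype.card k : ℂ) ^ 3 * f (coordQ k (a, b, c - 1)) := by
  have e : Finset.powersetCard 1 (Finset.univ : Finset (Fin 4)) = {{0}, {1}, {2}, {3}} := by decide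
  have i0 : invNumber {0} = 0 := by decide
  have i1 : invNumber {1} = 1 := by decide
  have i2 : invNumber {2} = 2 := by decide
  have i3 : invNumber {3} = 3 := by decide
  have := adjOp_diagQ (antitone_coordTuple h) one_pos (by norm_num) f
  rw [Nat.cast_one] at this
  rw [coordQ, this, e, Finset.sum_insert (by decide), Finset.sum_insert (by decide),
    Finset.sum_insert (by decide), Finset.sum_singleton, i0, i1, i2, i3, diagQ_coordTuple_add,
    diagQ_coordTuple_add, diagQ_coordTuple_add, diagQ_coordTuple_add, pow_zero, one_mul, pow_one, ← add_assoc,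
    ← add_assoc]
  simp [indVec, sub_eq_add_neg]

theorem adjOp_two_coordQ (f : QVertex k → ℂ) {a b c : ℤ} (h : ((a, b, c) : Coweight) ∈ cone) :
    adjOp 2 f (coordQ k (a, b, c)) = f (coordQ k (a, b + 1, c)) +
      (Fintype.card k : ℂ) * f (coordQ k (a + 1, b - 1, c + 1)) +
      (Fintype.card k : ℂ) ^ 2 * f (coordQ k (a + 1, b, c - 1)) +
      (Fintype.card k : ℂ) ^ 2 * f (coordQ k (a - 1, b, c + 1)) +
      (Fintype.card k : ℂ) ^ 3 * f (coordQ k (a - 1, b + 1, c - 1)) +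
      (Fintype.card k : ℂ) ^ 4 * f (coordQ k (a, b - 1, c)) := by
  have e : Finset.powersetCard 2 (Finset.univ : Finset (Fin 4)) =
    {{0, 1}, {0, 2}, {0, 3}, {1, 2}, {1, 3}, {2, 3}} := by decide
  have i0 : invNumber {0, 1} = 0 := by decide
  have i1 : invNumber {0, 2} = 1 := by decide
  have i2 : invNumber {0, 3} = 2 := by decide
  have i3 : invNumber {1, 2} = 2 := by decide
  have i4 : invNumber {1, 3} = 3 := by decide
  have i5 : invNumber {2, 3} = 4 := by decide
  have := adjOp_diagQ (antitone_coordTuple h) two_pos (by norm_num) f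
  rw [Nat.cast_two] at this
  rw [coordQ, this, e, Finset.sum_insert (by decide), Finset.sum_insert (by decide),
    Finset.sum_insert (by decide), Finset.sum_insert (by decide), Finset.sum_insert (by decide),
    Finset.sum_singleton, i0, i1, i2, i3, i4, i5, diagQ_coordTuple_add, diagQ_coordTuple_add,
    diagQ_coordTuple_add, diagQ_coordTuple_add, diagQ_coordTuple_add, diagQ_coordTuple_add, pow_zero, one_mul, pow_one,
    ← add_assoc, ← add_assoc, ← add_assoc, ← add_assoc]
  simp [indVec, sub_eq_add_neg]

theorem adjOp_three_coordQ (f : QVertex k → ℂ) {a b c : ℤ} (h : ((a, b, c) : Coweight) ∈ cone) :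
    adjOp 3 f (coordQ k (a, b, c)) = f (coordQ k (a, b, c + 1)) +
      (Fintype.card k : ℂ) * f (coordQ k (a, b + 1, c - 1)) +
      (Fintype.card k : ℂ) ^ 2 * f (coordQ k (a + 1, b - 1, c)) +
      (Fintype.card k : ℂ) ^ 3 * f (coordQ k (a - 1, b, c)) := by
  have e : Finset.powersetCard 3 (Finset.univ : Finset (Fin 4)) =
    {{0, 1, 2}, {0, 1, 3}, {0, 2, 3}, {1, 2, 3}} := by decide
  have i0 : invNumber {0, 1, 2} = 0 := by decide
  have i1 : invNumber {0, 1, 3} = 1 := by decide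
  have i2 : invNumber {0, 2, 3} = 2 := by decide
  have i3 : invNumber {1, 2, 3} = 3 := by decide
  have := adjOp_diagQ (antitone_coordTuple h) three_pos (by norm_num) f
  rw [Nat.cast_three] at this
  rw [coordQ, this, e, Finset.sum_insert (by decide), Finset.sum_insert (by decide),
    Finset.sum_insert (by decide), Finset.sum_singleton, i0, i1, i2, i3, diagQ_coordTuple_add,
    diagQ_coordTuple_add, diagQ_coordTuple_add, diagQ_coordTuple_add, pow_zero, one_mul, pow_one, ← add_assoc,
    ← add_assoc]
  simp [indVec, sub_eq_add_neg]

end Coordinates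

end Building
end

/-! ### How the orbit weight changes along the cone -/

noncomputable section

namespace Building

/-! ### The weights of the vertices of the quotient -/

section QuadraticForm

variable {k : Type*} [Field k]

/-- The norm of a coweight, scaled to be integral. -/
def coweightForm (μ : Coweight) : ℤ :=
  3 * μ.1 ^ 2 + 4 * μ.2.1 ^ 2 + 3 * μ.2.2 ^ 2 + 4 * μ.1 * μ.2.1 + 2 * μ.1 * μ.2.2 +
    4 * μ.2.1 * μ.2.2

theorem coweightForm_eq (μ : Coweight) : coweightForm μ =
    4 * ∑ j, coordTuple μ j ^ 2 - (∑ j, coordTuple μ j) ^ 2 := by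
  simp [coweightForm, Fin.sum_univ_four, coordTuple]
  ring

/-- The form is four times the sum of squares minus the square of the sum, unchanged by permutations
and by constant shifts. It is a cheap test that two orbits differ. -/
theorem coweightForm_eq_of_coordQ_eq {μ μ' : Coweight} (h : coordQ k μ = coordQ k μ') :
    coweightForm μ = coweightForm μ' := by
  obtain ⟨σ, n, hσ⟩ := exists_perm_of_diagQ_eq h
  have h1 : ∑ j, coordTuple μ j = ∑ j, (coordTuple μ' j + n) :=
    (Equiv.sum_comp σ (coordTuple μ)).symm.trans (congrArg (fun f => ∑ j, f j) hσ)
  have h2 : ∑ j, coordTuple μ j ^ 2 = ∑ j, (coordTuple μ' j + n) ^ 2 :=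
    (Equiv.sum_comp σ fun j => coordTuple μ j ^ 2).symm.trans
      (congrArg (fun f => ∑ j, f j ^ 2) hσ)
  rw [coweightForm_eq, coweightForm_eq, h1, h2]
  simp only [Fin.sum_univ_four]
  ring

open scoped Classical in
theorem single_coordQ_of_ne {μ μ' : Coweight} (h : coweightForm μ' ≠ coweightForm μ) :
    (Pi.single (coordQ k μ) 1 : QVertex k → ℂ) (coordQ k μ') = 0 :=
  Pi.single_eq_of_ne (fun h' => h (coweightForm_eq_of_coordQ_eq h')) 1

end QuadraticForm

section Weights

variable {k : Type*} [Field k]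

/-- A vertex with given coordinates. -/
def coordVertex (k : Type*) [Field k] (μ : Coweight) : Vertex k := vertexOf (diagX (coordTuple μ))

theorem toQ_coordVertex (μ : Coweight) : toQ (coordVertex k μ) = coordQ k μ := rfl

/-- Geometrically the rotation leads to an adjacent orbit: the last exponent grows by 1 and a cyclic
permutation follows. -/
theorem coordQ_rot (μ : Coweight) :
    coordQ k (rot μ) = diagQ k (coordTuple μ + indVec {3}) := by
  obtain ⟨a, b, c⟩ := μ
  rw [← diagQ_comp_perm _ (finRotate 4)⁻¹, diagQ_eq_coordQ]
  have e0 : (finRotate 4)⁻¹ (0 : Fin 4) = 3 := by decide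
  have e1 : (finRotate 4)⁻¹ (1 : Fin 4) = 0 := by decide
  have e2 : (finRotate 4)⁻¹ (2 : Fin 4) = 1 := by decide
  have e3 : (finRotate 4)⁻¹ (3 : Fin 4) = 2 := by decide
  congr 1
  refine Prod.ext ?_ (Prod.ext ?_ ?_) <;>
    simp only [diffs, Function.comp_apply, e0, e1, e2, e3] <;>
    (simp [rot, coordTuple, indVec]; try ring)

variable [Fintype k]

theorem one_le_nbrCount {i : ZMod 4} {x y : Vertex k} (h : Adj x y) (hc : color y = color x + i) :
    1 ≤ nbrCount i x (toQ y) := by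
  classical
  exact Finset.card_pos.mpr ⟨y, Finset.mem_filter.mpr ⟨mem_nbrs.mpr ⟨h, hc⟩, rfl⟩⟩

theorem one_le_nbrCount_diagX (ν : Fin 4 → ℤ) {J : Finset (Fin 4)} (h1 : J ≠ ∅)
    (h2 : J ≠ Finset.univ) :
    1 ≤ nbrCount (J.card : ZMod 4) (vertexOf (diagX ν : GL (Fin 4) k⸨X⸩))
      (diagQ k (ν + indVec J)) := by
  refine one_le_nbrCount (adj_diagX ν h1 h2) ?_
  rw [diagX_add, color_vertexOf_mul, color_vertexOf (diagX (indVec J)), order_det_diagX, sum_indVec]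
  simp

/-- The color of the fundamental coweights. -/
def fundColor : Fin 3 → ZMod 4
  | 0 => 1
  | 1 => 2
  | 2 => 3

theorem one_le_nbrCount_addFund (i : Fin 3) (μ : Coweight) :
    1 ≤ nbrCount (fundColor i) (coordVertex k μ) (coordQ k (addFund i μ)) := by
  obtain ⟨a, b, c⟩ := μ
  fin_cases i
  · have := one_le_nbrCount_diagX (k := k) (coordTuple (a, b, c)) (J := {0}) (by decide) (by decide)
    rw [diagQ_coordTuple_add] at this
    simp [indVec] at this
    exact this
  · have := one_le_nbrCount_diagX (k := k) (coordTuple (a, b, c)) (J := {0, 1}) (by decide)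
      (by decide)
    rw [diagQ_coordTuple_add] at this
    simp [indVec] at this
    exact this
  · have := one_le_nbrCount_diagX (k := k) (coordTuple (a, b, c)) (J := {0, 1, 2}) (by decide)
      (by decide)
    rw [diagQ_coordTuple_add] at this
    simp [indVec] at this
    exact this

/-- For steps of one color, the differences of the form are multiples of differences of the sums of
exponents over the chosen sets. Off the wall the initial set is the unique maximum, so no other cell
leads to the same orbit, and its own cell is a point. -/
theorem nbrCount_addFund (i : Fin 3) {μ : Coweight} (hμ : μ ∈ cone) (h : rootCoord i μ ≠ 0) :
    nbrCount (fundColor i) (coordVertex k μ) (coordQ k (addFund i μ)) = 1 := by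
  classical
  obtain ⟨a, b, c⟩ := μ
  obtain ⟨ha, hb, hc⟩ := mem_cone.mp hμ
  rw [← Nat.cast_inj (R := ℂ), ← adjOp_single, toQ_coordVertex, Nat.cast_one]
  fin_cases i
  · have h' : 0 < a := lt_of_le_of_ne ha (Ne.symm h)
    refine (adjOp_one_coordQ _ hμ).trans ?_
    rw [single_coordQ_of_ne (μ' := (a - 1, b + 1, c)),
      single_coordQ_of_ne (μ' := (a, b - 1, c + 1)),
      single_coordQ_of_ne (μ' := (a, b, c - 1))]
    · simp [addFund]
    all_goals
      intro h
      simp only [coweightForm, addFund] at h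
      linarith
  · have h' : 0 < b := lt_of_le_of_ne hb (Ne.symm h)
    refine (adjOp_two_coordQ _ hμ).trans ?_
    rw [single_coordQ_of_ne (μ' := (a + 1, b - 1, c + 1)),
      single_coordQ_of_ne (μ' := (a + 1, b, c - 1)),
      single_coordQ_of_ne (μ' := (a - 1, b, c + 1)),
      single_coordQ_of_ne (μ' := (a - 1, b + 1, c - 1)),
      single_coordQ_of_ne (μ' := (a, b - 1, c))]
    · simp [addFund]
    all_goals
      intro h
      simp only [coweightForm, addFund] at h
      linarith
  · have h' : 0 < c := lt_of_le_of_ne hc (Ne.symm h)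
    refine (adjOp_three_coordQ _ hμ).trans ?_
    rw [single_coordQ_of_ne (μ' := (a, b + 1, c - 1)),
      single_coordQ_of_ne (μ' := (a + 1, b - 1, c)),
      single_coordQ_of_ne (μ' := (a - 1, b, c))]
    · simp [addFund]
    all_goals
      intro h
      simp only [coweightForm, addFund] at h
      linarith

/-- The way back is given only by the largest cell, of dimension `fundExp i`: for a coweight of the
form `addFund i μ` the final set strictly minimizes the form, whether or not `μ` lies on the wall.
-/
theorem nbrCount_neg_addFund (i : Fin 3) {μ : Coweight} (hμ : μ ∈ cone) :
    nbrCount (-fundColor i) (coordVertex k (addFund i μ)) (coordQ k μ) =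
      Fintype.card k ^ fundExp i := by
  classical
  obtain ⟨a, b, c⟩ := μ
  obtain ⟨ha, hb, hc⟩ := mem_cone.mp hμ
  rw [← Nat.cast_inj (R := ℂ), ← adjOp_single, toQ_coordVertex, Nat.cast_pow]
  fin_cases i
  · have h' : ((a + 1, b, c) : Coweight) ∈ cone := mem_cone.mpr ⟨by omega, hb, hc⟩
    refine (adjOp_three_coordQ _ h').trans ?_
    rw [single_coordQ_of_ne, single_coordQ_of_ne, single_coordQ_of_ne]
    · simp [fundExp]
    all_goals
      intro h
      simp only [coweightForm] at h
      linarith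
  · have h' : ((a, b + 1, c) : Coweight) ∈ cone := mem_cone.mpr ⟨ha, by omega, hc⟩
    refine (adjOp_two_coordQ _ h').trans ?_
    rw [single_coordQ_of_ne, single_coordQ_of_ne, single_coordQ_of_ne, single_coordQ_of_ne,
      single_coordQ_of_ne]
    · simp [fundExp]
    all_goals
      intro h
      simp only [coweightForm] at h
      linarith
  · have h' : ((a, b, c + 1) : Coweight) ∈ cone := mem_cone.mpr ⟨ha, hb, by omega⟩
    refine (adjOp_one_coordQ _ h').trans ?_
    rw [single_coordQ_of_ne, single_coordQ_of_ne, single_coordQ_of_ne]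
    · simp [fundExp]
    all_goals
      intro h
      simp only [coweightForm] at h
      linarith

/-- This is `balance` for the edges between the two orbits. The weight decays exactly by `q ^
fundExp i` off the wall, and on the wall up to the bounded number of forward neighbours. -/
theorem orbitWeight_addFund (i : Fin 3) {μ : Coweight} (hμ : μ ∈ cone) :
    (Fintype.card k : ℝ) ^ fundExp i * orbitWeight (coordQ k (addFund i μ)) =
      orbitWeight (coordQ k μ) *
        nbrCount (fundColor i) (coordVertex k μ) (coordQ k (addFund i μ)) := by
  have h := balance (fundColor i) (coordVertex k μ) (coordVertex k (addFund i μ))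
  rw [toQ_coordVertex, toQ_coordVertex, nbrCount_neg_addFund i hμ, Nat.cast_pow] at h
  rw [h, mul_comm]

/-- The two orbits are joined by an edge, so their weights are comparable up to the bound on the
number of neighbours. This makes the rotation operator bounded. -/
theorem orbitWeight_le_rot (μ : Coweight) :
    orbitWeight (coordQ k μ) ≤ nbrBound k * orbitWeight (coordQ k (rot μ)) := by
  have h := balance 1 (coordVertex k μ) (vertexOf (diagX (coordTuple μ + indVec {3})))
  have h1 := one_le_nbrCount_diagX (k := k) (coordTuple μ) (J := {3}) (by decide) (by decide)
  rw [Finset.card_singleton, Nat.cast_one] at h1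
  have e : toQ (vertexOf (diagX (coordTuple μ + indVec {3}) : GL (Fin 4) k⸨X⸩)) =
    coordQ k (rot μ) := (coordQ_rot μ).symm
  rw [← coordQ_rot] at h1
  rw [toQ_coordVertex, e] at h
  have h2 : (nbrCount (-1) (vertexOf (diagX (coordTuple μ + indVec {3}) : GL (Fin 4) k⸨X⸩))
      (coordQ k μ) : ℝ) ≤ nbrBound k := Nat.cast_le.mpr (nbrCount_le _ _ _)
  calc orbitWeight (coordQ k μ) ≤ _ :=
        le_mul_of_one_le_right (orbitWeight_pos _).le (Nat.one_le_cast.mpr h1)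
    _ = _ := h
    _ ≤ _ := by
      rw [mul_comm]
      exact mul_le_mul_of_nonneg_right h2 (orbitWeight_pos _).le

variable (k) in
theorem heckeWeight_orbitWeight :
    HeckeWeight (Fintype.card k) fun μ => ENNReal.ofReal (orbitWeight (coordQ k μ)) := by
  -- The constants of `HeckeWeight` enter squared, and this choice avoids a square root.
  have hB : ((nbrBound k : ℝ≥0∞)) ≤ ((nbrBound k + 1 : ℕ) : ℝ≥0∞) ^ 2 := by
    exact_mod_cast (by nlinarith : nbrBound k ≤ (nbrBound k + 1) ^ 2)
  have hmul : ∀ i μ, ENNReal.ofReal (Fintype.card k) ^ fundExp i *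
      ENNReal.ofReal (orbitWeight (coordQ k (addFund i μ))) =
      ENNReal.ofReal ((Fintype.card k : ℝ) ^ fundExp i * orbitWeight (coordQ k (addFund i μ))) := by
    intro i μ
    rw [ENNReal.ofReal_mul (by positivity), ENNReal.ofReal_pow (by positivity)]
  have hbound : ∀ {w w' : ℝ}, w ≤ nbrBound k * w' →
      ENNReal.ofReal w ≤ ((nbrBound k + 1 : ℕ) : ℝ≥0∞) ^ 2 * ENNReal.ofReal w' := by
    intro w w' h
    refine (ENNReal.ofReal_le_ofReal h).trans ?_
    rw [ENNReal.ofReal_mul (by positivity), ENNReal.ofReal_natCast]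
    gcongr
  refine ⟨fun i ν => by simp only [coordQ_refl], ⟨_, ENNReal.natCast_ne_top _, fun ν =>
    hbound (orbitWeight_le_rot ν)⟩, fun i ν hν => ?_, fun i ν hν h => ?_,
    ⟨((nbrBound k + 1 : ℕ) : ℝ≥0∞), ENNReal.natCast_ne_top _, fun i ν hν => ?_⟩⟩
  · rw [hmul, orbitWeight_addFund i hν]
    exact ENNReal.ofReal_le_ofReal (le_mul_of_one_le_right (orbitWeight_pos _).le
      (Nat.one_le_cast.mpr (one_le_nbrCount_addFund i ν)))
  · rw [hmul, orbitWeight_addFund i hν, nbrCount_addFund i hν h, Nat.cast_one, mul_one]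
  · rw [hmul, orbitWeight_addFund i hν]
    refine hbound ?_
    rw [mul_comm]
    exact mul_le_mul_of_nonneg_right (Nat.cast_le.mpr (nbrCount_le _ _ _)) (orbitWeight_pos _).le

end Weights

end Building
end

noncomputable section

namespace Building

/-! ### The adjacency operators and the scalar product -/

section Adjoint

open scoped ComplexConjugate

variable {k : Type*} [Field k]

theorem tsum_ne_top_of_wNorm {f : QVertex k → ℂ} (hf : wNorm f ≠ ∞) :
    ∑' u : QVertex k, ‖f u‖ₑ ^ 2 * ENNReal.ofReal (orbitWeight u) ≠ ∞ := by
  intro h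
  rw [wNorm, h, ENNReal.top_rpow_of_pos (by norm_num)] at hf
  exact hf rfl

theorem toQ_out (u : QVertex k) : toQ u.out = u := Quotient.out_eq' u

variable [Fintype k]

theorem toReal_enorm_sq_mul (f : QVertex k → ℂ) (u : QVertex k) :
    (‖f u‖ₑ ^ 2 * ENNReal.ofReal (orbitWeight u)).toReal = orbitWeight u * ‖f u‖ ^ 2 := by
  rw [ENNReal.toReal_mul, ENNReal.toReal_pow, toReal_enorm,
    ENNReal.toReal_ofReal (orbitWeight_pos u).le, mul_comm]

theorem summable_orbitWeight_mul {f : QVertex k → ℂ} (hf : wNorm f ≠ ∞) :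
    Summable fun u => orbitWeight u * ‖f u‖ ^ 2 := by
  refine (ENNReal.summable_toReal (tsum_ne_top_of_wNorm hf)).congr fun u => ?_
  rw [toReal_enorm_sq_mul]

theorem toReal_wNorm_sq (f : QVertex k → ℂ) :
    (wNorm f).toReal ^ 2 = ∑' u, orbitWeight u * ‖f u‖ ^ 2 := by
  rw [wNorm, ← ENNReal.toReal_pow, ← ENNReal.rpow_natCast, ← ENNReal.rpow_mul]
  norm_num
  rw [ENNReal.tsum_toReal_eq fun u => ENNReal.mul_ne_top (by simp) ENNReal.ofReal_ne_top]
  exact tsum_congr fun u => toReal_enorm_sq_mul f u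

theorem norm_sqrt_mul_sq (f : QVertex k → ℂ) (u : QVertex k) :
    ‖((√(orbitWeight u) : ℝ) : ℂ) * f u‖ ^ 2 = orbitWeight u * ‖f u‖ ^ 2 := by
  rw [norm_mul, Complex.norm_real, mul_pow, Real.norm_eq_abs, sq_abs,
    Real.sq_sqrt (orbitWeight_pos u).le]

/-- A function of finite norm as a vector of the standard Hilbert space. -/
def l2Vec (f : QVertex k → ℂ) (hf : wNorm f ≠ ∞) : lp (fun _ : QVertex k => ℂ) 2 :=
  ⟨fun u => ((√(orbitWeight u) : ℝ) : ℂ) * f u, memℓp_gen (by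
    refine (summable_orbitWeight_mul hf).congr fun u => ?_
    rw [← norm_sqrt_mul_sq]
    norm_num)⟩

theorem norm_l2Vec (f : QVertex k → ℂ) (hf : wNorm f ≠ ∞) : ‖l2Vec f hf‖ = (wNorm f).toReal := by
  have h := lp.norm_rpow_eq_tsum (p := 2) (by norm_num) (l2Vec f hf)
  simp only [ENNReal.toReal_ofNat, Real.rpow_ofNat] at h
  refine (sq_eq_sq₀ (norm_nonneg _) ENNReal.toReal_nonneg).mp ?_
  rw [h, toReal_wNorm_sq]
  exact tsum_congr fun u => norm_sqrt_mul_sq f u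

theorem hasSum_inner_l2Vec (f g : QVertex k → ℂ) (hf : wNorm f ≠ ∞) (hg : wNorm g ≠ ∞) :
    HasSum (fun u => (orbitWeight u : ℂ) * (conj (f u) * g u))
      (inner ℂ (l2Vec f hf) (l2Vec g hg)) := by
  refine (lp.hasSum_inner (l2Vec f hf) (l2Vec g hg)).congr_fun fun u => ?_
  change _ = inner ℂ (((√(orbitWeight u) : ℝ) : ℂ) * f u) (((√(orbitWeight u) : ℝ) : ℂ) * g u)
  have h : (orbitWeight u : ℂ) = ((√(orbitWeight u) : ℝ) : ℂ) * ((√(orbitWeight u) : ℝ) : ℂ) := by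
    rw [← Complex.ofReal_mul, Real.mul_self_sqrt (orbitWeight_pos u).le]
  rw [RCLike.inner_apply, map_mul, Complex.conj_ofReal, h]
  ring

/-- The kernel of an adjacency operator. -/
def adjKernel (i : ZMod 4) (u v : QVertex k) : ℝ := orbitWeight u * nbrCount i u.out v

theorem adjKernel_nonneg (i : ZMod 4) (u v : QVertex k) : 0 ≤ adjKernel i u v :=
  mul_nonneg (orbitWeight_pos u).le (Nat.cast_nonneg _)

theorem adjKernel_symm (i : ZMod 4) (u v : QVertex k) : adjKernel i u v = adjKernel (-i) v u := by
  have := balance i u.out v.out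
  rwa [toQ_out, toQ_out] at this

theorem hasSum_nbrCount {E : Type*} [NormedRing E] (i : ZMod 4) (x : Vertex k)
    (g : QVertex k → E) :
    HasSum (fun v => (nbrCount i x v : E) * g v) (∑ y ∈ nbrs i x, g (toQ y)) := by
  classical
  have h : (fun v => (nbrCount i x v : E) * g v) =
      fun v => ∑ y ∈ nbrs i x, if v = toQ y then g (toQ y) else 0 := by
    funext v
    rw [nbrCount, Finset.card_filter, Nat.cast_sum, Finset.sum_mul]
    refine Finset.sum_congr rfl fun y _ => ?_
    by_cases h : toQ y = v
    · rw [if_pos h, if_pos h.symm, h, Nat.cast_one, one_mul]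
    · rw [if_neg h, if_neg (Ne.symm h), Nat.cast_zero, zero_mul]
  rw [h]
  exact hasSum_sum fun y _ => hasSum_ite_eq (toQ y) (g (toQ y))

theorem hasSum_adjKernel (i : ZMod 4) (u : QVertex k) (g : QVertex k → ℂ) :
    HasSum (fun v => (adjKernel i u v : ℂ) * g v) (orbitWeight u * adjOp i g u) := by
  have h := (hasSum_nbrCount i u.out g).mul_left (orbitWeight u : ℂ)
  rw [← adjOp_toQ, toQ_out] at h
  refine h.congr_fun fun v => ?_
  rw [adjKernel, Complex.ofReal_mul, Complex.ofReal_natCast, mul_assoc]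

/-- The rows of the kernel have total mass at most `nbrBound k` times the weight of the vertex. -/
theorem summable_adjKernel_fst {g : QVertex k → ℝ} (i : ZMod 4) (hg0 : ∀ u, 0 ≤ g u)
    (hg : Summable fun u => orbitWeight u * g u) :
    Summable fun p : QVertex k × QVertex k => adjKernel i p.1 p.2 * g p.1 := by
  have hrow : ∀ u, HasSum (fun v => adjKernel i u v * g u)
      (orbitWeight u * (nbrs i u.out).card * g u) := by
    intro u
    have h := ((hasSum_nbrCount i u.out fun _ => (1 : ℝ)).mul_left (orbitWeight u)).mul_right (g u)
    simpa [adjKernel] using h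
  rw [summable_prod_of_nonneg fun p => mul_nonneg (adjKernel_nonneg i _ _) (hg0 _)]
  refine ⟨fun u => (hrow u).summable, ?_⟩
  refine Summable.of_nonneg_of_le (fun u => tsum_nonneg fun v =>
    mul_nonneg (adjKernel_nonneg i _ _) (hg0 _)) (fun u => ?_) (hg.mul_left (nbrBound k : ℝ))
  rw [(hrow u).tsum_eq, mul_comm (orbitWeight u), mul_assoc]
  exact mul_le_mul_of_nonneg_right (Nat.cast_le.mpr (card_nbrs_le i _))
    (mul_nonneg (orbitWeight_pos u).le (hg0 u))

/-- A Schur test: the product of two values is dominated by the sum of their squares, and the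
symmetry of the kernel handles the second square. -/
theorem summable_adjKernel {f : QVertex k → ℂ} (i : ZMod 4) (hf : wNorm f ≠ ∞) :
    Summable fun p : QVertex k × QVertex k => (adjKernel i p.1 p.2 : ℂ) * (conj (f p.1) * f p.2) := by
  have h := summable_orbitWeight_mul hf
  have h1 := summable_adjKernel_fst i (fun u => sq_nonneg ‖f u‖) h
  have h2 := (summable_adjKernel_fst (-i) (fun u => sq_nonneg ‖f u‖) h).prod_symm
  refine Summable.of_norm_bounded (h1.add h2) fun p => ?_
  rw [Prod.fst_swap, Prod.snd_swap, ← adjKernel_symm, norm_mul, norm_mul, Complex.norm_real,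
    Real.norm_of_nonneg (adjKernel_nonneg i _ _), RCLike.norm_conj, ← mul_add]
  refine mul_le_mul_of_nonneg_left ?_ (adjKernel_nonneg i _ _)
  have h3 := two_mul_le_add_sq ‖f p.1‖ ‖f p.2‖
  have h4 := mul_nonneg (norm_nonneg (f p.1)) (norm_nonneg (f p.2))
  linarith

theorem tsum_adjKernel (i : ZMod 4) (f : QVertex k → ℂ) (u : QVertex k) :
    ∑' v, (adjKernel i u v : ℂ) * (conj (f u) * f v) =
      (orbitWeight u : ℂ) * (conj (f u) * adjOp i f u) := by
  have h := (hasSum_adjKernel i u f).mul_left (conj (f u))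
  rw [mul_left_comm, ← h.tsum_eq]
  exact tsum_congr fun v => mul_left_comm _ _ _

/-- Adjointness of the operators of opposite colors, stated on the diagonal only, which suffices for
eigenvalues. The kernels are transposes of each other, and absolute summability allows the sums to
be exchanged. -/
theorem tsum_adjOp_conj {f : QVertex k → ℂ} (i : ZMod 4) (hf : wNorm f ≠ ∞) :
    ∑' u, (orbitWeight u : ℂ) * (conj (f u) * adjOp (-i) f u) =
      conj (∑' u, (orbitWeight u : ℂ) * (conj (f u) * adjOp i f u)) := by
  have hs : Summable (Function.uncurry fun u v => (adjKernel (-i) u v : ℂ) * (conj (f u) * f v)) :=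
    summable_adjKernel (-i) hf
  have hterm : ∀ u v, (adjKernel (-i) v u : ℂ) * (conj (f v) * f u) =
      conj ((adjKernel i u v : ℂ) * (conj (f u) * f v)) := by
    intro u v
    rw [map_mul, map_mul, Complex.conj_ofReal, Complex.conj_conj, adjKernel_symm i,
      mul_comm (f u)]
  calc _ = ∑' u, ∑' v, (adjKernel (-i) u v : ℂ) * (conj (f u) * f v) :=
        tsum_congr fun u => (tsum_adjKernel (-i) f u).symm
    _ = ∑' u, ∑' v, (adjKernel (-i) v u : ℂ) * (conj (f v) * f u) := hs.tsum_comm.symm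
    _ = ∑' u, conj (∑' v, (adjKernel i u v : ℂ) * (conj (f u) * f v)) :=
        tsum_congr fun u => by
          rw [Complex.conj_tsum]
          exact tsum_congr fun v => hterm u v
    _ = _ := by
      rw [Complex.conj_tsum]
      exact tsum_congr fun u => congrArg conj (tsum_adjKernel i f u)

/-- By Cauchy–Schwarz the Rayleigh quotient of a unit vector differs from `c` by at most the norm of
the error. -/
theorem tsum_adjOp_eq {f : QVertex k → ℂ} {i : ZMod 4} {c : ℂ} (hf : wNorm f = 1)
    (hD : wNorm (fun u => adjOp i f u - c * f u) ≠ ∞) :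
    ‖∑' u, (orbitWeight u : ℂ) * (conj (f u) * adjOp i f u) - c‖ ≤
      (wNorm fun u => adjOp i f u - c * f u).toReal := by
  have hf' : wNorm f ≠ ∞ := by simp [hf]
  have h1 := hasSum_inner_l2Vec f f hf' hf'
  have h2 := hasSum_inner_l2Vec f _ hf' hD
  have h : HasSum (fun u => (orbitWeight u : ℂ) * (conj (f u) * adjOp i f u))
      (inner ℂ (l2Vec f hf') (l2Vec _ hD) + c * inner ℂ (l2Vec f hf') (l2Vec f hf')) :=
    (h2.add (h1.mul_left c)).congr_fun fun u => by ring
  have hn : ‖l2Vec f hf'‖ = 1 := by rw [norm_l2Vec, hf, ENNReal.toReal_one]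
  rw [h.tsum_eq, inner_self_eq_norm_sq_to_K, hn]
  have := norm_inner_le_norm (𝕜 := ℂ) (l2Vec f hf') (l2Vec _ hD)
  rw [hn, norm_l2Vec _ hD, one_mul] at this
  simpa using this

/-- The Rayleigh quotients of the two operators converge to `c` and `d` and are conjugate to each
other. -/
theorem approx_eigenvalue_conj {f : ℕ → QVertex k → ℂ} {i j : ZMod 4} (hij : j = -i) {c d : ℂ}
    (hf : ∀ n, wNorm (f n) = 1)
    (hc : Tendsto (fun n => wNorm fun u => adjOp i (f n) u - c * f n u) atTop (𝓝 0))
    (hd : Tendsto (fun n => wNorm fun u => adjOp j (f n) u - d * f n u) atTop (𝓝 0)) :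
    d = conj c := by
  subst hij
  have key : ∀ {i : ZMod 4} {c : ℂ},
      Tendsto (fun n => wNorm fun u => adjOp i (f n) u - c * f n u) atTop (𝓝 0) →
      Tendsto (fun n => ∑' u, (orbitWeight u : ℂ) * (conj (f n u) * adjOp i (f n) u))
        atTop (𝓝 c) := by
    intro i c h
    have h0 := (ENNReal.tendsto_toReal ENNReal.zero_ne_top).comp h
    have hfin : ∀ᶠ n in atTop, (wNorm fun u => adjOp i (f n) u - c * f n u) ≠ ∞ :=
      (h.eventually (gt_mem_nhds ENNReal.zero_lt_top)).mono fun n hn => hn.ne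
    rw [tendsto_iff_norm_sub_tendsto_zero]
    exact squeeze_zero' (Eventually.of_forall fun n => norm_nonneg _)
      (hfin.mono fun n hn => tsum_adjOp_eq (hf n) hn) h0
  have h1 := key hd
  have h2 := ((Complex.continuous_conj.tendsto c).comp (key hc))
  refine tendsto_nhds_unique h1 (h2.congr fun n => ?_)
  exact (tsum_adjOp_conj i (by simp [hf n])).symm

end Adjoint

end Building
end

/-! ### From the quotient to the Hecke module -/

noncomputable section

namespace Building

/-! ### The transfer to the dominant cone -/

section Transfer

variable {k : Type*} [Field k]

theorem isSymm_comp_coordQ (f : QVertex k → ℂ) : IsSymm (f ∘ coordQ k) := fun i ν =>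
  congrArg f (coordQ_refl i ν)

variable (k) in
/-- The weights of the vertices of the quotient, as a function of the coordinates. -/
def coordWeight (μ : Coweight) : ℝ≥0∞ := ENNReal.ofReal (orbitWeight (coordQ k μ))

/-- The dominant coweights are in bijection with the orbits; values of `G` outside the cone carry no
weight. -/
theorem wNorm_eq_weightedNorm {f : QVertex k → ℂ} {G : Coweight → ℂ}
    (h : ∀ μ ∈ cone, f (coordQ k μ) = G μ) : wNorm f = weightedNorm (coneWeight (coordWeight k)) G := by
  let e : cone ≃ QVertex k := Equiv.ofBijective (fun μ => coordQ k μ)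
    ⟨fun μ μ' h => Subtype.ext (coordQ_injOn μ.2 μ'.2 h), fun u => by
      obtain ⟨μ, hμ, h⟩ := exists_coordQ_eq u
      exact ⟨⟨μ, hμ⟩, h⟩⟩
  rw [wNorm, weightedNorm]
  congr 1
  have hind : (fun μ => ‖G μ‖ₑ ^ 2 * coneWeight (coordWeight k) μ) =
      cone.indicator fun μ => ‖G μ‖ₑ ^ 2 * coordWeight k μ := by
    funext μ
    by_cases hμ : μ ∈ cone
    · rw [Set.indicator_of_mem hμ, coneWeight_of_mem _ hμ]
    · rw [Set.indicator_of_notMem hμ, coneWeight, Set.indicator_of_notMem hμ, mul_zero]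
  rw [hind, ← tsum_subtype, ← e.tsum_eq]
  refine tsum_congr fun μ => ?_
  change ‖f (coordQ k μ)‖ₑ ^ 2 * ENNReal.ofReal (orbitWeight (coordQ k μ)) = _
  rw [h μ μ.2]
  rfl

variable [Fintype k]

variable (k) in
theorem one_lt_card : (1 : ℝ) < Fintype.card k := Nat.one_lt_cast.mpr Fintype.one_lt_card

/-- The bridge between geometry and algebra: the powers of `q` that count points of Schubert cells
are the coefficients of the symmetric functions of the Bernstein elements on invariant functions. -/
theorem polyAct_symPoly_comp_coordQ {q : ℝ} (hq : 1 < q) (hk : q = Fintype.card k) (i : Fin 3)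
    (f : QVertex k → ℂ) {ν : Coweight} (hν : ν ∈ cone) :
    polyAct hq (symPoly i.castSucc) (f ∘ coordQ k) ν =
      (((√q) ^ fundExp i)⁻¹ : ℝ) * adjOp (fundColor i) f (coordQ k ν) := by
  have hq0 : (q : ℂ) ≠ 0 := by exact_mod_cast (zero_lt_one.trans hq).ne'
  have hs : √q ≠ 0 := (Real.sqrt_pos.mpr (zero_lt_one.trans hq)).ne'
  have hsq : q = √q ^ 2 := (Real.sq_sqrt (zero_lt_one.trans hq).le).symm
  have hkc : (q : ℂ) = Fintype.card k := by rw [hk, Complex.ofReal_natCast]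
  have hF := isSymm_comp_coordQ f
  obtain ⟨a, b, c⟩ := ν
  fin_cases i
  · change bernstein _ _ (.X 0 + .X 1 + .X 2 + .X 3) (f ∘ coordQ k) (a, b, c) = _
    have h := heckeY_esymm_one hq0 hF hν
    simp only [map_add, bernstein_X, LinearMap.add_apply, LinearMap.smul_apply, Pi.add_apply,
      Pi.smul_apply, smul_eq_mul] at h ⊢
    rw [← mul_add, ← mul_add, ← mul_add, h]
    refine congrArg₂ (· * ·) rfl (Eq.trans ?_ (adjOp_one_coordQ f hν).symm)
    rw [hkc]
    rfl
  · change bernstein _ _ (.X 0 * .X 1 + .X 0 * .X 2 + .X 0 * .X 3 + .X 1 * .X 2 + .X 1 * .X 3 +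
      .X 2 * .X 3) (f ∘ coordQ k) (a, b, c) = _
    have h := heckeY_esymm_two hq0 hF hν
    simp only [map_add, map_mul, bernstein_X, LinearMap.add_apply, Module.End.mul_apply,
      LinearMap.smul_apply, map_smul, Pi.add_apply, Pi.smul_apply, smul_eq_mul] at h ⊢
    simp only [← mul_add]
    rw [h, ← mul_assoc, ← mul_assoc]
    refine congrArg₂ (· * ·) ?_ (Eq.trans ?_ (adjOp_two_coordQ f hν).symm)
    · rw [normFactor, ← Complex.ofReal_mul, ← Complex.ofReal_mul]
      congr 1
      change _ = ((√q) ^ 4)⁻¹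
      nth_rewrite 3 [hsq]
      field_simp
    · rw [hkc]
      rfl
  · change bernstein _ _ (.X 0 * .X 1 * .X 2 + .X 0 * .X 1 * .X 3 + .X 0 * .X 2 * .X 3 +
      .X 1 * .X 2 * .X 3) (f ∘ coordQ k) (a, b, c) = _
    have h := heckeY_esymm_three hq0 hF hν
    simp only [map_add, map_mul, bernstein_X, LinearMap.add_apply, Module.End.mul_apply,
      LinearMap.smul_apply, map_smul, Pi.add_apply, Pi.smul_apply, smul_eq_mul] at h ⊢
    simp only [← mul_add]
    rw [h, ← mul_assoc, ← mul_assoc, ← mul_assoc]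
    refine congrArg₂ (· * ·) ?_ (Eq.trans ?_ (adjOp_three_coordQ f hν).symm)
    · rw [normFactor, ← Complex.ofReal_mul, ← Complex.ofReal_mul, ← Complex.ofReal_pow,
        ← Complex.ofReal_mul]
      congr 1
      change _ = ((√q) ^ 3)⁻¹
      nth_rewrite 4 [hsq]
      field_simp
    · rw [hkc]
      rfl

theorem sigma_eq_eval (i : Fin 4) (z : Fin 4 → ℂ) :
    sigma ((i : ℕ) + 1) z = MvPolynomial.eval z (symPoly i) := by
  have e1 : Finset.powersetCard 1 (Finset.univ : Finset (Fin 4)) = {{0}, {1}, {2}, {3}} := by decide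
  have e2 : Finset.powersetCard 2 (Finset.univ : Finset (Fin 4)) =
    {{0, 1}, {0, 2}, {0, 3}, {1, 2}, {1, 3}, {2, 3}} := by decide
  have e3 : Finset.powersetCard 3 (Finset.univ : Finset (Fin 4)) =
    {{0, 1, 2}, {0, 1, 3}, {0, 2, 3}, {1, 2, 3}} := by decide
  have e4 : Finset.powersetCard 4 (Finset.univ : Finset (Fin 4)) = {{0, 1, 2, 3}} := by decide
  fin_cases i
  · change sigma 1 z = MvPolynomial.eval z (symPoly 0)
    rw [sigma, e1, eval_symPoly_zero, Finset.sum_insert (by decide), Finset.sum_insert (by decide),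
      Finset.sum_insert (by decide), Finset.sum_singleton]
    simp only [Finset.prod_singleton]
    ring
  · change sigma 2 z = MvPolynomial.eval z (symPoly 1)
    rw [sigma, e2, eval_symPoly_one, Finset.sum_insert (by decide), Finset.sum_insert (by decide),
      Finset.sum_insert (by decide), Finset.sum_insert (by decide), Finset.sum_insert (by decide),
      Finset.sum_singleton, Finset.prod_pair (by decide), Finset.prod_pair (by decide),
      Finset.prod_pair (by decide), Finset.prod_pair (by decide), Finset.prod_pair (by decide),
      Finset.prod_pair (by decide)]
    ring
  · change sigma 3 z = MvPolynomial.eval z (symPoly 2)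
    rw [sigma, e3, eval_symPoly_two, Finset.sum_insert (by decide), Finset.sum_insert (by decide),
      Finset.sum_insert (by decide), Finset.sum_singleton,
      Finset.prod_insert (a := 0) (s := {1, 2}) (by decide),
      Finset.prod_insert (a := 0) (s := {1, 3}) (by decide),
      Finset.prod_insert (a := 0) (s := {2, 3}) (by decide),
      Finset.prod_insert (a := 1) (s := {2, 3}) (by decide), Finset.prod_pair (by decide),
      Finset.prod_pair (by decide), Finset.prod_pair (by decide)]
    ring
  · change sigma 4 z = MvPolynomial.eval z (symPoly 3)
    rw [sigma, e4, eval_symPoly_three, Finset.sum_singleton, Finset.prod_insert (by decide),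
      Finset.prod_insert (by decide), Finset.prod_pair (by decide)]
    ring

theorem rpow_eq_sqrt_pow_fundExp {q : ℝ} (hq : 0 ≤ q) (i : Fin 3) :
    q ^ ((((i : ℕ) + 1 : ℝ) * (4 - ((i : ℕ) + 1 : ℝ))) / 2) = √q ^ fundExp i := by
  rw [Real.sqrt_eq_rpow, ← Real.rpow_natCast, ← Real.rpow_mul hq]
  congr 1
  fin_cases i <;> norm_num [fundExp]

theorem natCast_succ_eq_fundColor (i : Fin 3) : (((i : ℕ) + 1 : ℕ) : ZMod 4) = fundColor i := by
  fin_cases i <;> rfl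

variable {q : ℝ} (hq : 1 < q) (hk : q = Fintype.card k) {z : Fin 4 → ℂ} {f : ℕ → QVertex k → ℂ}

-- Degrees 1 to 3 are the given approximate eigenvalue equations after rescaling; in degree 4 the
-- operator is the identity on invariant functions and the eigenvalue is 1.
include hk in
theorem tendsto_weightedNorm_symPoly (hz : MvPolynomial.eval z (symPoly 3) = 1)
    (hf : ∀ i : Fin 3, Tendsto (fun n => wNorm fun u => adjOp (fundColor i) (f n) u -
      ((√q ^ fundExp i : ℝ) : ℂ) * MvPolynomial.eval z (symPoly i.castSucc) * f n u) atTop (𝓝 0))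
    (j : Fin 4) : Tendsto (fun n => weightedNorm (coneWeight (coordWeight k))
      (polyAct hq (symPoly j) (f n ∘ coordQ k) -
        MvPolynomial.eval z (symPoly j) • (f n ∘ coordQ k))) atTop (𝓝 0) := by
  induction j using Fin.lastCases with
  | last =>
    refine tendsto_const_nhds.congr fun n => ?_
    change 0 = weightedNorm _ (polyAct hq (symPoly 3) _ - MvPolynomial.eval z (symPoly 3) • _)
    rw [polyAct_symPoly_three hq (isSymm_comp_coordQ _), hz, one_smul, sub_self, weightedNorm_zero]
  | cast i =>
    have hs : ((√q ^ fundExp i : ℝ) : ℂ) ≠ 0 := Complex.ofReal_ne_zero.mpr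
      (pow_ne_zero _ (Real.sqrt_pos.mpr (zero_lt_one.trans hq)).ne')
    have h := ENNReal.Tendsto.const_mul (a := ‖((√q ^ fundExp i : ℝ) : ℂ)⁻¹‖ₑ) (hf i)
      (Or.inr enorm_ne_top)
    rw [mul_zero] at h
    refine h.congr fun n => ?_
    rw [wNorm_eq_weightedNorm (G := ((√q ^ fundExp i : ℝ) : ℂ) •
      (polyAct hq (symPoly i.castSucc) (f n ∘ coordQ k) -
        MvPolynomial.eval z (symPoly i.castSucc) • (f n ∘ coordQ k))), ← weightedNorm_smul,
      inv_smul_smul₀ hs]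
    intro μ hμ
    rw [Pi.smul_apply, Pi.sub_apply, polyAct_symPoly_comp_coordQ hq hk i (f n) hμ, Pi.smul_apply,
      Function.comp_apply, smul_eq_mul, smul_eq_mul, Complex.ofReal_inv]
    field_simp

open scoped ComplexConjugate

/-- Modulo 4 the colors 1 and 3 are opposite and 2 is its own opposite, so adjointness relates the
first and third symmetric functions and makes the second real. -/
theorem isHermitianTuple_of_tendsto (hq : 1 < q) (hz : MvPolynomial.eval z (symPoly 3) = 1)
    (h1 : ∀ n, wNorm (f n) = 1)
    (hf : ∀ i : Fin 3, Tendsto (fun n => wNorm fun u => adjOp (fundColor i) (f n) u -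
      ((√q ^ fundExp i : ℝ) : ℂ) * MvPolynomial.eval z (symPoly i.castSucc) * f n u)
        atTop (𝓝 0)) : IsHermitianTuple z := by
  have hs : ∀ i : Fin 3, ((√q ^ fundExp i : ℝ) : ℂ) ≠ 0 := fun i => Complex.ofReal_ne_zero.mpr
    (pow_ne_zero _ (Real.sqrt_pos.mpr (zero_lt_one.trans hq)).ne')
  have h02 := approx_eigenvalue_conj (by decide) h1 (hf 0) (hf 2)
  have h11 := approx_eigenvalue_conj (by decide) h1 (hf 1) (hf 1)
  rw [map_mul, Complex.conj_ofReal] at h02 h11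
  exact ⟨hz, mul_left_cancel₀ (hs 0) h02, (mul_left_cancel₀ (hs 1) h11).symm⟩

include hk in
theorem exists_isPartitionForm_of_tendsto (hq : 1 < q) (hz : MvPolynomial.eval z (symPoly 3) = 1)
    (h1 : ∀ n, wNorm (f n) = 1)
    (hf : ∀ i : Fin 3, Tendsto (fun n => wNorm fun u => adjOp (fundColor i) (f n) u -
      ((√q ^ fundExp i : ℝ) : ℂ) * MvPolynomial.eval z (symPoly i.castSucc) * f n u)
        atTop (𝓝 0)) : ∃ p : Equiv.Perm (Fin 4), IsPartitionForm q (z ∘ p) := by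
  have hm : HeckeWeight q (coordWeight k) := hk ▸ heckeWeight_orbitWeight k
  obtain ⟨wt, w1, w2, w3, w4⟩ := exists_weights hq hm (fun n => isSymm_comp_coordQ (f n))
    (fun n => (wNorm_eq_weightedNorm fun _ _ => rfl).symm.trans (h1 n))
    (tendsto_weightedNorm_symPoly hq hk hz hf)
  exact exists_isPartitionForm hq (isHermitianTuple_of_tendsto hq hz h1 hf) ⟨w1, w2, w3, w4⟩

end Transfer

end Building
end
-- The main theorem
theorem theorem1p2 {k : Type*} [Field k] [Fintype k] (q : ℝ) (hq : q = Fintype.card k)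
    (lam : Fin 3 → ℂ) (hlam : lam ∈ Building.automorphicSpectrum k)
    (z : Fin 4 → ℂ) (hz : Building.sigma 4 z = 1)
    (hpar : ∀ i : Fin 3, lam i =
      ((q ^ ((((i : ℕ) + 1 : ℝ) * (4 - ((i : ℕ) + 1 : ℝ))) / 2) : ℝ) : ℂ)
        * Building.sigma ((i : ℕ) + 1) z) :
    (∃ p : Equiv.Perm (Fin 4),
      ((∃ j : Fin 4, z ∘ p =
          ![((q * √q : ℝ) : ℂ) * Complex.I ^ (j : ℕ), ((√q : ℝ) : ℂ) * Complex.I ^ (j : ℕ),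
            ((1 / √q : ℝ) : ℂ) * Complex.I ^ (j : ℕ),
            ((1 / (q * √q) : ℝ) : ℂ) * Complex.I ^ (j : ℕ)]) ∧
        Building.moduli z = Building.partitionModuli q {4}) ∨
      ((∃ θ : ℝ, z ∘ p =
          ![(q : ℂ) * Complex.exp (θ * Complex.I), Complex.exp (θ * Complex.I),
            Complex.exp (-3 * θ * Complex.I), ((1 / q : ℝ) : ℂ) * Complex.exp (θ * Complex.I)]) ∧
        Building.moduli z = Building.partitionModuli q {3, 1}) ∨
      ((∃ θ : ℝ, ∃ ε : ℂ, (ε = 1 ∨ ε = -1) ∧ z ∘ p =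
          ![((√q : ℝ) : ℂ) * Complex.exp (θ * Complex.I),
            ε * ((√q : ℝ) : ℂ) * Complex.exp (-θ * Complex.I),
            ((1 / √q : ℝ) : ℂ) * Complex.exp (θ * Complex.I),
            ε * ((1 / √q : ℝ) : ℂ) * Complex.exp (-θ * Complex.I)]) ∧
        Building.moduli z = Building.partitionModuli q {2, 2}) ∨
      ((∃ θ₁ θ₂ : ℝ, z ∘ p =
          ![((√q : ℝ) : ℂ) * Complex.exp (θ₁ * Complex.I), Complex.exp (θ₂ * Complex.I),
            Complex.exp (-(θ₂ + 2 * θ₁) * Complex.I),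
            ((1 / √q : ℝ) : ℂ) * Complex.exp (θ₁ * Complex.I)]) ∧
        Building.moduli z = Building.partitionModuli q {2, 1, 1}) ∨
      ((∃ θ₁ θ₂ θ₃ : ℝ, z ∘ p =
          ![Complex.exp (θ₁ * Complex.I), Complex.exp (θ₂ * Complex.I),
            Complex.exp (θ₃ * Complex.I), Complex.exp (-(θ₁ + θ₂ + θ₃) * Complex.I)]) ∧
        Building.moduli z = Building.partitionModuli q {1, 1, 1, 1})) ∧
    Function.Injective (fun P : Nat.Partition 4 => Building.partitionModuli q P.parts) := by
  have hq1 : 1 < q := hq ▸ Building.one_lt_card k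
  obtain ⟨f, h1, hf⟩ := hlam
  have hz' : MvPolynomial.eval z (Building.symPoly 3) = 1 := (Building.sigma_eq_eval 3 z) ▸ hz
  obtain ⟨p, hp⟩ := Building.exists_isPartitionForm_of_tendsto hq hq1 hz' h1 fun i => by
    have h := hf i
    rwa [hpar i, Building.natCast_succ_eq_fundColor,
      Building.rpow_eq_sqrt_pow_fundExp (zero_lt_one.trans hq1).le,
      show Building.sigma ((i : ℕ) + 1) z = _ from Building.sigma_eq_eval i.castSucc z] at h
  refine ⟨⟨p, ?_⟩, Building.partitionModuli_injective hq1⟩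
  rwa [Building.IsPartitionForm, Building.moduli_comp_perm] at hp
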